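/- Let $S^1=\mathbb R/\mathbb Z$. For $r>1/2$ let $H^r(S^1)$ be the Sobolev space of real functions on $S^1$ (continuous, by the Sobolev embedding), and let $H^r_0(S^1)=\{f\in H^r(S^1): f(0)=0\}$. Let $s>5/2$ and $\kappa\in\{1,-1\}$. Let $\mathrm{Diff}^s_0(S^1)$ be the set of orientation-preserving diffeomorphisms $\varphi$ of $S^1$ of class $H^s$ with $\varphi(0)=0$; identified with their lifts to $\mathbb R$ that fix $0$, these are the maps $\varphi$ with $\varphi-\mathrm{id}\in H^s_0(S^1)$ and $\varphi_x>0$, so that $G^s=\mathrm{Diff}^s_0(S^1)\times H^{s-1}(S^1)$ is, via $(\varphi,\alpha)\mapsto(\varphi-\mathrm{id},\alpha)$, an open subset of the Banach space $H^s_0(S^1)\times H^{s-1}(S^1)$, which is also the tangent space at every point. Equip $G^s$, with the group law $(\varphi,\alpha)(\psi,\beta)=(\varphi\circ\psi,\ \beta+\alpha\circ\psi)$, with the right-invariant metric $$\langle U,V\rangle_{(\varphi,\alpha)}=\frac14\int_{S^1}\bigl(u_{1x}v_{1x}+\kappa\,u_2v_2\bigr)\,dx,\qquad (u_1,u_2)=(U_1\circ\varphi^{-1},U_2\circ\varphi^{-1}),\quad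 (v_1,v_2)=(V_1\circ\varphi^{-1},V_2\circ\varphi^{-1}).$$ Let $A=-\partial_x^2$, with inverse $$(A^{-1}f)(x)=-\int_0^x\!\int_0^y f(z)\,dz\,dy+x\int_0^1\!\int_0^y f(z)\,dz\,dy\qquad\text{for } \int_{S^1} f\,dx=0 .$$ Let $J\subset\mathbb R$ be an open interval, let $(\varphi,\alpha):J\to G^s$ be a $C^2$ curve, and put $(u,\rho)=(\varphi_t\circ\varphi^{-1},\ \alpha_t\circ\varphi^{-1})$. Then $$(u,\rho)\in C\bigl(J;H^s_0(S^1)\times H^{s-1}(S^1)\bigr)\cap C^1\bigl(J;H^{s-1}_0(S^1)\times H^{s-2}(S^1)\bigr),$$ and the following are equivalent: 1. $(\varphi,\alpha)$ is a geodesic of the metric on $J$: its Levi-Civita acceleration vanishes, that is, writing $c=(\varphi,\alpha)$ and $D_X$ for the derivative with respect to the base point in the direction $X$, $$\langle c_{tt},Z\rangle_c+(D_{c_t}\langle\cdot,\cdot\rangle)_c(c_t,Z)-\tfrac12(D_Z\langle\cdot,\cdot\rangle)_c(c_t,c_t)=0\qquad\text{for all } t\in J,\ Z\in H^s_0(S^1)\times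 H^{s-1}(S^1).$$ 2. $(\varphi,\alpha)$ satisfies $(\varphi_{tt},\alpha_{tt})=\Gamma_{(\varphi,\alpha)}\bigl((\varphi_t,\alpha_t),(\varphi_t,\alpha_t)\bigr)$ on $J$, where $\Gamma_{(\varphi,\alpha)}(U,V)=\Gamma_{(\mathrm{id},0)}(U\circ\varphi^{-1},V\circ\varphi^{-1})\circ\varphi$ and $$\Gamma_{(\mathrm{id},0)}\bigl((u,\rho),(v,\sigma)\bigr)=\Bigl(-\tfrac12A^{-1}\partial_x(u_xv_x+\kappa\rho\sigma),\ -\tfrac12(u_x\sigma+v_x\rho)\Bigr).$$ 3. For all $t\in J$, $(u,\rho)$ satisfies the weak (nonlocal) form of the two-component Hunter–Saxton system $$u_t+uu_x=-\tfrac12A^{-1}\partial_x\bigl(u_x^2+\kappa\rho^2\bigr),\qquad \rho_t+u\rho_x=-\rho u_x .$$ -/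

import Mathlib

noncomputable section

/-! ### Sobolev spaces on the circle `S¹ = ℝ/ℤ` -/

/-- The sequence `(1 + k²)^{s/2} f̂(k)`, `k ∈ ℤ`, for a continuous real function `f` on the circle. -/
def weightedCoeff (s : ℝ) (f : C(UnitAddCircle, ℝ)) (k : ℤ) : ℂ :=
  (((1 + (k : ℝ) ^ 2) ^ (s / 2) : ℝ) : ℂ) * fourierCoeff (fun x => ((f x : ℝ) : ℂ)) k

theorem integrable_fourier_smul (f : C(UnitAddCircle, ℝ)) (k : ℤ) :
    MeasureTheory.Integrable
      (fun x : UnitAddCircle => fourier (-k) x • ((f x : ℝ) : ℂ)) AddCircle.haarAddCircle := by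
  have h : Continuous (fun x : UnitAddCircle => fourier (-k) x • ((f x : ℝ) : ℂ)) := by
    fun_prop
  exact h.integrable_of_hasCompactSupport (HasCompactSupport.of_compactSpace _)

theorem weightedCoeff_add (s : ℝ) (f g : C(UnitAddCircle, ℝ)) :
    weightedCoeff s (f + g) = weightedCoeff s f + weightedCoeff s g := by
  funext k
  simp only [weightedCoeff, Pi.add_apply, fourierCoeff, ContinuousMap.add_apply,
    Complex.ofReal_add, smul_add]
  rw [MeasureTheory.integral_add (integrable_fourier_smul f k) (integrable_fourier_smul g k)]
  ring

theorem weightedCoeff_smul (s a : ℝ) (f : C(UnitAddCircle, ℝ)) :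
    weightedCoeff s (a • f) = a • weightedCoeff s f := by
  funext k
  have h : (fun x : UnitAddCircle => fourier (-k) x • (((a • f) x : ℝ) : ℂ)) =
      fun x => (a : ℂ) * (fourier (-k) x • ((f x : ℝ) : ℂ)) := by
    funext x
    simp only [ContinuousMap.smul_apply, smul_eq_mul, Complex.ofReal_mul]
    ring
  simp only [weightedCoeff, Pi.smul_apply, fourierCoeff, Complex.real_smul]
  rw [h, MeasureTheory.integral_const_mul]
  ring

/-- The functions in `H^s(S¹)` as a linear subspace of the continuous functions.  Only orders
`s > 1/2` are used; there every class in `H^s(S¹)` has exactly one continuous representative, so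
this is the usual space of real functions with `∑ (1 + k²)^s |f̂(k)|² < ∞`. -/
def sobolevSubmodule (s : ℝ) : Submodule ℝ C(UnitAddCircle, ℝ) where
  carrier := {f | Memℓp (weightedCoeff s f) 2}
  add_mem' {f g} hf hg := by
    simp only [Set.mem_ofPred_eq, weightedCoeff_add] at *
    exact hf.add hg
  zero_mem' := by
    have h : weightedCoeff s 0 = 0 := by
      have := weightedCoeff_smul s 0 0
      simpa using this
    simp only [Set.mem_ofPred_eq, h]
    exact zero_memℓp
  smul_mem' a f hf := by
    simp only [Set.mem_ofPred_eq, weightedCoeff_smul] at *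
    exact hf.const_smul a

/-- The Sobolev space `H^s(S¹)` of real functions (`s > 1/2`). It is a type of its own, so that it
carries the Sobolev norm and not the supremum norm. -/
def Hs (s : ℝ) : Type := sobolevSubmodule s

instance (s : ℝ) : AddCommGroup (Hs s) := inferInstanceAs (AddCommGroup (sobolevSubmodule s))

instance (s : ℝ) : Module ℝ (Hs s) := inferInstanceAs (Module ℝ (sobolevSubmodule s))

/-- The isometric embedding `f ↦ ((1 + k²)^{s/2} f̂(k))_k` of `H^s(S¹)` into `ℓ²(ℤ; ℂ)`. -/
def Hs.toL2 (s : ℝ) : Hs s →ₗ[ℝ] lp (fun _ : ℤ => ℂ) 2 where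
  toFun f := ⟨weightedCoeff s f.1, f.2⟩
  map_add' f g := Subtype.ext (weightedCoeff_add s f.1 g.1)
  map_smul' a f := Subtype.ext (weightedCoeff_smul s a f.1)

theorem Hs.toL2_injective (s : ℝ) : Function.Injective (Hs.toL2 s) := by
  rw [injective_iff_map_eq_zero]
  intro f hf
  have h0 : ∀ k : ℤ, fourierCoeff (fun x => ((f.1 x : ℝ) : ℂ)) k = 0 := by
    intro k
    have h1 : weightedCoeff s f.1 k = 0 := congrFun (congrArg Subtype.val hf) k
    have h2 : (((1 + (k : ℝ) ^ 2) ^ (s / 2) : ℝ) : ℂ) ≠ 0 := by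
      have : 0 < (1 + (k : ℝ) ^ 2) ^ (s / 2) := Real.rpow_pos_of_pos (by positivity) _
      exact_mod_cast this.ne'
    exact (mul_eq_zero.mp h1).resolve_left h2
  let g : C(UnitAddCircle, ℂ) := ⟨fun x => ((f.1 x : ℝ) : ℂ), by fun_prop⟩
  have hs : HasSum (fun i : ℤ => fourierCoeff g i • fourier i) g :=
    hasSum_fourier_series_of_summable (by
      have : fourierCoeff g = fun _ => 0 := funext h0
      rw [this]; exact summable_zero)
  have hg : g = 0 := by
    refine hs.unique ?_
    have : (fun i : ℤ => fourierCoeff g i • (fourier i : C(UnitAddCircle, ℂ))) = fun _ => 0 := by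
      funext i
      rw [show fourierCoeff g i = 0 from h0 i]; exact ContinuousMap.ext fun x => zero_mul (fourier i x)
    rw [this]
    exact hasSum_zero
  refine Subtype.ext (ContinuousMap.ext fun x => ?_)
  have hx : ((f.1 x : ℝ) : ℂ) = 0 := congrArg (fun q : C(UnitAddCircle, ℂ) => q x) hg
  exact_mod_cast hx

/-- The Sobolev norm `‖f‖² = ∑ (1 + k²)^s |f̂(k)|²`. -/
instance (s : ℝ) : NormedAddCommGroup (Hs s) :=
  NormedAddCommGroup.induced (Hs s) (lp (fun _ : ℤ => ℂ) 2) (Hs.toL2 s) (Hs.toL2_injective s)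

instance (s : ℝ) : NormedSpace ℝ (Hs s) :=
  NormedSpace.induced ℝ (Hs s) (lp (fun _ : ℤ => ℂ) 2) (Hs.toL2 s)

/-- A Sobolev function seen as a `1`-periodic function on `ℝ`. -/
def Hs.per {s : ℝ} (f : Hs s) : ℝ → ℝ := fun x => f.1 (x : UnitAddCircle)

/-- `H_0^s(S¹)`: the functions of `H^s(S¹)` that vanish at the point `0`, with the same norm. -/
def H0 (s : ℝ) : Submodule ℝ (Hs s) where
  carrier := {f | f.per 0 = 0}
  add_mem' {f g} hf hg := by
    change f.1 _ + g.1 _ = 0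
    change f.1 _ = 0 at hf
    change g.1 _ = 0 at hg
    rw [hf, hg, add_zero]
  zero_mem' := rfl
  smul_mem' a f hf := by
    change a * f.1 _ = 0
    change f.1 _ = 0 at hf
    rw [hf, mul_zero]

/-- The pair of `1`-periodic functions given by an element of `H_0^a(S¹) × H^b(S¹)`. -/
def pairFun {a b : ℝ} (X : H0 a × Hs b) : (ℝ → ℝ) × (ℝ → ℝ) := (X.1.1.per, X.2.per)

/-! ### The group `G^s = Diff_0^s(S¹) ⓢ H^{s-1}(S¹)` -/

/-- The lift `φ(x) = x + h(x)` to `ℝ` of the circle map with displacement `h`. -/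
def diffeo {s : ℝ} (c : H0 s × Hs (s - 1)) : ℝ → ℝ := fun x => x + c.1.1.per x

/-- The inverse `φ⁻¹` of the lift. -/
def diffeoInv {s : ℝ} (c : H0 s × Hs (s - 1)) : ℝ → ℝ := Function.invFun (diffeo c)

/-- `G^s` in its global chart: a pair `(φ, α)` is represented by `(φ - id, α)`, which ranges over
the subset of the Banach space `H_0^s(S¹) × H^{s-1}(S¹)` given by `φ_x > 0`.  (For `s > 3/2` this
set is open, and the `φ` with `φ - id ∈ H_0^s(S¹)` and `φ_x > 0` are exactly the lifts fixing `0` of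
the orientation-preserving `H^s` diffeomorphisms of the circle that fix `0`.)  All tangent spaces
are `H_0^s(S¹) × H^{s-1}(S¹)`. -/
def Gs (s : ℝ) : Set (H0 s × Hs (s - 1)) := {c | ∀ x : ℝ, 0 < deriv (diffeo c) x}

/-- Right translation of a tangent vector at `(φ, α)` to the identity: `U ↦ (U₁ ∘ φ⁻¹, U₂ ∘ φ⁻¹)`. -/
def toIdentity {s : ℝ} (c U : H0 s × Hs (s - 1)) : (ℝ → ℝ) × (ℝ → ℝ) :=
  ((pairFun U).1 ∘ diffeoInv c, (pairFun U).2 ∘ diffeoInv c)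

/-- The inner product at the identity, `¼ ∫ (u₁ₓ v₁ₓ + κ u₂ v₂) dx`. -/
def metricId (κ : ℝ) (u v : (ℝ → ℝ) × (ℝ → ℝ)) : ℝ :=
  1 / 4 * ∫ x in (0 : ℝ)..1, (deriv u.1 x * deriv v.1 x + κ * (u.2 x * v.2 x))

/-- The right-invariant metric on `G^s`. -/
def metric (κ : ℝ) {s : ℝ} (c U V : H0 s × Hs (s - 1)) : ℝ :=
  metricId κ (toIdentity c U) (toIdentity c V)

/-- The derivative at `c`, in the direction `X`, of the metric coefficient `⟨Y, Z⟩`. -/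
def metricDeriv (κ : ℝ) {s : ℝ} (c X Y Z : H0 s × Hs (s - 1)) : ℝ :=
  deriv (fun ε : ℝ => metric κ (c + ε • X) Y Z) 0

/-- Koszul's formula for the Levi-Civita derivative in the chart: the value `⟨∇_X Y, Z⟩` at `c` for
constant vector fields `X, Y, Z` (the Christoffel symbols of the first kind). -/
def christoffelFirst (κ : ℝ) {s : ℝ} (c X Y Z : H0 s × Hs (s - 1)) : ℝ :=
  1 / 2 * (metricDeriv κ c X Y Z + metricDeriv κ c Y X Z - metricDeriv κ c Z X Y)

/-- The curve `c` is a geodesic of the metric on `J`: its Levi-Civita acceleration `∇_{c_t} c_t`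
vanishes, i.e. `⟨∇_{c_t} c_t, Z⟩ = ⟨c_tt, Z⟩ + Γ(c_t, c_t; Z) = 0` for all tangent vectors `Z`. -/
def IsMetricGeodesic (κ : ℝ) {s : ℝ} (c : ℝ → H0 s × Hs (s - 1)) (J : Set ℝ) : Prop :=
  ∀ t ∈ J, ∀ Z : H0 s × Hs (s - 1),
    metric κ (c t) (deriv (deriv c) t) Z + christoffelFirst κ (c t) (deriv c t) (deriv c t) Z = 0

/-! ### The Hunter–Saxton system -/

/-- The inverse of `A = -∂ₓ²`:
`(A⁻¹f)(x) = -∫₀ˣ ∫₀ʸ f(z) dz dy + x ∫₀¹ ∫₀ʸ f(z) dz dy` for `f` of mean zero. -/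
def Ainv (f : ℝ → ℝ) (x : ℝ) : ℝ :=
  -(∫ y in (0 : ℝ)..x, ∫ z in (0 : ℝ)..y, f z) + x * ∫ y in (0 : ℝ)..1, ∫ z in (0 : ℝ)..y, f z

/-- The Christoffel operator at the identity,
`Γ((u, ρ), (v, σ)) = (-½ A⁻¹∂ₓ(uₓ vₓ + κ ρ σ), -½ (uₓ σ + vₓ ρ))`. -/
def christoffelId (κ : ℝ) (q r : (ℝ → ℝ) × (ℝ → ℝ)) : (ℝ → ℝ) × (ℝ → ℝ) :=
  (fun x => -(1 / 2) * Ainv (deriv fun y => deriv q.1 y * deriv r.1 y + κ * (q.2 y * r.2 y)) x,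
   fun x => -(1 / 2) * (deriv q.1 x * r.2 x + deriv r.1 x * q.2 x))

/-- The Christoffel operator at `c = (φ, α)`, extended by right invariance:
`Γ_{(φ, α)}(U, V) = Γ_{(id, 0)}(U ∘ φ⁻¹, V ∘ φ⁻¹) ∘ φ`. -/
def christoffel (κ : ℝ) {s : ℝ} (c U V : H0 s × Hs (s - 1)) : (ℝ → ℝ) × (ℝ → ℝ) :=
  ((christoffelId κ (toIdentity c U) (toIdentity c V)).1 ∘ diffeo c,
   (christoffelId κ (toIdentity c U) (toIdentity c V)).2 ∘ diffeo c)

/-- The curve `c` is a geodesic on `J` with respect to the Christoffel operator: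
`(φ_tt, α_tt) = Γ_{(φ, α)}((φ_t, α_t), (φ_t, α_t))`. -/
def IsChristoffelGeodesic (κ : ℝ) {s : ℝ} (c : ℝ → H0 s × Hs (s - 1)) (J : Set ℝ) : Prop :=
  ∀ t ∈ J, pairFun (deriv (deriv c) t) = christoffel κ (c t) (deriv c t) (deriv c t)

/-- The Eulerian velocity `(u, ρ) = (φ_t ∘ φ⁻¹, α_t ∘ φ⁻¹)` at time `t`. -/
def eulerian {s : ℝ} (c : ℝ → H0 s × Hs (s - 1)) (t : ℝ) : (ℝ → ℝ) × (ℝ → ℝ) :=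
  toIdentity (c t) (deriv c t)

/-- The weak (nonlocal) form of the Hunter–Saxton system at one instant, for `q = (u, ρ)` and
`q' = (u_t, ρ_t)`:
`u_t + u uₓ = -½ A⁻¹∂ₓ(uₓ² + κ ρ²)` and `ρ_t + u ρₓ = -ρ uₓ`. -/
def WeakHunterSaxton (κ : ℝ) (q q' : (ℝ → ℝ) × (ℝ → ℝ)) : Prop :=
  ∀ x : ℝ,
    q'.1 x + q.1 x * deriv q.1 x =
        -(1 / 2) * Ainv (deriv fun y => deriv q.1 y ^ 2 + κ * q.2 y ^ 2) x ∧
      q'.2 x + q.1 x * deriv q.2 x = -(q.2 x * deriv q.1 x)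

end

/-! Equivalence. Fix a time and write U = c_t, V = c_tt, R = 1/φ_x. The substitution y = φ(x) turns
the metric into ¼∫(Y₁'Z₁'/φ_x + κ Y₂Z₂φ_x) dx (`metric_eq`), which depends on the base point only
through φ_x, so its derivative along the base point is explicit (`metricDeriv_eq`). Koszul's formula
then gives the acceleration tested against Z as ¼∫(Z₁'P + κ Z₂Q) dx, with P = V₁'R - ½((U₁'R)² +
κU₂²) and Q = V₂φ_x + U₂U₁' (`metric_add_christoffelFirst_eq`). Since Z₁' ranges over mean-zero
functions and Z₂ is free, vanishing for all Z means that Q = 0 and P is constant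
(`forall_metric_eq_zero_iff`).

On the Eulerian side u_t + uu_x = φ_tt ∘ φ⁻¹ and ρ_t + uρ_x = α_tt ∘ φ⁻¹. The function -½A⁻¹∂_x g is
the one that vanishes at 0 and has derivative ½(g - ∫g), so the first equation of the weak system
says that P ∘ φ⁻¹ is constant (`acceleration_eq_iff`), and the second says that Q = 0
(`weakHunterSaxton_iff`). The Christoffel form is the weak system composed with φ
(`eq_christoffel_iff`).

Regularity. The main analytic work is the joint continuity of (f, φ) ↦ f ∘ φ⁻¹ in H^r for 0 < r ≤ s.
Composition operators are bounded on H^r uniformly over families of φ (`exists_sn_T_le`): for 0 < r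
< 2 by interpolation between L² and H² (`sn_interpolation`), and for larger r by induction through
(f ∘ φ⁻¹)' = (f'R) ∘ φ⁻¹, the algebra property `sn_mul_le` and closure under reciprocals
`sn_recip_ne_top`. Uniform bounds and density of smooth functions give continuity
(`CircleDiffeo.Converges.tendsto_sn_T_joint`). For the C¹ statement, (u, ρ) is differentiated in
time at each point of the circle; the resulting derivative is continuous into H^{s-1} × H^{s-2}, and
integrating it back shows that it is the derivative in norm (`hasDerivAt_of_separating`).

All estimates use `sn`, the squared Sobolev norm with values in [0, ∞], so that sums may be
rearranged without summability conditions; finiteness is carried separately. -/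

open scoped ENNReal Topology ComplexConjugate
open Filter Set MeasureTheory

/-! ### Fourier coefficients of real continuous functions on the circle -/

/-- The complexification of a real continuous function on the circle. -/
def toComplexMap (f : C(UnitAddCircle, ℝ)) : C(UnitAddCircle, ℂ) :=
  ⟨fun x => ((f x : ℝ) : ℂ), by fun_prop⟩

/-- The `k`-th Fourier coefficient of a real continuous function on the circle. -/
noncomputable def fc (f : C(UnitAddCircle, ℝ)) (k : ℤ) : ℂ :=
  fourierCoeff (fun x => ((f x : ℝ) : ℂ)) k

theorem weightedCoeff_eq_fc (s : ℝ) (f : C(UnitAddCircle, ℝ)) (k : ℤ) :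
    weightedCoeff s f k = (((1 + (k : ℝ) ^ 2) ^ (s / 2) : ℝ) : ℂ) * fc f k := rfl

theorem weightedCoeff_zero_eq_fc (f : C(UnitAddCircle, ℝ)) : weightedCoeff 0 f = fc f := by
  funext k
  simp [weightedCoeff, fc]

theorem fc_add (f g : C(UnitAddCircle, ℝ)) (k : ℤ) : fc (f + g) k = fc f k + fc g k := by
  rw [← weightedCoeff_zero_eq_fc, weightedCoeff_add, weightedCoeff_zero_eq_fc,
    weightedCoeff_zero_eq_fc, Pi.add_apply]

theorem fc_smul (a : ℝ) (f : C(UnitAddCircle, ℝ)) (k : ℤ) : fc (a • f) k = a * fc f k := by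
  rw [← weightedCoeff_zero_eq_fc, weightedCoeff_smul, weightedCoeff_zero_eq_fc, Pi.smul_apply,
    Complex.real_smul]

theorem fc_sub (f g : C(UnitAddCircle, ℝ)) (k : ℤ) : fc (f - g) k = fc f k - fc g k := by
  rw [eq_sub_iff_add_eq, ← fc_add, sub_add_cancel]

theorem fc_neg_index (f : C(UnitAddCircle, ℝ)) (k : ℤ) : fc f (-k) = conj (fc f k) := by
  unfold fc fourierCoeff
  rw [← integral_conj]
  congr 1
  funext t
  rw [smul_eq_mul, smul_eq_mul, map_mul, Complex.conj_ofReal, ← fourier_neg, neg_neg]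

/-- The Fourier coefficient as a continuous linear functional. -/
noncomputable def fourierCoeffCLM (n : ℤ) : C(UnitAddCircle, ℂ) →L[ℂ] ℂ :=
  (innerSL ℂ (fourierLp (T := (1 : ℝ)) 2 n)).comp
    (ContinuousMap.toLp (E := ℂ) 2 AddCircle.haarAddCircle ℂ)

theorem fourierCoeffCLM_apply (n : ℤ) (G : C(UnitAddCircle, ℂ)) :
    fourierCoeffCLM n G = fourierCoeff G n := by
  rw [← fourierCoeff_toLp, ← fourierBasis_repr, HilbertBasis.repr_apply_apply, coe_fourierBasis]
  rfl

/-- A continuous functional may be applied to the series term by term, and orthogonality of the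
characters leaves a single term. -/
theorem fourierCoeff_eq_of_hasSum {a : ℤ → ℂ} {G : C(UnitAddCircle, ℂ)}
    (h : HasSum (fun k => a k • (fourier k : C(UnitAddCircle, ℂ))) G) (n : ℤ) :
    fourierCoeff G n = a n := by
  have h2 := h.mapL (fourierCoeffCLM n)
  rw [fourierCoeffCLM_apply] at h2
  have he : (fun k => fourierCoeffCLM n (a k • (fourier k : C(UnitAddCircle, ℂ)))) =
      fun k => if k = n then a n else 0 := by
    funext k
    rw [map_smul, fourierCoeffCLM_apply, fourierCoeff_fourier]
    by_cases hk : k = n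
    · simp [hk]
    · simp [hk, Ne.symm hk]
  rw [he] at h2
  exact h2.unique (hasSum_ite_eq n (a n))

/-- A summable conjugation-symmetric sequence is the sequence of Fourier coefficients of a real
continuous function. -/
theorem exists_fc_eq {a : ℤ → ℂ} (hs : Summable fun k => ‖a k‖)
    (ha : ∀ k, a (-k) = conj (a k)) :
    ∃ g : C(UnitAddCircle, ℝ), ∀ k, fc g k = a k := by
  have hsum : Summable (fun k => a k • (fourier k : C(UnitAddCircle, ℂ))) := by
    refine Summable.of_norm ?_
    simpa [norm_smul, fourier_norm] using hs
  obtain ⟨G, hG⟩ := hsum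
  have hx : ∀ x, HasSum (fun k => a k * fourier k x) (G x) := fun x => by
    have := hG.mapL (ContinuousMap.evalCLM ℂ x)
    exact this
  -- Conjugating the series is the same as reindexing it by k ↦ -k, so the sum is real.
  have hreal : ∀ x, conj (G x) = G x := fun x => by
    have h1 := (hx x).map (starRingEnd ℂ) Complex.continuous_conj
    have h2 := (Equiv.neg ℤ).hasSum_iff.mpr (hx x)
    refine h1.unique ?_
    convert h2 using 1
    funext k
    simp only [Function.comp, map_mul, Equiv.neg_apply]
    rw [← ha, ← fourier_neg]
  refine ⟨⟨fun x => (G x).re, by fun_prop⟩, fun k => ?_⟩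
  rw [← fourierCoeff_eq_of_hasSum hG k]
  unfold fc
  congr 1
  funext x
  exact Complex.conj_eq_iff_re.mp (hreal x)

theorem hasSum_fc {f : C(UnitAddCircle, ℝ)} (hs : Summable fun k => ‖fc f k‖)
    (x : UnitAddCircle) : HasSum (fun k => fc f k * fourier k x) ((f x : ℝ) : ℂ) :=
  has_pointwise_sum_fourier_series_of_summable (f := toComplexMap f)
    (show Summable (fc f) from hs.of_norm) x

theorem eq_of_fc_eq {f g : C(UnitAddCircle, ℝ)} (h : ∀ k, fc f k = fc g k) : f = g := by
  have h0 : ∀ k, fc (f - g) k = 0 := fun k => by rw [fc_sub, h, sub_self]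
  have hs := hasSum_fc (f := f - g) (by simp [h0, summable_zero])
  ext x
  have h1 := hs x
  simp only [h0, zero_mul] at h1
  have := h1.unique hasSum_zero
  rw [Complex.ofReal_eq_zero, ContinuousMap.sub_apply] at this
  linarith

/-! ### Differentiation on the Fourier side -/

/-- `g` is the derivative of `f`, both regarded as periodic functions on the line. -/
def IsDer (f g : C(UnitAddCircle, ℝ)) : Prop :=
  ∀ x : ℝ, HasDerivAt (fun y : ℝ => f (y : UnitAddCircle)) (g (x : UnitAddCircle)) x

theorem continuous_coe_circle (f : C(UnitAddCircle, ℝ)) :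
    Continuous fun x : ℝ => f (x : UnitAddCircle) :=
  f.continuous.comp (AddCircle.continuous_mk' 1)

theorem fc_eq_integral (f : C(UnitAddCircle, ℝ)) (k : ℤ) :
    fc f k = ∫ x in (0:ℝ)..1, fourier (-k) (x : UnitAddCircle) * ((f x : ℝ) : ℂ) := by
  unfold fc
  rw [fourierCoeff_eq_intervalIntegral _ _ 0]
  simp

theorem hasDerivAt_fourier_unit (k : ℤ) (x : ℝ) :
    HasDerivAt (fun y : ℝ => fourier k (y : UnitAddCircle))
      (2 * Real.pi * Complex.I * k * fourier k (x : UnitAddCircle)) x := by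
  have h := hasDerivAt_fourier 1 k x
  rwa [Complex.ofReal_one, div_one] at h

theorem fc_of_isDer {f g : C(UnitAddCircle, ℝ)} (h : IsDer f g) (k : ℤ) :
    fc g k = 2 * Real.pi * Complex.I * k * fc f k := by
  have h1 : ∀ x : ℝ, HasDerivAt (fun y : ℝ => fourier (-k) (y : UnitAddCircle) * ((f y : ℝ) : ℂ))
      (-2 * Real.pi * Complex.I * k * (fourier (-k) (x : UnitAddCircle) * ((f x : ℝ) : ℂ))
        + fourier (-k) (x : UnitAddCircle) * ((g x : ℝ) : ℂ)) x := fun x => by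
    refine ((hasDerivAt_fourier_unit (-k) x).mul (h x).ofReal_comp).congr_deriv ?_
    push_cast
    ring
  have c1 : Continuous fun x : ℝ => fourier (-k) (x : UnitAddCircle) * ((f x : ℝ) : ℂ) :=
    ((fourier (-k)).continuous.comp (AddCircle.continuous_mk' 1)).mul
      (Complex.continuous_ofReal.comp (continuous_coe_circle f))
  have c2 : Continuous fun x : ℝ => fourier (-k) (x : UnitAddCircle) * ((g x : ℝ) : ℂ) :=
    ((fourier (-k)).continuous.comp (AddCircle.continuous_mk' 1)).mul
      (Complex.continuous_ofReal.comp (continuous_coe_circle g))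
  have h2 := intervalIntegral.integral_eq_sub_of_hasDerivAt (a := 0) (b := 1)
    (fun x _ => h1 x) (((c1.const_mul _).add c2).intervalIntegrable _ _)
  rw [intervalIntegral.integral_add ((c1.const_mul _).intervalIntegrable _ _)
    (c2.intervalIntegrable _ _), intervalIntegral.integral_const_mul, ← fc_eq_integral,
    ← fc_eq_integral] at h2
  have h3 : ((1 : ℝ) : UnitAddCircle) = ((0 : ℝ) : UnitAddCircle) := AddCircle.coe_period 1
  rw [h3, sub_self] at h2
  linear_combination h2

theorem isDer_of_fc {f g : C(UnitAddCircle, ℝ)} (hf : Summable fun k => ‖fc f k‖)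
    (hg : Summable fun k => ‖fc g k‖)
    (h : ∀ k, fc g k = 2 * Real.pi * Complex.I * k * fc f k) : IsDer f g := by
  intro x
  have h0 : Summable fun k => fc f k * fourier k ((0 : ℝ) : UnitAddCircle) :=
    (hasSum_fc hf _).summable
  have h1 : HasDerivAt (fun y : ℝ => ∑' k, fc f k * fourier k (y : UnitAddCircle))
      (∑' k, fc g k * fourier k (x : UnitAddCircle)) x := by
    refine hasDerivAt_tsum (u := fun k => ‖fc g k‖)
      (g := fun k (y : ℝ) => fc f k * fourier k (y : UnitAddCircle)) hg
      (g' := fun k y => fc g k * fourier k (y : UnitAddCircle)) (fun k y => ?_) (fun k y => ?_)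
      (y₀ := 0) h0 x
    · refine ((hasDerivAt_fourier_unit k y).const_mul (fc f k)).congr_deriv ?_
      rw [h]
      ring
    · rw [norm_mul]
      refine mul_le_of_le_one_right (norm_nonneg _) ?_
      exact (ContinuousMap.norm_coe_le_norm _ _).trans (fourier_norm k).le
  rw [(hasSum_fc hg _).tsum_eq] at h1
  have h2 : (fun y : ℝ => ∑' k, fc f k * fourier k (y : UnitAddCircle)) =
      fun y : ℝ => ((f y : ℝ) : ℂ) := funext fun y => (hasSum_fc hf _).tsum_eq
  rw [h2] at h1
  have h3 := (Complex.reCLM.hasFDerivAt.comp_hasDerivAt x h1)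
  exact h3

/-! ### Inequalities for sums of extended nonnegative reals -/

theorem ENNReal.two_mul_mul_le_sq_add_sq (a b : ℝ≥0∞) : 2 * a * b ≤ a ^ 2 + b ^ 2 := by
  rcases eq_or_ne a ⊤ with rfl | ha
  · simp
  rcases eq_or_ne b ⊤ with rfl | hb
  · simp
  lift a to NNReal using ha
  lift b to NNReal using hb
  exact_mod_cast two_mul_le_add_sq a b

theorem ENNReal.add_sq_le_two_mul (a b : ℝ≥0∞) : (a + b) ^ 2 ≤ 2 * (a ^ 2 + b ^ 2) := by
  have := ENNReal.two_mul_mul_le_sq_add_sq a b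
  calc (a + b) ^ 2 = a ^ 2 + b ^ 2 + 2 * a * b := by ring
    _ ≤ a ^ 2 + b ^ 2 + (a ^ 2 + b ^ 2) := by gcongr
    _ = _ := by ring

/-- The Cauchy–Schwarz inequality with weights. -/
theorem ENNReal.sq_tsum_mul_le {ι : Type*} (A B : ι → ℝ≥0∞) :
    (∑' j, A j * B j) ^ 2 ≤ (∑' j, A j) * ∑' j, A j * B j ^ 2 := by
  -- The doubled square is expanded as a double sum, in which 2 B_i B_j ≤ B_i² + B_j². This works
  -- for infinite values too; the factor 2 is cancelled at the end.
  have h2 : 2 * (∑' j, A j * B j) ^ 2 ≤ 2 * ((∑' j, A j) * ∑' j, A j * B j ^ 2) := by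
    calc 2 * (∑' j, A j * B j) ^ 2
        = ∑' i, ∑' j, A i * A j * (2 * B i * B j) := by
          rw [sq, ← ENNReal.tsum_mul_right, ← ENNReal.tsum_mul_left]
          refine tsum_congr fun i => ?_
          rw [← ENNReal.tsum_mul_left, ← ENNReal.tsum_mul_left]
          exact tsum_congr fun j => by ring
      _ ≤ ∑' i, ∑' j, A i * A j * (B i ^ 2 + B j ^ 2) := by
          gcongr
          exact ENNReal.two_mul_mul_le_sq_add_sq _ _
      _ = ∑' i, ∑' j, A i * B i ^ 2 * A j + ∑' i, ∑' j, A i * (A j * B j ^ 2) := by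
          rw [← ENNReal.tsum_add]
          refine tsum_congr fun i => ?_
          rw [← ENNReal.tsum_add]
          exact tsum_congr fun j => by ring
      _ = _ := by
          simp_rw [ENNReal.tsum_mul_left, ENNReal.tsum_mul_right]
          ring
  exact (ENNReal.mul_le_mul_iff_right two_ne_zero (by simp)).mp h2

/-- Young's inequality for the convolution of an `ℓ¹` and an `ℓ²` sequence. -/
theorem ENNReal.tsum_sq_conv_le (A B : ℤ → ℝ≥0∞) :
    ∑' k, (∑' j, A j * B (k - j)) ^ 2 ≤ (∑' j, A j) ^ 2 * ∑' j, B j ^ 2 := by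
  calc ∑' k, (∑' j, A j * B (k - j)) ^ 2
      ≤ ∑' k, (∑' j, A j) * ∑' j, A j * B (k - j) ^ 2 := by
        gcongr with k
        exact ENNReal.sq_tsum_mul_le _ _
    _ = (∑' j, A j) * ∑' j, A j * ∑' k, B (k - j) ^ 2 := by
        rw [ENNReal.tsum_mul_left, ENNReal.tsum_comm]
        simp_rw [ENNReal.tsum_mul_left]
    _ = _ := by
        have : ∀ j : ℤ, ∑' k, B (k - j) ^ 2 = ∑' k, B k ^ 2 := fun j =>
          (Equiv.subRight j).tsum_eq fun k => B k ^ 2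
        simp_rw [this, ENNReal.tsum_mul_right]
        ring

/-! ### Extended Sobolev norms -/

/-- The square `∑ (1 + k²)^r |f̂(k)|²` of the Sobolev norm of order `r`, possibly infinite. -/
noncomputable def sn (r : ℝ) (f : C(UnitAddCircle, ℝ)) : ℝ≥0∞ :=
  ∑' k : ℤ, ENNReal.ofReal ((1 + (k : ℝ) ^ 2) ^ r) * ‖fc f k‖ₑ ^ 2

theorem one_le_weight (k : ℤ) : 1 ≤ 1 + (k : ℝ) ^ 2 := by nlinarith [sq_nonneg (k : ℝ)]

theorem weight_pos (k : ℤ) : 0 < 1 + (k : ℝ) ^ 2 := by positivity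

theorem sn_mono {r q : ℝ} (h : r ≤ q) (f : C(UnitAddCircle, ℝ)) : sn r f ≤ sn q f := by
  unfold sn
  gcongr with k
  exact one_le_weight k

/-- `sn` is a squared norm, so the triangle inequality costs a factor 2; the factors 2 in later
estimates have this origin. -/
theorem sn_add_le (r : ℝ) (f g : C(UnitAddCircle, ℝ)) :
    sn r (f + g) ≤ 2 * (sn r f + sn r g) := by
  unfold sn
  rw [← ENNReal.tsum_add, ← ENNReal.tsum_mul_left]
  refine ENNReal.tsum_le_tsum fun k => ?_
  rw [fc_add, ← mul_add, mul_left_comm]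
  gcongr
  calc ‖fc f k + fc g k‖ₑ ^ 2 ≤ (‖fc f k‖ₑ + ‖fc g k‖ₑ) ^ 2 := by
        gcongr
        exact enorm_add_le _ _
    _ ≤ _ := ENNReal.add_sq_le_two_mul _ _

theorem sn_neg (r : ℝ) (f : C(UnitAddCircle, ℝ)) : sn r (-f) = sn r f := by
  unfold sn
  refine tsum_congr fun k => ?_
  have : fc (-f) k = - fc f k := by
    rw [← neg_one_smul ℝ f, fc_smul]
    simp
  rw [this, enorm_neg]

theorem sn_sub_comm (r : ℝ) (f g : C(UnitAddCircle, ℝ)) : sn r (f - g) = sn r (g - f) := by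
  rw [← sn_neg, neg_sub]

theorem sn_sub_le (r : ℝ) (f g : C(UnitAddCircle, ℝ)) :
    sn r (f - g) ≤ 2 * (sn r f + sn r g) := by
  rw [sub_eq_add_neg, ← sn_neg r g]
  exact sn_add_le r f (-g)

theorem ofReal_weight_sq (s : ℝ) (k : ℤ) :
    ENNReal.ofReal ((1 + (k : ℝ) ^ 2) ^ (s / 2)) ^ 2 =
      ENNReal.ofReal ((1 + (k : ℝ) ^ 2) ^ s) := by
  rw [← ENNReal.ofReal_pow (Real.rpow_nonneg (weight_pos k).le _), ← Real.rpow_natCast,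
    ← Real.rpow_mul (weight_pos k).le]
  congr 2
  push_cast
  ring

theorem enorm_weightedCoeff_sq (s : ℝ) (f : C(UnitAddCircle, ℝ)) (k : ℤ) :
    ‖weightedCoeff s f k‖ₑ ^ 2 = ENNReal.ofReal ((1 + (k : ℝ) ^ 2) ^ s) * ‖fc f k‖ₑ ^ 2 := by
  rw [weightedCoeff_eq_fc, enorm_mul, mul_pow, ← ofReal_weight_sq]
  congr 2
  rw [← ofReal_norm, Complex.norm_real, Real.norm_of_nonneg
    (Real.rpow_nonneg (weight_pos k).le _)]

theorem sn_eq_tsum_weightedCoeff (s : ℝ) (f : C(UnitAddCircle, ℝ)) :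
    sn s f = ∑' k, ENNReal.ofReal (‖weightedCoeff s f k‖ ^ 2) := by
  unfold sn
  refine tsum_congr fun k => ?_
  rw [← enorm_weightedCoeff_sq, ENNReal.ofReal_pow (norm_nonneg _), ofReal_norm]

theorem memℓp_weightedCoeff_iff (s : ℝ) (f : C(UnitAddCircle, ℝ)) :
    Memℓp (weightedCoeff s f) 2 ↔ sn s f ≠ ⊤ := by
  rw [memℓp_gen_iff (by simp), sn_eq_tsum_weightedCoeff]
  simp only [ENNReal.toReal_ofNat, Real.rpow_ofNat]
  constructor
  · intro h
    rw [← ENNReal.ofReal_tsum_of_nonneg (fun k => by positivity) h]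
    exact ENNReal.ofReal_ne_top
  · intro h
    have := ENNReal.summable_toReal h
    refine this.congr fun k => ?_
    rw [ENNReal.toReal_ofReal (by positivity)]

theorem Hs.sn_ne_top {s : ℝ} (F : Hs s) : sn s F.1 ≠ ⊤ :=
  (memℓp_weightedCoeff_iff s F.1).mp F.2

theorem Hs.enorm_sq {s : ℝ} (F : Hs s) : ‖F‖ₑ ^ 2 = sn s F.1 := by
  have h1 : ‖F‖ = ‖Hs.toL2 s F‖ := rfl
  have h2 := lp.hasSum_norm (p := 2) (by simp) (Hs.toL2 s F)
  simp only [ENNReal.toReal_ofNat, Real.rpow_ofNat] at h2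
  rw [sn_eq_tsum_weightedCoeff, ← ofReal_norm, ← ENNReal.ofReal_pow (norm_nonneg _), h1,
    ← h2.tsum_eq, ENNReal.ofReal_tsum_of_nonneg (fun k => by positivity) h2.summable]
  rfl

/-- The sum `∑ (1 + k²)^(-r)`. -/
noncomputable def wsum (r : ℝ) : ℝ≥0∞ := ∑' k : ℤ, ENNReal.ofReal ((1 + (k : ℝ) ^ 2) ^ (-r))

theorem wsum_ne_top {r : ℝ} (hr : 1 / 2 < r) : wsum r ≠ ⊤ := by
  have hs : Summable fun k : ℤ => (1 + (k : ℝ) ^ 2) ^ (-r) := by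
    have h1 : Summable fun k : ℤ => |(k : ℝ)| ^ (-(2 * r)) :=
      Real.summable_abs_int_rpow (by linarith)
    have h2 : Summable fun k : ℤ => if k = 0 then (1 : ℝ) else 0 :=
      (hasSum_ite_eq (0 : ℤ) (1 : ℝ)).summable
    refine Summable.of_nonneg_of_le (fun k => Real.rpow_nonneg (weight_pos k).le _) (fun k => ?_)
      (h1.add h2)
    rcases eq_or_ne k 0 with rfl | hk
    · simp
      positivity
    · rw [if_neg hk, add_zero, neg_mul_eq_mul_neg, Real.rpow_mul (abs_nonneg _)]
      have h0 : (0 : ℝ) < |(k : ℝ)| := by positivity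
      refine Real.rpow_le_rpow_of_nonpos (by positivity) ?_ (by linarith)
      rw [Real.rpow_two, sq_abs]
      linarith
  unfold wsum
  rw [← ENNReal.ofReal_tsum_of_nonneg (fun k => Real.rpow_nonneg (weight_pos k).le _) hs]
  exact ENNReal.ofReal_ne_top

/-- Weighted Cauchy–Schwarz after writing |f̂| = w^(-r) · (w^r |f̂|) with w = 1 + k². -/
theorem sq_tsum_fc_le (r : ℝ) (f : C(UnitAddCircle, ℝ)) :
    (∑' k, ‖fc f k‖ₑ) ^ 2 ≤ wsum r * sn r f := by
  have h1 : ∀ k : ℤ, ENNReal.ofReal ((1 + (k : ℝ) ^ 2) ^ (-r)) *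
      ENNReal.ofReal ((1 + (k : ℝ) ^ 2) ^ r) = 1 := fun k => by
    rw [← ENNReal.ofReal_mul (Real.rpow_nonneg (weight_pos k).le _), ← Real.rpow_add (weight_pos k)]
    simp
  have h := ENNReal.sq_tsum_mul_le (fun k : ℤ => ENNReal.ofReal ((1 + (k : ℝ) ^ 2) ^ (-r)))
    (fun k => ENNReal.ofReal ((1 + (k : ℝ) ^ 2) ^ r) * ‖fc f k‖ₑ)
  simp_rw [← mul_assoc, h1, one_mul, mul_pow] at h
  refine h.trans_eq ?_
  unfold wsum sn
  congr 1
  refine tsum_congr fun k => ?_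
  rw [sq (ENNReal.ofReal _), ← mul_assoc, ← mul_assoc, h1, one_mul]

theorem tsum_fc_ne_top {r : ℝ} (hr : 1 / 2 < r) {f : C(UnitAddCircle, ℝ)} (hf : sn r f ≠ ⊤) :
    ∑' k, ‖fc f k‖ₑ ≠ ⊤ := by
  intro h
  have := sq_tsum_fc_le r f
  rw [h] at this
  exact ENNReal.mul_ne_top (wsum_ne_top hr) hf (top_le_iff.mp (by simpa using this))

theorem summable_fc {r : ℝ} (hr : 1 / 2 < r) {f : C(UnitAddCircle, ℝ)} (hf : sn r f ≠ ⊤) :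
    Summable fun k => ‖fc f k‖ := by
  have := ENNReal.summable_toReal (tsum_fc_ne_top hr hf)
  simpa using this

/-- The Sobolev embedding into the continuous functions. -/
theorem enorm_apply_sq_le {r : ℝ} (hr : 1 / 2 < r) (f : C(UnitAddCircle, ℝ)) (x : UnitAddCircle) :
    ‖f x‖ₑ ^ 2 ≤ wsum r * sn r f := by
  rcases eq_or_ne (sn r f) ⊤ with h | h
  · have : wsum r ≠ 0 := by
      unfold wsum
      intro h0
      have := ENNReal.tsum_eq_zero.mp h0 0
      simp at this
    rw [h, ENNReal.mul_top this]
    exact le_top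
  · refine le_trans ?_ (sq_tsum_fc_le r f)
    gcongr
    have h1 := hasSum_fc (summable_fc hr h) x
    have h2 : ‖((f x : ℝ) : ℂ)‖ₑ = ‖f x‖ₑ := by
      rw [← ofReal_norm, Complex.norm_real, ofReal_norm]
    rw [← h2, ← h1.tsum_eq]
    refine enorm_tsum_le_tsum_enorm.trans ?_
    gcongr with k
    rw [enorm_mul]
    refine mul_le_of_le_one_right zero_le ?_
    rw [← ofReal_norm, ← ENNReal.ofReal_one]
    exact ENNReal.ofReal_le_ofReal
      (((fourier k : C(UnitAddCircle, ℂ)).norm_coe_le_norm _).trans (fourier_norm k).le)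

/-- Parseval's identity. -/
theorem sn_zero (f : C(UnitAddCircle, ℝ)) :
    sn 0 f = ENNReal.ofReal (∫ x in (0:ℝ)..1, (f (x : UnitAddCircle)) ^ 2) := by
  have h1 := hasSum_sq_fourierCoeff
    (ContinuousMap.toLp (E := ℂ) 2 AddCircle.haarAddCircle ℂ (toComplexMap f))
  simp_rw [fourierCoeff_toLp] at h1
  have h2 : ∫ t, ‖(ContinuousMap.toLp (E := ℂ) 2 AddCircle.haarAddCircle ℂ (toComplexMap f)) t‖ ^ 2
      ∂AddCircle.haarAddCircle = ∫ x in (0:ℝ)..1, (f (x : UnitAddCircle)) ^ 2 := by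
    have h3 : ∫ t, ‖(ContinuousMap.toLp (E := ℂ) 2 AddCircle.haarAddCircle ℂ (toComplexMap f)) t‖ ^ 2
      ∂AddCircle.haarAddCircle = ∫ t, (f t) ^ 2 ∂AddCircle.haarAddCircle := by
      refine integral_congr_ae ?_
      filter_upwards [ContinuousMap.coeFn_toLp (𝕜 := ℂ) (p := 2) AddCircle.haarAddCircle
        (toComplexMap f)] with t ht
      rw [ht]
      change ‖((f t : ℝ) : ℂ)‖ ^ 2 = _
      rw [Complex.norm_real, Real.norm_eq_abs, sq_abs]
    have h4 := AddCircle.intervalIntegral_preimage (1 : ℝ) 0 fun t => (f t) ^ 2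
    rw [zero_add] at h4
    rw [h3, h4, AddCircle.integral_haarAddCircle, inv_one, one_smul]
  rw [h2] at h1
  rw [← h1.tsum_eq, ENNReal.ofReal_tsum_of_nonneg (fun k => by positivity) h1.summable]
  unfold sn
  refine tsum_congr fun k => ?_
  rw [Real.rpow_zero, ENNReal.ofReal_one, one_mul, ENNReal.ofReal_pow (norm_nonneg _),
    ofReal_norm]
  rfl

/-- One factor 1 + k² splits off from the weight, and k²|f̂|² is |ĝ|² up to (2π)². Being an
identity, it transfers both bounds and limits in H^{r+1} to the function and its derivative in H^r;
all inductions on the order rest on it. -/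
theorem sn_add_one {f g : C(UnitAddCircle, ℝ)} (h : IsDer f g) (r : ℝ) :
    sn (r + 1) f = sn r f + ENNReal.ofReal (((2 * Real.pi) ^ 2)⁻¹) * sn r g := by
  unfold sn
  rw [← ENNReal.tsum_mul_left, ← ENNReal.tsum_add]
  refine tsum_congr fun k => ?_
  have h1 : ‖fc g k‖ₑ ^ 2 = ENNReal.ofReal ((2 * Real.pi) ^ 2 * (k : ℝ) ^ 2) * ‖fc f k‖ₑ ^ 2 := by
    rw [fc_of_isDer h, enorm_mul, mul_pow]
    congr 1
    rw [← ofReal_norm, ← ENNReal.ofReal_pow (norm_nonneg _)]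
    congr 1
    simp only [norm_mul, Complex.norm_I, Complex.norm_real, Complex.norm_intCast, Complex.norm_ofNat,
      mul_pow, Real.norm_eq_abs, sq_abs, mul_one]
  rw [h1, ← mul_assoc, ← mul_assoc, ← add_mul]
  congr 1
  rw [← ENNReal.ofReal_mul (by positivity), ← ENNReal.ofReal_mul (by positivity),
    ← ENNReal.ofReal_add (by positivity) (by positivity), Real.rpow_add (weight_pos k)]
  congr 1
  have : Real.pi ≠ 0 := Real.pi_ne_zero
  field_simp
  rw [Real.rpow_one]

theorem sn_le_of_isDer {f g : C(UnitAddCircle, ℝ)} (h : IsDer f g) (r : ℝ) :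
    sn r g ≤ ENNReal.ofReal ((2 * Real.pi) ^ 2) * sn (r + 1) f := by
  rw [sn_add_one h, mul_add, ← mul_assoc, ← ENNReal.ofReal_mul (by positivity),
    mul_inv_cancel₀ (by positivity), ENNReal.ofReal_one, one_mul]
  exact le_add_self

/-! ### Classical derivatives and the algebra property -/

/-- Functions of class `H^r`, `r > 3/2`, are continuously differentiable. -/
theorem exists_isDer {r : ℝ} (hr : 3 / 2 < r) {f : C(UnitAddCircle, ℝ)} (hf : sn r f ≠ ⊤) :
    ∃ g, IsDer f g := by
  have hfs : Summable fun k => ‖fc f k‖ := summable_fc (by linarith) hf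
  have h1 : Summable fun k : ℤ => ‖2 * Real.pi * Complex.I * k * fc f k‖ := by
    have h2 : (∑' k : ℤ, ‖(k : ℂ) * fc f k‖ₑ) ≠ ⊤ := by
      -- With w = 1 + k², A = w^(-(r-1)) and B = w^(r-1/2)|f̂|, the product AB = w^(1/2)|f̂|
      -- dominates |k f̂|, while AB² = w^r|f̂|² sums to `sn r f`. The sum of A is finite because r -
      -- 1 > 1/2.
      have h3 := ENNReal.sq_tsum_mul_le (fun k : ℤ => ENNReal.ofReal ((1 + (k : ℝ) ^ 2) ^ (-(r-1))))
        (fun k => ENNReal.ofReal ((1 + (k : ℝ) ^ 2) ^ (r - 1 / 2)) * ‖fc f k‖ₑ)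
      have h4 : ∑' k : ℤ, ENNReal.ofReal ((1 + (k : ℝ) ^ 2) ^ (-(r-1))) *
          (ENNReal.ofReal ((1 + (k : ℝ) ^ 2) ^ (r - 1 / 2)) * ‖fc f k‖ₑ) ^ 2 = sn r f := by
        unfold sn
        refine tsum_congr fun k => ?_
        rw [mul_pow, ← mul_assoc, ← ENNReal.ofReal_pow (Real.rpow_nonneg (weight_pos k).le _),
          ← ENNReal.ofReal_mul (Real.rpow_nonneg (weight_pos k).le _),
          ← Real.rpow_mul_natCast (weight_pos k).le, ← Real.rpow_add (weight_pos k)]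
        congr 3
        push_cast
        ring
      rw [h4] at h3
      change _ ≤ wsum (r - 1) * _ at h3
      intro htop
      have h5 : (∑' k : ℤ, ‖(k : ℂ) * fc f k‖ₑ) ≤
          ∑' k : ℤ, ENNReal.ofReal ((1 + (k : ℝ) ^ 2) ^ (-(r-1))) *
            (ENNReal.ofReal ((1 + (k : ℝ) ^ 2) ^ (r - 1 / 2)) * ‖fc f k‖ₑ) := by
        gcongr with k
        rw [enorm_mul, ← mul_assoc, ← ENNReal.ofReal_mul (Real.rpow_nonneg (weight_pos k).le _),
          ← Real.rpow_add (weight_pos k)]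
        gcongr
        rw [← ofReal_norm]
        refine ENNReal.ofReal_le_ofReal ?_
        rw [Complex.norm_intCast, show -(r - 1) + (r - 1 / 2) = 1 / 2 by ring, ← Real.sqrt_eq_rpow]
        exact Real.abs_le_sqrt (by linarith)
      rw [htop, top_le_iff] at h5
      rw [h5] at h3
      exact ENNReal.mul_ne_top (wsum_ne_top (r := r - 1) (by linarith)) hf
        (top_le_iff.mp (by rwa [ENNReal.top_pow two_ne_zero] at h3))
    have h3 := (ENNReal.summable_toReal h2).mul_left ‖2 * (Real.pi : ℂ) * Complex.I‖
    refine h3.congr fun k => ?_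
    rw [toReal_enorm, ← norm_mul, ← mul_assoc]
  obtain ⟨g, hg⟩ := exists_fc_eq h1 (fun k => by
    rw [fc_neg_index]
    simp only [map_mul, Complex.conj_I, Complex.conj_ofReal, map_ofNat, map_intCast]
    push_cast
    ring)
  refine ⟨g, isDer_of_fc hfs ?_ hg⟩
  simpa only [hg] using h1

/-- Only f is expanded: its series converges uniformly, can be multiplied by g, and multiplication
by the j-th character shifts the coefficients of g by j. Thus no summability of ĝ is needed. -/
theorem hasSum_fc_mul {f : C(UnitAddCircle, ℝ)} (hs : Summable fun k => ‖fc f k‖)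
    (g : C(UnitAddCircle, ℝ)) (k : ℤ) :
    HasSum (fun j => fc f j * fc g (k - j)) (fc (f * g) k) := by
  have h1 : HasSum (fun j => fc f j • (fourier j : C(UnitAddCircle, ℂ))) (toComplexMap f) :=
    hasSum_fourier_series_of_summable (f := toComplexMap f)
      (show Summable (fc f) from hs.of_norm)
  have h2 := (h1.mul_right (toComplexMap g)).mapL (fourierCoeffCLM k)
  simp_rw [fourierCoeffCLM_apply] at h2
  have h3 : fourierCoeff (toComplexMap f * toComplexMap g) k = fc (f * g) k := by
    unfold fc
    congr 1
    funext x
    simp [toComplexMap]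
  have h4 : ∀ j, fourierCoeff ((fc f j • (fourier j : C(UnitAddCircle, ℂ))) * toComplexMap g) k =
      fc f j * fc g (k - j) := fun j => by
    unfold fc
    rw [← smul_eq_mul (a := fourierCoeff _ j), ← fourierCoeff.const_smul]
    unfold fourierCoeff
    congr 1
    funext x
    rw [show -(k - j) = -k + j by ring, fourier_add]
    simp only [toComplexMap, ContinuousMap.mul_apply, ContinuousMap.smul_apply, smul_eq_mul,
      ContinuousMap.coe_mk, Pi.smul_apply]
    ring
  rw [h3] at h2
  simpa only [h4] using h2

/-- From k = j + (k - j) follows k² ≤ 2j² + 2(k - j)², hence 1 + k² is at most four times the larger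
of the two weights. In a convolution this puts the weight on one factor or the other. -/
theorem weight_rpow_le {r : ℝ} (hr : 0 ≤ r) (k j : ℤ) :
    (1 + (k : ℝ) ^ 2) ^ r ≤
      4 ^ r * ((1 + (j : ℝ) ^ 2) ^ r + (1 + ((k - j : ℤ) : ℝ) ^ 2) ^ r) := by
  have h1 : 1 + (k : ℝ) ^ 2 ≤ 4 * max (1 + (j : ℝ) ^ 2) (1 + ((k - j : ℤ) : ℝ) ^ 2) := by
    have h2 := le_max_left (1 + (j : ℝ) ^ 2) (1 + ((k - j : ℤ) : ℝ) ^ 2)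
    have h3 := le_max_right (1 + (j : ℝ) ^ 2) (1 + ((k - j : ℤ) : ℝ) ^ 2)
    push_cast at h2 h3 ⊢
    nlinarith [sq_nonneg ((k : ℝ) - 2 * j)]
  refine (Real.rpow_le_rpow (weight_pos k).le h1 hr).trans ?_
  rw [Real.mul_rpow (by norm_num) (le_max_of_le_left (weight_pos j).le)]
  gcongr
  have p1 := Real.rpow_nonneg (weight_pos j).le r
  have p2 := Real.rpow_nonneg (weight_pos (k - j)).le r
  rcases max_cases (1 + (j : ℝ) ^ 2) (1 + ((k - j : ℤ) : ℝ) ^ 2) with h | h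
  · rw [h.1]; linarith
  · rw [h.1]; linarith

/-- A constant for the product estimate in `H^r`. -/
noncomputable def mulConst (r : ℝ) : ℝ≥0∞ :=
  ENNReal.ofReal ((4 ^ (r / 2)) ^ 2) * (2 * (wsum r + wsum r))

theorem mulConst_ne_top {r : ℝ} (hr : 1 / 2 < r) : mulConst r ≠ ⊤ := by
  have := wsum_ne_top hr
  unfold mulConst
  finiteness

/-- For `r > 1/2` the Sobolev space of order `r` is an algebra. -/
theorem sn_mul_le {r : ℝ} (hr : 1 / 2 < r) {f g : C(UnitAddCircle, ℝ)} (hf : sn r f ≠ ⊤) :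
    sn r (f * g) ≤ mulConst r * (sn r f * sn r g) := by
  set a : ℤ → ℝ≥0∞ := fun j => ENNReal.ofReal ((1 + (j : ℝ) ^ 2) ^ (r / 2)) * ‖fc f j‖ₑ with ha
  set b : ℤ → ℝ≥0∞ := fun j => ENNReal.ofReal ((1 + (j : ℝ) ^ 2) ^ (r / 2)) * ‖fc g j‖ₑ with hb
  have hsa : ∑' j, a j ^ 2 = sn r f := tsum_congr fun j => by
    rw [ha, mul_pow, ofReal_weight_sq]
  have hsb : ∑' j, b j ^ 2 = sn r g := tsum_congr fun j => by
    rw [hb, mul_pow, ofReal_weight_sq]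
  -- The weighted coefficient of the product is dominated by two convolutions, each of an unweighted
  -- ℓ¹ sequence with a weighted ℓ² sequence; Young's inequality then applies to both.
  have key : ∀ k : ℤ, ENNReal.ofReal ((1 + (k : ℝ) ^ 2) ^ (r / 2)) * ‖fc (f * g) k‖ₑ ≤
      ENNReal.ofReal (4 ^ (r / 2)) *
        ((∑' j, ‖fc g j‖ₑ * a (k - j)) + ∑' j, ‖fc f j‖ₑ * b (k - j)) := fun k => by
    have e1 : ∑' j, ‖fc g j‖ₑ * a (k - j) = ∑' j, ‖fc g (k - j)‖ₑ * a j := by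
      rw [← (Equiv.subLeft k).tsum_eq]
      simp
    rw [e1, ← ENNReal.tsum_add, ← ENNReal.tsum_mul_left]
    calc ENNReal.ofReal ((1 + (k : ℝ) ^ 2) ^ (r / 2)) * ‖fc (f * g) k‖ₑ
        ≤ ENNReal.ofReal ((1 + (k : ℝ) ^ 2) ^ (r / 2)) * ∑' j, ‖fc f j * fc g (k - j)‖ₑ := by
          gcongr
          rw [← (hasSum_fc_mul (summable_fc hr hf) g k).tsum_eq]
          exact enorm_tsum_le_tsum_enorm
      _ = ∑' j, ENNReal.ofReal ((1 + (k : ℝ) ^ 2) ^ (r / 2)) * (‖fc f j‖ₑ * ‖fc g (k - j)‖ₑ) := by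
          rw [ENNReal.tsum_mul_left]
          simp_rw [enorm_mul]
      _ ≤ ∑' j : ℤ, (ENNReal.ofReal (4 ^ (r / 2)) * (ENNReal.ofReal ((1 + (j : ℝ) ^ 2) ^ (r / 2)) +
            ENNReal.ofReal ((1 + ((k - j : ℤ) : ℝ) ^ 2) ^ (r / 2)))) *
              (‖fc f j‖ₑ * ‖fc g (k - j)‖ₑ) := by
          gcongr with j
          rw [← ENNReal.ofReal_add (Real.rpow_nonneg (weight_pos j).le _)
            (Real.rpow_nonneg (weight_pos (k - j)).le _), ← ENNReal.ofReal_mul (by positivity)]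
          exact ENNReal.ofReal_le_ofReal (weight_rpow_le (by linarith) k j)
      _ = _ := tsum_congr fun j => by
          rw [ha, hb]
          ring
  calc sn r (f * g)
      = ∑' k : ℤ, (ENNReal.ofReal ((1 + (k : ℝ) ^ 2) ^ (r / 2)) * ‖fc (f * g) k‖ₑ) ^ 2 :=
        tsum_congr fun k => by rw [mul_pow, ofReal_weight_sq]
    _ ≤ ∑' k, (ENNReal.ofReal (4 ^ (r / 2)) *
        ((∑' j, ‖fc g j‖ₑ * a (k - j)) + ∑' j, ‖fc f j‖ₑ * b (k - j))) ^ 2 := by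
        refine ENNReal.tsum_le_tsum fun k => ?_
        gcongr ?_ ^ 2
        exact key k
    _ ≤ ∑' k, ENNReal.ofReal (4 ^ (r / 2)) ^ 2 *
        (2 * ((∑' j, ‖fc g j‖ₑ * a (k - j)) ^ 2 + (∑' j, ‖fc f j‖ₑ * b (k - j)) ^ 2)) := by
        gcongr with k
        rw [mul_pow]
        gcongr
        exact ENNReal.add_sq_le_two_mul _ _
    _ = ENNReal.ofReal (4 ^ (r / 2)) ^ 2 * (2 * ((∑' k, (∑' j, ‖fc g j‖ₑ * a (k - j)) ^ 2) +
          ∑' k, (∑' j, ‖fc f j‖ₑ * b (k - j)) ^ 2)) := by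
        rw [ENNReal.tsum_mul_left, ENNReal.tsum_mul_left, ENNReal.tsum_add]
    _ ≤ ENNReal.ofReal (4 ^ (r / 2)) ^ 2 * (2 * ((wsum r * sn r g) * sn r f +
          (wsum r * sn r f) * sn r g)) := by
        gcongr
        · refine (ENNReal.tsum_sq_conv_le _ _).trans ?_
          rw [hsa]
          gcongr
          exact sq_tsum_fc_le r g
        · refine (ENNReal.tsum_sq_conv_le _ _).trans ?_
          rw [hsb]
          gcongr
          exact sq_tsum_fc_le r f
    _ = _ := by
        unfold mulConst
        rw [ENNReal.ofReal_pow (by positivity)]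
        ring

/-! ### Structure of the spaces `Hs s` -/

/-- The element of `H^s` given by a continuous function of finite Sobolev norm. -/
def Hs.ofFun {s : ℝ} (f : C(UnitAddCircle, ℝ)) (h : sn s f ≠ ⊤) : Hs s :=
  ⟨f, (memℓp_weightedCoeff_iff s f).mpr h⟩

theorem Hs.edist_sq {s : ℝ} (F G : Hs s) : edist F G ^ 2 = sn s (F.1 - G.1) := by
  rw [edist_eq_enorm_sub, Hs.enorm_sq]
  rfl

theorem ENNReal.tendsto_zero_of_sq {ι : Type*} {l : Filter ι} {u : ι → ℝ≥0∞}
    (h : Tendsto (fun i => u i ^ 2) l (𝓝 0)) : Tendsto u l (𝓝 0) := by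
  rw [ENNReal.tendsto_nhds_zero] at h ⊢
  intro ε hε
  filter_upwards [h (ε ^ 2) (by positivity)] with i hi
  exact (ENNReal.pow_le_pow_left_iff two_ne_zero).mp hi

/-- Passage between the norm topology and the extended squared norms in which the estimates are
carried out. -/
theorem Hs.tendsto_iff {ι : Type*} {l : Filter ι} {s : ℝ} {F : ι → Hs s} {G : Hs s} :
    Tendsto F l (𝓝 G) ↔ Tendsto (fun i => sn s ((F i).1 - G.1)) l (𝓝 0) := by
  rw [tendsto_iff_edist_tendsto_0]
  simp_rw [← Hs.edist_sq]
  constructor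
  · intro h
    have := ENNReal.Tendsto.pow (n := 2) h
    simpa using this
  · exact ENNReal.tendsto_zero_of_sq

theorem Hs.abs_apply_le {s : ℝ} (hs : 1 / 2 < s) (F : Hs s) (x : UnitAddCircle) :
    |F.1 x| ≤ Real.sqrt (wsum s).toReal * ‖F‖ := by
  have h := enorm_apply_sq_le hs F.1 x
  rw [← Hs.enorm_sq] at h
  have h2 := ENNReal.toReal_mono (by have := wsum_ne_top hs; finiteness) h
  rw [ENNReal.toReal_pow, ENNReal.toReal_mul, ENNReal.toReal_pow, toReal_enorm, toReal_enorm,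
    Real.norm_eq_abs] at h2
  refine (pow_le_pow_iff_left₀ (abs_nonneg _) (by positivity) two_ne_zero).mp ?_
  rw [mul_pow, Real.sq_sqrt ENNReal.toReal_nonneg]
  exact h2

/-- Evaluation at a point as a continuous linear functional on `H^s`, `s > 1/2`. -/
noncomputable def Hs.evalCLM {s : ℝ} (hs : 1 / 2 < s) (x : UnitAddCircle) : Hs s →L[ℝ] ℝ :=
  LinearMap.mkContinuous
    { toFun := fun F => F.1 x
      map_add' := fun _ _ => rfl
      map_smul' := fun _ _ => rfl }
    (Real.sqrt (wsum s).toReal) fun F => Hs.abs_apply_le hs F x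

/-- The isometry into ℓ² has as its range the conjugation-symmetric sequences, a closed set.
Surjectivity onto these needs s > 1/2, so that the coefficients are summable and define a continuous
function. -/
theorem Hs.completeSpace {s : ℝ} (hs : 1 / 2 < s) : CompleteSpace (Hs s) := by
  have hi : Isometry (Hs.toL2 s) := AddMonoidHomClass.isometry_of_norm _ fun _ => rfl
  rw [completeSpace_iff_isComplete_range hi.isUniformInducing]
  refine IsClosed.isComplete ?_
  have hr : Set.range (Hs.toL2 s) = {a | ∀ k : ℤ, a (-k) = conj (a k)} := by
    ext a
    constructor
    · rintro ⟨F, rfl⟩ k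
      change weightedCoeff s F.1 (-k) = conj (weightedCoeff s F.1 k)
      rw [weightedCoeff_eq_fc, weightedCoeff_eq_fc, fc_neg_index, map_mul, Complex.conj_ofReal]
      push_cast
      rw [neg_sq]
    · intro ha
      have hw : ∀ k : ℤ, (0 : ℝ) < (1 + (k : ℝ) ^ 2) ^ (s / 2) := fun k =>
        Real.rpow_pos_of_pos (weight_pos k) _
      set b : ℤ → ℂ := fun k => (((1 + (k : ℝ) ^ 2) ^ (s / 2) : ℝ) : ℂ)⁻¹ * a k with hb
      have hba : ∀ k : ℤ, (((1 + (k : ℝ) ^ 2) ^ (s / 2) : ℝ) : ℂ) * b k = a k := fun k => by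
        have : (((1 + (k : ℝ) ^ 2) ^ (s / 2) : ℝ) : ℂ) ≠ 0 := by exact_mod_cast (hw k).ne'
        exact mul_inv_cancel_left₀ this _
      have hbs : Summable fun k => ‖b k‖ := by
        have h2 := lp.hasSum_norm (p := 2) (by simp) a
        simp only [ENNReal.toReal_ofNat, Real.rpow_ofNat] at h2
        have h3 : Summable fun k : ℤ => (1 + (k : ℝ) ^ 2) ^ (-s) := by
          have h4 := ENNReal.summable_toReal (wsum_ne_top hs)
          refine h4.congr fun k => ?_
          rw [ENNReal.toReal_ofReal (Real.rpow_nonneg (weight_pos k).le _)]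
        -- ‖b k‖ is the product of (1 + k²)^(-s/2) and ‖a k‖, hence at most the sum of their
        -- squares.
        refine Summable.of_nonneg_of_le (fun k => norm_nonneg _) (fun k => ?_) (h3.add h2.summable)
        have e1 : (1 + (k : ℝ) ^ 2) ^ (-s) = (((1 + (k : ℝ) ^ 2) ^ (s / 2))⁻¹) ^ 2 := by
          rw [← Real.rpow_neg (weight_pos k).le, ← Real.rpow_mul_natCast (weight_pos k).le]
          congr 1
          push_cast
          ring
        rw [e1, hb, norm_mul, norm_inv, Complex.norm_real, Real.norm_of_nonneg (hw k).le]
        nlinarith [sq_nonneg (((1 + (k : ℝ) ^ 2) ^ (s / 2))⁻¹ - ‖a k‖),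
          sq_nonneg (((1 + (k : ℝ) ^ 2) ^ (s / 2))⁻¹ + ‖a k‖)]
      obtain ⟨g, hg⟩ := exists_fc_eq hbs fun k => by
        rw [hb, map_mul, map_inv₀, Complex.conj_ofReal, ← ha k]
        push_cast
        rw [neg_sq]
      have hga : weightedCoeff s g = a := by
        funext k
        rw [weightedCoeff_eq_fc, hg, hba]
      refine ⟨⟨g, ?_⟩, ?_⟩
      · change Memℓp _ 2
        rw [hga]
        exact a.2
      · exact Subtype.ext hga
  rw [hr, Set.ofPred_forall]
  refine isClosed_iInter fun k => ?_
  have hc : ∀ k : ℤ, Continuous fun a : lp (fun _ : ℤ => ℂ) 2 => a k := fun k =>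
    (lp.evalCLM ℂ (fun _ : ℤ => ℂ) 2 k).continuous
  exact isClosed_eq (hc _) (Complex.continuous_conj.comp (hc _))

theorem H0.completeSpace {s : ℝ} (hs : 1 / 2 < s) : CompleteSpace (H0 s) := by
  have := Hs.completeSpace hs
  suffices h : IsClosed (H0 s : Set (Hs s)) from h.completeSpace_coe
  have : (H0 s : Set (Hs s)) = {F | Hs.evalCLM hs ((0 : ℝ) : UnitAddCircle) F = 0} := rfl
  rw [this]
  exact isClosed_eq (Hs.evalCLM hs _).continuous continuous_const

/-! ### Derivatives, products and reciprocals on the circle -/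

theorem IsDer.sub {f f' g g' : C(UnitAddCircle, ℝ)} (hf : IsDer f f') (hg : IsDer g g') :
    IsDer (f - g) (f' - g') := fun x => (hf x).sub (hg x)

theorem IsDer.add {f f' g g' : C(UnitAddCircle, ℝ)} (hf : IsDer f f') (hg : IsDer g g') :
    IsDer (f + g) (f' + g') := fun x => (hf x).add (hg x)

theorem IsDer.mul {f f' g g' : C(UnitAddCircle, ℝ)} (hf : IsDer f f') (hg : IsDer g g') :
    IsDer (f * g) (f' * g + f * g') := fun x => (hf x).mul (hg x)

theorem IsDer.unique {f g h : C(UnitAddCircle, ℝ)} (hg : IsDer f g) (hh : IsDer f h) : g = h := by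
  ext x
  induction x using QuotientAddGroup.induction_on with
  | H x => exact (hg x).unique (hh x)

theorem IsDer.recip {a a' b : C(UnitAddCircle, ℝ)} (ha : IsDer a a') (hab : a * b = 1) :
    IsDer b (-(a' * (b * b))) := by
  intro x
  have h1 : ∀ y : UnitAddCircle, a y * b y = 1 := fun y =>
    congrArg (fun q : C(UnitAddCircle, ℝ) => q y) hab
  have h0 : ∀ y : UnitAddCircle, a y ≠ 0 := fun y => left_ne_zero_of_mul_eq_one (h1 y)
  have h2 : ∀ y : UnitAddCircle, b y = (a y)⁻¹ := fun y => eq_inv_of_mul_eq_one_right (h1 y)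
  have h3 := (ha x).inv (h0 _)
  refine (h3.congr_of_eventuallyEq (.of_forall fun y => h2 _)).congr_deriv ?_
  simp only [ContinuousMap.neg_apply, ContinuousMap.mul_apply, h2]
  field_simp

theorem exists_recip {a : C(UnitAddCircle, ℝ)} (ha : ∀ x, a x ≠ 0) :
    ∃ b : C(UnitAddCircle, ℝ), a * b = 1 :=
  ⟨⟨fun x => (a x)⁻¹, a.continuous.inv₀ ha⟩, ContinuousMap.ext fun x => mul_inv_cancel₀ (ha x)⟩

theorem sn_zero_ne_top (f : C(UnitAddCircle, ℝ)) : sn 0 f ≠ ⊤ := by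
  rw [sn_zero]
  exact ENNReal.ofReal_ne_top

theorem sn_zero_le {f g : C(UnitAddCircle, ℝ)} {M : ℝ}
    (h : ∀ x, |f x| ≤ M * |g x|) : sn 0 f ≤ ENNReal.ofReal (M ^ 2) * sn 0 g := by
  rw [sn_zero, sn_zero, ← ENNReal.ofReal_mul (by positivity), ← intervalIntegral.integral_const_mul]
  refine ENNReal.ofReal_le_ofReal (intervalIntegral.integral_mono_on zero_le_one ?_ ?_ fun x _ => ?_)
  · exact ((continuous_coe_circle f).pow 2).intervalIntegrable _ _
  · exact (((continuous_coe_circle g).pow 2).const_mul _).intervalIntegrable _ _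
  · rw [← sq_abs (f _), ← sq_abs (g _), ← mul_pow]
    exact pow_le_pow_left₀ (abs_nonneg _) (h _) 2

theorem sn_zero_mul_le {f g : C(UnitAddCircle, ℝ)} {M : ℝ} (h : ∀ x, |f x| ≤ M) :
    sn 0 (f * g) ≤ ENNReal.ofReal (M ^ 2) * sn 0 g :=
  sn_zero_le fun x => by
    rw [ContinuousMap.mul_apply, abs_mul]
    gcongr
    exact h x

theorem sn_zero_le_of_abs_le {f : C(UnitAddCircle, ℝ)} {M : ℝ} (h : ∀ x, |f x| ≤ M) :
    sn 0 f ≤ ENNReal.ofReal (M ^ 2) := by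
  rw [sn_zero]
  refine ENNReal.ofReal_le_ofReal ?_
  have := intervalIntegral.integral_mono_on (a := 0) (b := 1) (μ := volume) zero_le_one
    (((continuous_coe_circle f).pow 2).intervalIntegrable _ _)
    ((continuous_const (y := M ^ 2)).intervalIntegrable _ _) fun x _ => by
      change f x ^ 2 ≤ M ^ 2
      rw [← sq_abs]
      exact pow_le_pow_left₀ (abs_nonneg _) (h _) 2
  simpa using this

theorem sn_one_ne_top {f g : C(UnitAddCircle, ℝ)} (h : IsDer f g) : sn 1 f ≠ ⊤ := by
  have h1 := sn_add_one h 0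
  rw [zero_add] at h1
  rw [h1]
  have := sn_zero_ne_top f
  have := sn_zero_ne_top g
  finiteness

theorem sn_add_one_ne_top {f g : C(UnitAddCircle, ℝ)} (h : IsDer f g) {r : ℝ} (hf : sn r f ≠ ⊤)
    (hg : sn r g ≠ ⊤) : sn (r + 1) f ≠ ⊤ := by
  rw [sn_add_one h]
  finiteness

theorem sn_ne_top_of_le {r q : ℝ} (h : r ≤ q) {f : C(UnitAddCircle, ℝ)} (hf : sn q f ≠ ⊤) :
    sn r f ≠ ⊤ :=
  ne_top_of_le_ne_top hf (sn_mono h f)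

theorem sn_mul_ne_top {r : ℝ} (hr : 1 / 2 < r) {f g : C(UnitAddCircle, ℝ)} (hf : sn r f ≠ ⊤)
    (hg : sn r g ≠ ⊤) : sn r (f * g) ≠ ⊤ :=
  ne_top_of_le_ne_top (by have := mulConst_ne_top hr; finiteness) (sn_mul_le hr hf)

theorem sn_ne_top_of_isDer {f g : C(UnitAddCircle, ℝ)} (h : IsDer f g) {r : ℝ}
    (hf : sn (r + 1) f ≠ ⊤) : sn r g ≠ ⊤ :=
  ne_top_of_le_ne_top (by finiteness) (sn_le_of_isDer h r)

theorem sn_add_ne_top {r : ℝ} {f g : C(UnitAddCircle, ℝ)} (hf : sn r f ≠ ⊤)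
    (hg : sn r g ≠ ⊤) : sn r (f + g) ≠ ⊤ :=
  ne_top_of_le_ne_top (by finiteness) (sn_add_le r f g)

theorem sn_sub_ne_top {r : ℝ} {f g : C(UnitAddCircle, ℝ)} (hf : sn r f ≠ ⊤)
    (hg : sn r g ≠ ⊤) : sn r (f - g) ≠ ⊤ :=
  ne_top_of_le_ne_top (by finiteness) (sn_sub_le r f g)

/-- `H^r`, `r > 3/2`, is closed under reciprocals. -/
theorem sn_recip_ne_top {r : ℝ} (hr : 3 / 2 < r) {a b : C(UnitAddCircle, ℝ)} (hab : a * b = 1)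
    (ha : sn r a ≠ ⊤) : sn r b ≠ ⊤ := by
  -- Bootstrap through b' = -a'b²: if b lies in H^{r-1}, an algebra since r - 1 > 1/2, then so does
  -- b', and b lies in H^r. The start is b ∈ H¹, which holds because b is continuously
  -- differentiable and which settles r ≤ 2.
  suffices H : ∀ n : ℕ, ∀ r : ℝ, 3 / 2 < r → r ≤ 2 + n → sn r a ≠ ⊤ → sn r b ≠ ⊤ by
    obtain ⟨n, hn⟩ := exists_nat_ge (r - 2)
    exact H n r hr (by linarith) ha
  clear ha hr r
  have step : ∀ r : ℝ, 3 / 2 < r → sn r a ≠ ⊤ → sn (r - 1) b ≠ ⊤ → sn r b ≠ ⊤ := by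
    intro r hr ha hb
    obtain ⟨a', ha'⟩ := exists_isDer hr ha
    have h1 : sn (r - 1) a' ≠ ⊤ := sn_ne_top_of_isDer ha' (by simpa using ha)
    have := sn_add_one_ne_top (r := r - 1) (ha'.recip hab) hb (by
      rw [sn_neg]
      exact sn_mul_ne_top (by linarith) h1 (sn_mul_ne_top (by linarith) hb hb))
    simpa using this
  intro n
  induction n with
  | zero =>
    intro r hr hrn ha
    obtain ⟨a', ha'⟩ := exists_isDer hr ha
    exact step r hr ha (sn_ne_top_of_le (by push_cast at hrn; linarith)
      (sn_one_ne_top (ha'.recip hab)))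
  | succ n ih =>
    intro r hr hrn ha
    rcases le_total r (2 + n) with h | h
    · exact ih r hr h ha
    · push_cast at hrn
      have hn : (0 : ℝ) ≤ n := n.cast_nonneg
      refine step r hr ha (sn_ne_top_of_le (q := 2 + n) (by linarith) ?_)
      exact ih _ (by linarith) le_rfl (sn_ne_top_of_le h ha)

/-- The identity B - b = (a - A) b B bounds the error by a small factor times `sn r B`, and `sn r B`
is in turn bounded by the error plus `sn r b`. -/
theorem tendsto_recip {ι : Type*} {l : Filter ι} {r : ℝ} (hr : 1 / 2 < r)
    {A B : ι → C(UnitAddCircle, ℝ)} {a b : C(UnitAddCircle, ℝ)} (hab : a * b = 1)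
    (hAB : ∀ᶠ i in l, A i * B i = 1) (hb : sn r b ≠ ⊤) (hB : ∀ᶠ i in l, sn r (B i) ≠ ⊤)
    (h : Tendsto (fun i => sn r (A i - a)) l (𝓝 0)) :
    Tendsto (fun i => sn r (B i - b)) l (𝓝 0) := by
  set K := mulConst r with hK
  have hKt : K ≠ ⊤ := mulConst_ne_top hr
  set e : ι → ℝ≥0∞ := fun i => 2 * (K * (K * (sn r (A i - a) * sn r b))) with he
  have het : Tendsto e l (𝓝 0) := by
    have h1 := ENNReal.Tendsto.mul_const (b := sn r b) h (Or.inr hb)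
    have h2 := ENNReal.Tendsto.const_mul (a := K) h1 (Or.inr hKt)
    have h3 := ENNReal.Tendsto.const_mul (a := K) h2 (Or.inr hKt)
    have h4 := ENNReal.Tendsto.const_mul (a := 2) h3 (Or.inr (by simp))
    simpa using h4
  have hbound : ∀ᶠ i in l, sn r (B i - b) ≤ 2 * (e i * sn r b) := by
    -- Once e ≤ 1/2, the error term on the right is absorbed into the left side; its finiteness `hS`
    -- permits the cancellation.
    have hhalf : ∀ᶠ i in l, e i ≤ 2⁻¹ := (ENNReal.tendsto_nhds_zero.mp het) _ (by simp)
    have hfin : ∀ᶠ i in l, sn r (A i - a) ≤ 1 := (ENNReal.tendsto_nhds_zero.mp h) _ (by simp)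
    filter_upwards [hhalf, hfin, hAB, hB] with i hi hf hABi hBi
    have hid : B i - b = ((a - A i) * b) * B i := by
      calc B i - b = (a * b) * B i - (A i * B i) * b := by rw [hab, hABi]; ring
        _ = _ := by ring
    have hs0 : sn r (a - A i) ≠ ⊤ := by
      rw [sn_sub_comm]
      exact ne_top_of_le_ne_top (by simp) hf
    have h1 : sn r (B i - b) ≤ K * (K * (sn r (A i - a) * sn r b) * sn r (B i)) := by
      conv_lhs => rw [hid]
      refine (sn_mul_le hr (sn_mul_ne_top hr hs0 hb)).trans ?_
      gcongr
      rw [sn_sub_comm r (A i)]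
      exact sn_mul_le hr hs0
    have h2 : sn r (B i) ≤ 2 * (sn r (B i - b) + sn r b) := by
      have := sn_add_le r (B i - b) b
      rwa [sub_add_cancel] at this
    have hS : sn r (B i - b) ≠ ⊤ := sn_sub_ne_top hBi hb
    have h3 : sn r (B i - b) ≤ 2⁻¹ * sn r (B i - b) + e i * sn r b := by
      calc sn r (B i - b) ≤ K * (K * (sn r (A i - a) * sn r b) *
            (2 * (sn r (B i - b) + sn r b))) := h1.trans (by gcongr)
        _ = e i * sn r (B i - b) + e i * sn r b := by rw [he]; ring
        _ ≤ _ := by gcongr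
    have h4 : 2 * sn r (B i - b) ≤ sn r (B i - b) + 2 * (e i * sn r b) := by
      calc 2 * sn r (B i - b) ≤ 2 * (2⁻¹ * sn r (B i - b) + e i * sn r b) := by gcongr
        _ = _ := by
          rw [mul_add, ← mul_assoc, ENNReal.mul_inv_cancel two_ne_zero (by simp), one_mul]
    rw [two_mul] at h4
    exact (ENNReal.add_le_add_iff_left hS).mp h4
  refine tendsto_of_tendsto_of_tendsto_of_le_of_le' tendsto_const_nhds ?_
    (.of_forall fun _ => zero_le) hbound
  have h1 := ENNReal.Tendsto.mul_const (b := sn r b) het (Or.inr hb)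
  have h2 := ENNReal.Tendsto.const_mul (a := 2) h1 (Or.inr (by simp))
  simpa using h2

/-! ### Interpolation between `H^0` and `H^n` -/

/-- The integral is split at t = w: the minimum is 1 below and (w/t)^n above. Convergence at 0 uses
r > 0, at infinity r < n. -/
theorem lintegral_interpolation_kernel {r n : ℝ} (hr : 0 < r) (hrn : r < n) {w : ℝ} (hw : 0 < w) :
    ∫⁻ t in Ioi (0 : ℝ), ENNReal.ofReal (t ^ (r - 1)) * ENNReal.ofReal (min 1 ((w / t) ^ n)) =
      ENNReal.ofReal (w ^ r) * ENNReal.ofReal (1 / r + 1 / (n - r)) := by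
  have h1 : ∫⁻ t in Ioc (0 : ℝ) w,
      ENNReal.ofReal (t ^ (r - 1)) * ENNReal.ofReal (min 1 ((w / t) ^ n)) =
        ENNReal.ofReal (w ^ r / r) := by
    calc _ = ∫⁻ t in Ioc (0 : ℝ) w, ENNReal.ofReal (t ^ (r - 1)) := by
          refine setLIntegral_congr_fun measurableSet_Ioc fun t ht => ?_
          have : 1 ≤ (w / t) ^ n :=
            Real.one_le_rpow ((one_le_div ht.1).mpr ht.2) (by linarith)
          simp [min_eq_left this]
      _ = _ := by
          rw [← ofReal_integral_eq_lintegral_ofReal, ← intervalIntegral.integral_of_le hw.le,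
            integral_rpow (Or.inl (by linarith))]
          · simp [Real.zero_rpow hr.ne']
          · exact (intervalIntegrable_iff_integrableOn_Ioc_of_le hw.le).mp
              (intervalIntegral.intervalIntegrable_rpow' (by linarith))
          · filter_upwards [ae_restrict_mem measurableSet_Ioc] with t ht
            exact Real.rpow_nonneg ht.1.le _
  have h2 : ∫⁻ t in Ioi w,
      ENNReal.ofReal (t ^ (r - 1)) * ENNReal.ofReal (min 1 ((w / t) ^ n)) =
        ENNReal.ofReal (w ^ r / (n - r)) := by
    calc _ = ∫⁻ t in Ioi w, ENNReal.ofReal (w ^ n * t ^ (r - 1 - n)) := by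
          refine setLIntegral_congr_fun measurableSet_Ioi fun t ht => ?_
          have ht0 : 0 < t := hw.trans ht
          have : (w / t) ^ n ≤ 1 :=
            Real.rpow_le_one (by positivity) ((div_le_one ht0).mpr (le_of_lt ht)) (by linarith)
          rw [min_eq_right this, ← ENNReal.ofReal_mul (by positivity), Real.div_rpow hw.le ht0.le,
            Real.rpow_sub ht0 (r - 1) n]
          congr 1
          ring
      _ = _ := by
          rw [← ofReal_integral_eq_lintegral_ofReal, integral_const_mul,
            integral_Ioi_rpow_of_lt (by linarith) hw]
          · congr 1
            have h3 : r - 1 - n + 1 = r - n := by ring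
            rw [h3, Real.rpow_sub hw]
            have : w ^ n ≠ 0 := (Real.rpow_pos_of_pos hw n).ne'
            have h4 : r - n ≠ 0 := by linarith
            have h5 : n - r ≠ 0 := by linarith
            rw [show r - n = -(n - r) by ring]
            field_simp
          · exact (integrableOn_Ioi_rpow_of_lt (by linarith) hw).const_mul _
          · filter_upwards [ae_restrict_mem measurableSet_Ioi] with t ht
            have ht0 : 0 < t := hw.trans ht
            simp only [Pi.zero_apply]
            positivity
  rw [← Ioc_union_Ioi_eq_Ioi hw.le, lintegral_union measurableSet_Ioi
    (Set.disjoint_left.mpr fun t h h' => absurd h.2 (not_le.mpr h')), h1, h2,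
    ← ENNReal.ofReal_add (by positivity) (div_nonneg (by positivity) (by linarith)),
    ← ENNReal.ofReal_mul (by positivity)]
  congr 1
  ring

/-- Truncation of the Fourier series of `f` to the frequencies with `1 + k² ≤ t`. -/
theorem exists_truncation (f : C(UnitAddCircle, ℝ)) (t : ℝ) :
    ∃ g : C(UnitAddCircle, ℝ), (∀ k : ℤ, fc g k = if 1 + (k : ℝ) ^ 2 ≤ t then fc f k else 0) ∧
      ∀ q, sn q g ≠ ⊤ := by
  have hfin : {k : ℤ | 1 + (k : ℝ) ^ 2 ≤ t}.Finite := by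
    refine (Set.finite_Icc (-⌈t⌉) ⌈t⌉).subset fun k hk => ?_
    have hk' : 1 + (k : ℝ) ^ 2 ≤ t := hk
    have ht := Int.le_ceil t
    rw [Set.mem_Icc, ← abs_le]
    have : |(k : ℝ)| ≤ ⌈t⌉ := by nlinarith [sq_abs (k : ℝ), sq_nonneg (|(k : ℝ)| - 1)]
    exact_mod_cast this
  obtain ⟨g, hg⟩ := exists_fc_eq (a := fun k : ℤ => if 1 + (k : ℝ) ^ 2 ≤ t then fc f k else 0)
    (summable_of_ne_finset_zero (s := hfin.toFinset) fun k hk => by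
      rw [Set.Finite.mem_toFinset, Set.mem_ofPred_eq] at hk
      rw [if_neg hk, norm_zero])
    (fun k => by
      push_cast
      rw [neg_sq]
      split_ifs
      · exact fc_neg_index f k
      · simp)
  refine ⟨g, hg, fun q => ?_⟩
  unfold sn
  rw [tsum_eq_sum (s := hfin.toFinset) fun k hk => by
      rw [Set.Finite.mem_toFinset, Set.mem_ofPred_eq] at hk
      rw [hg, if_neg hk]
      simp]
  exact ENNReal.sum_ne_top.mpr fun k _ => by finiteness

/-- Real interpolation by hand. At each threshold t, f is cut into low frequencies g, estimated by
`hn`, and high frequencies f - g, estimated by `h0`. The result is an inequality between sums with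
kernel min(1, ((1 + k²)/t)^n). Integration against t^(r-1) dt turns this kernel into the same
multiple of (1 + k²)^r on both sides. -/
theorem sn_interpolation {r n : ℝ} (hr : 0 < r) (hrn : r < n)
    (T : C(UnitAddCircle, ℝ) → C(UnitAddCircle, ℝ)) (hT : ∀ f g, T (f - g) = T f - T g)
    {M : ℝ≥0∞} (h0 : ∀ f, sn 0 (T f) ≤ M * sn 0 f)
    (hn : ∀ f, (∀ q, sn q f ≠ ⊤) → sn n (T f) ≤ M * sn n f) (f : C(UnitAddCircle, ℝ)) :
    sn r (T f) ≤ 2 * M * sn r f := by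
  have hK : ∀ t ∈ Ioi (0 : ℝ),
      ∑' k : ℤ, ENNReal.ofReal (min 1 (((1 + (k : ℝ) ^ 2) / t) ^ n)) * ‖fc (T f) k‖ₑ ^ 2 ≤
      2 * M * ∑' k : ℤ, ENNReal.ofReal (min 1 (((1 + (k : ℝ) ^ 2) / t) ^ n)) * ‖fc f k‖ₑ ^ 2 := by
    intro t ht
    have ht0 : (0 : ℝ) < t := ht
    obtain ⟨g, hg, hgs⟩ := exists_truncation f t
    have e1 : ∀ k : ℤ, ENNReal.ofReal (((1 + (k : ℝ) ^ 2) / t) ^ n) =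
        ENNReal.ofReal ((t ^ n)⁻¹) * ENNReal.ofReal ((1 + (k : ℝ) ^ 2) ^ n) := fun k => by
      rw [← ENNReal.ofReal_mul (by positivity), Real.div_rpow (weight_pos k).le ht0.le]
      congr 1
      ring
    calc ∑' k : ℤ, ENNReal.ofReal (min 1 (((1 + (k : ℝ) ^ 2) / t) ^ n)) * ‖fc (T f) k‖ₑ ^ 2
        ≤ ∑' k : ℤ, (2 * (ENNReal.ofReal ((1 + (k : ℝ) ^ 2) ^ (0 : ℝ)) * ‖fc (T (f - g)) k‖ₑ ^ 2) +
            2 * (ENNReal.ofReal ((t ^ n)⁻¹) *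
              (ENNReal.ofReal ((1 + (k : ℝ) ^ 2) ^ n) * ‖fc (T g) k‖ₑ ^ 2))) := by
          refine ENNReal.tsum_le_tsum fun k => ?_
          have h2 : ‖fc (T f) k‖ₑ ^ 2 ≤ 2 * (‖fc (T (f - g)) k‖ₑ ^ 2 + ‖fc (T g) k‖ₑ ^ 2) := by
            have h3 : fc (T f) k = fc (T (f - g)) k + fc (T g) k := by
              rw [hT, fc_sub, sub_add_cancel]
            rw [h3]
            exact (by gcongr; exact enorm_add_le _ _ :
              _ ≤ (‖fc (T (f - g)) k‖ₑ + ‖fc (T g) k‖ₑ) ^ 2).trans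
                (ENNReal.add_sq_le_two_mul _ _)
          refine (mul_le_mul_right h2 _).trans ?_
          rw [mul_left_comm, mul_add, mul_add, ← mul_assoc (ENNReal.ofReal ((t ^ n)⁻¹)), ← e1]
          gcongr
          · rw [Real.rpow_zero]
            exact min_le_left _ _
          · exact min_le_right _ _
      _ = 2 * sn 0 (T (f - g)) + 2 * (ENNReal.ofReal ((t ^ n)⁻¹) * sn n (T g)) := by
          rw [ENNReal.tsum_add, ENNReal.tsum_mul_left, ENNReal.tsum_mul_left, ENNReal.tsum_mul_left]
          rfl
      _ ≤ 2 * (M * sn 0 (f - g)) + 2 * (ENNReal.ofReal ((t ^ n)⁻¹) * (M * sn n g)) := by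
          gcongr
          · exact h0 _
          · exact hn _ hgs
      _ = 2 * M * (sn 0 (f - g) + ENNReal.ofReal ((t ^ n)⁻¹) * sn n g) := by ring
      -- At each frequency exactly one of g and f - g is present, and the cut 1 + k² ≤ t is where
      -- the minimum changes branch; so the two norms add up to the kernel sum exactly.
      _ = _ := by
          congr 1
          unfold sn
          rw [← ENNReal.tsum_mul_left, ← ENNReal.tsum_add]
          refine tsum_congr fun k => ?_
          rw [← mul_assoc, ← e1, fc_sub, hg]
          split_ifs with hk
          · have : ((1 + (k : ℝ) ^ 2) / t) ^ n ≤ 1 :=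
              Real.rpow_le_one (div_nonneg (weight_pos k).le ht0.le) ((div_le_one ht0).mpr hk)
                (by linarith)
            rw [min_eq_right this]
            simp
          · have : 1 ≤ ((1 + (k : ℝ) ^ 2) / t) ^ n :=
              Real.one_le_rpow ((one_le_div ht0).mpr (not_le.mp hk).le) (by linarith)
            rw [min_eq_left this]
            simp
  have hint : ∀ F : C(UnitAddCircle, ℝ), ∫⁻ t in Ioi (0 : ℝ), ENNReal.ofReal (t ^ (r - 1)) *
      ∑' k : ℤ, ENNReal.ofReal (min 1 (((1 + (k : ℝ) ^ 2) / t) ^ n)) * ‖fc F k‖ₑ ^ 2 =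
      ENNReal.ofReal (1 / r + 1 / (n - r)) * sn r F := fun F => by
    simp_rw [← ENNReal.tsum_mul_left]
    rw [lintegral_tsum fun k => by fun_prop]
    unfold sn
    rw [← ENNReal.tsum_mul_left]
    refine tsum_congr fun k => ?_
    simp_rw [← mul_assoc]
    rw [lintegral_mul_const _ (by fun_prop), lintegral_interpolation_kernel hr hrn (weight_pos k)]
    ring
  have h3 : ENNReal.ofReal (1 / r + 1 / (n - r)) * sn r (T f) ≤
      ENNReal.ofReal (1 / r + 1 / (n - r)) * (2 * M * sn r f) := by
    rw [← hint, mul_left_comm, ← hint, ← lintegral_const_mul _ (by fun_prop)]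
    refine setLIntegral_mono' measurableSet_Ioi fun t ht => ?_
    rw [mul_left_comm]
    gcongr
    exact hK t ht
  refine (ENNReal.mul_le_mul_iff_right ?_ ENNReal.ofReal_ne_top).mp h3
  have : 0 < n - r := by linarith
  rw [ENNReal.ofReal_ne_zero_iff]
  positivity

/-! ### Diffeomorphisms of the circle -/

/-- A `C¹` diffeomorphism of the circle fixing `0`, given by its displacement `h`, together with the
derivative `h'` of `h` and the reciprocal `R = 1 / (1 + h')`. -/
structure CircleDiffeo where
  h : C(UnitAddCircle, ℝ)
  h' : C(UnitAddCircle, ℝ)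
  R : C(UnitAddCircle, ℝ)
  isDer : IsDer h h'
  h_zero : h ((0 : ℝ) : UnitAddCircle) = 0
  pos : ∀ x, 0 < 1 + h' x
  recip : (1 + h') * R = 1

namespace CircleDiffeo

variable (φ : CircleDiffeo)

/-- The lift of the diffeomorphism to the line. -/
def lift : ℝ → ℝ := fun x => x + φ.h (x : UnitAddCircle)

/-- The inverse of the lift. -/
noncomputable def inv : ℝ → ℝ := Function.invFun φ.lift

theorem recip_apply (x : UnitAddCircle) : (1 + φ.h' x) * φ.R x = 1 :=
  congrArg (fun q : C(UnitAddCircle, ℝ) => q x) φ.recip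

theorem R_eq (x : UnitAddCircle) : φ.R x = (1 + φ.h' x)⁻¹ :=
  eq_inv_of_mul_eq_one_right (φ.recip_apply x)

theorem R_pos (x : UnitAddCircle) : 0 < φ.R x := by
  rw [R_eq]
  exact inv_pos.mpr (φ.pos x)

theorem hasDerivAt_lift (x : ℝ) : HasDerivAt φ.lift (1 + φ.h' (x : UnitAddCircle)) x :=
  (hasDerivAt_id x).add (φ.isDer x)

theorem continuous_lift : Continuous φ.lift :=
  continuous_iff_continuousAt.mpr fun x => (φ.hasDerivAt_lift x).continuousAt

theorem strictMono_lift : StrictMono φ.lift :=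
  strictMono_of_deriv_pos fun x => by
    rw [(φ.hasDerivAt_lift x).deriv]
    exact φ.pos x

theorem lift_zero : φ.lift 0 = 0 := by
  unfold lift
  rw [φ.h_zero, add_zero]

theorem lift_add_one (x : ℝ) : φ.lift (x + 1) = φ.lift x + 1 := by
  unfold lift
  rw [AddCircle.coe_add_period]
  ring

theorem surjective_lift : Function.Surjective φ.lift := by
  obtain ⟨B, hB⟩ : ∃ B, ∀ x, |φ.h x| ≤ B := ⟨‖φ.h‖, fun x => φ.h.norm_coe_le_norm x⟩
  refine φ.continuous_lift.surjective ?_ ?_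
  · refine tendsto_atTop_mono (fun x => ?_) (tendsto_atTop_add_const_right _ (-B) tendsto_id)
    have := abs_le.mp (hB (x : UnitAddCircle))
    simp only [id, lift]
    linarith
  · refine tendsto_atBot_mono (fun x => ?_) (tendsto_atBot_add_const_right _ B tendsto_id)
    have := abs_le.mp (hB (x : UnitAddCircle))
    simp only [id, lift]
    linarith

theorem inv_lift (x : ℝ) : φ.inv (φ.lift x) = x :=
  Function.leftInverse_invFun φ.strictMono_lift.injective x

theorem lift_inv (y : ℝ) : φ.lift (φ.inv y) = y :=
  Function.rightInverse_invFun φ.surjective_lift y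

theorem inv_zero : φ.inv 0 = 0 := by
  conv_lhs => rw [← φ.lift_zero]
  exact φ.inv_lift 0

theorem inv_add_one (y : ℝ) : φ.inv (y + 1) = φ.inv y + 1 := by
  conv_lhs => rw [← φ.lift_inv y, ← φ.lift_add_one]
  exact φ.inv_lift _

theorem strictMono_inv : StrictMono φ.inv := fun a b hab => by
  rw [← φ.strictMono_lift.lt_iff_lt, φ.lift_inv, φ.lift_inv]
  exact hab

theorem continuous_inv : Continuous φ.inv :=
  φ.strictMono_inv.monotone.continuous_of_surjective fun x => ⟨_, φ.inv_lift x⟩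

theorem hasDerivAt_inv (y : ℝ) : HasDerivAt φ.inv (φ.R (φ.inv y : UnitAddCircle)) y := by
  rw [R_eq]
  exact HasDerivAt.of_local_left_inverse φ.continuous_inv.continuousAt (φ.hasDerivAt_lift _)
    (φ.pos _).ne' (.of_forall φ.lift_inv)

/-- Composition with the inverse of the diffeomorphism. -/
noncomputable def T (f : C(UnitAddCircle, ℝ)) : C(UnitAddCircle, ℝ) where
  toFun := Function.Periodic.lift (f := fun y : ℝ => f (φ.inv y : UnitAddCircle)) (c := 1)
    fun y => by simp only [inv_add_one, AddCircle.coe_add_period]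
  continuous_toFun := continuous_coinduced_dom.mpr
    ((continuous_coe_circle f).comp φ.continuous_inv)

@[simp]
theorem T_coe (f : C(UnitAddCircle, ℝ)) (y : ℝ) :
    φ.T f (y : UnitAddCircle) = f (φ.inv y : UnitAddCircle) := rfl

theorem ext_coe {f g : C(UnitAddCircle, ℝ)} (h : ∀ x : ℝ, f (x : UnitAddCircle) = g x) :
    f = g := by
  ext x
  induction x using QuotientAddGroup.induction_on with
  | H x => exact h x

theorem T_sub (f g : C(UnitAddCircle, ℝ)) : φ.T (f - g) = φ.T f - φ.T g := ext_coe fun _ => rfl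

theorem isDer_T {f f' : C(UnitAddCircle, ℝ)} (hf : IsDer f f') : IsDer (φ.T f) (φ.T (f' * φ.R)) :=
  fun y => (hf (φ.inv y)).comp y (φ.hasDerivAt_inv y)

/-- Substitution y = φ(x); the lift fixes 0 and 1, so the interval of integration is unchanged. -/
theorem integral_comp_inv {F : ℝ → ℝ} (hF : Continuous F) :
    ∫ y in (0:ℝ)..1, F (φ.inv y) = ∫ x in (0:ℝ)..1, F x * (1 + φ.h' (x : UnitAddCircle)) := by
  have h := intervalIntegral.integral_comp_mul_deriv (a := 0) (b := 1) (f := φ.lift)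
    (f' := fun x => 1 + φ.h' (x : UnitAddCircle)) (g := F ∘ φ.inv)
    (fun x _ => φ.hasDerivAt_lift x)
    (continuous_const.add (continuous_coe_circle _)).continuousOn (hF.comp φ.continuous_inv)
  have h1 : φ.lift 1 = 1 := by
    have := φ.lift_add_one 0
    rwa [zero_add, φ.lift_zero, zero_add] at this
  rw [φ.lift_zero, h1] at h
  simp only [Function.comp, φ.inv_lift] at h
  exact h.symm

theorem sn_zero_T_le {M : ℝ} (hM : ∀ x, 1 + φ.h' x ≤ M) (f : C(UnitAddCircle, ℝ)) :
    sn 0 (φ.T f) ≤ ENNReal.ofReal M * sn 0 f := by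
  have hM0 : 0 ≤ M := (φ.pos 0).le.trans (hM 0)
  have h := φ.integral_comp_inv (F := fun x => f (x : UnitAddCircle) ^ 2)
    ((continuous_coe_circle f).pow 2)
  rw [sn_zero, sn_zero, ← ENNReal.ofReal_mul hM0]
  refine ENNReal.ofReal_le_ofReal ?_
  simp only [T_coe]
  rw [h, ← intervalIntegral.integral_const_mul]
  refine intervalIntegral.integral_mono_on zero_le_one ?_ ?_ fun x _ => ?_
  · exact (((continuous_coe_circle f).pow 2).mul
      (continuous_const.add (continuous_coe_circle _))).intervalIntegrable _ _
  · exact (((continuous_coe_circle f).pow 2).const_mul _).intervalIntegrable _ _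
  · rw [mul_comm]
    gcongr
    exact hM _

end CircleDiffeo

/-! ### Uniform boundedness of composition operators -/

theorem sn_zero_mul_le_sn {q : ℝ} (hq : 1 / 2 < q) {f : C(UnitAddCircle, ℝ)} (hf : sn q f ≠ ⊤)
    (g : C(UnitAddCircle, ℝ)) : sn 0 (f * g) ≤ wsum q * sn q f * sn 0 g := by
  have hfin : wsum q * sn q f ≠ ⊤ := ENNReal.mul_ne_top (wsum_ne_top hq) hf
  have h := sn_zero_mul_le (f := f) (g := g) (M := Real.sqrt (wsum q * sn q f).toReal) fun x => by
    refine Real.abs_le_sqrt ?_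
    have h2 := ENNReal.toReal_mono hfin (enorm_apply_sq_le hq f x)
    rwa [ENNReal.toReal_pow, toReal_enorm, Real.norm_eq_abs, sq_abs] at h2
  rwa [Real.sq_sqrt ENNReal.toReal_nonneg, ENNReal.ofReal_toReal hfin] at h

/-- Uniform bounds for the composition with the inverse of a diffeomorphism. -/
theorem exists_sn_T_le {q : ℝ} (hq : 3 / 2 < q) (M : ℝ) {N : ℝ≥0∞} (hN : N ≠ ⊤) {r : ℝ}
    (hr : 0 ≤ r) (hrq : r ≤ q + 1) :
    ∃ C : ℝ≥0∞, C ≠ ⊤ ∧ ∀ φ : CircleDiffeo, (∀ x, 1 + φ.h' x ≤ M) → sn q φ.R ≤ N →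
      ∀ f, sn r f ≠ ⊤ → sn r (φ.T f) ≤ C * sn r f := by
  set c := ENNReal.ofReal (((2 * Real.pi) ^ 2)⁻¹) with hc
  set d := ENNReal.ofReal ((2 * Real.pi) ^ 2) with hd
  have hct : c ≠ ⊤ := ENNReal.ofReal_ne_top
  have hdt : d ≠ ⊤ := ENNReal.ofReal_ne_top
  -- For small r a function in H^r need not have a continuous derivative, so this range is
  -- interpolated. The endpoint H² needs only one derivative of R, which exists because q > 3/2. The
  -- constants depend on M and N but not on φ.
  have low : ∀ r : ℝ, 0 < r → r < 2 →
      ∃ C : ℝ≥0∞, C ≠ ⊤ ∧ ∀ φ : CircleDiffeo, (∀ x, 1 + φ.h' x ≤ M) → sn q φ.R ≤ N →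
      ∀ f, sn r f ≠ ⊤ → sn r (φ.T f) ≤ C * sn r f := by
    intro r hr hr2
    set M0 := ENNReal.ofReal M with hM0
    have hM0t : M0 ≠ ⊤ := ENNReal.ofReal_ne_top
    set M1 := M0 + c * (M0 * (wsum q * N * d)) with hM1
    have hwt : wsum q ≠ ⊤ := wsum_ne_top (by linarith)
    have hM1t : M1 ≠ ⊤ := by finiteness
    have hmt : mulConst 1 ≠ ⊤ := mulConst_ne_top (by norm_num)
    set M2 := M1 + c * (M1 * (mulConst 1 * (N * d))) with hM2
    have hM2t : M2 ≠ ⊤ := by finiteness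
    refine ⟨2 * (M0 + M2), by finiteness, fun φ hφ hR f _ => ?_⟩
    have hRt : sn q φ.R ≠ ⊤ := ne_top_of_le_ne_top hN hR
    have bound1 : ∀ f f', IsDer f f' → sn 1 (φ.T f) ≤ M1 * sn 1 f := by
      intro f f' hf
      have h1 := sn_add_one (φ.isDer_T hf) 0
      have h2 := sn_le_of_isDer hf 0
      rw [zero_add] at h1 h2
      calc sn 1 (φ.T f) = sn 0 (φ.T f) + c * sn 0 (φ.T (f' * φ.R)) := h1
        _ ≤ M0 * sn 1 f + c * (M0 * (wsum q * N * (d * sn 1 f))) := by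
          gcongr
          · exact (φ.sn_zero_T_le hφ f).trans (by gcongr; exact sn_mono zero_le_one f)
          · refine (φ.sn_zero_T_le hφ _).trans ?_
            rw [mul_comm f']
            gcongr
            refine (sn_zero_mul_le_sn (by linarith) hRt f').trans ?_
            gcongr
        _ = M1 * sn 1 f := by rw [hM1]; ring
    refine sn_interpolation (n := 2) hr hr2 φ.T φ.T_sub (M := M0 + M2)
      (fun f => (φ.sn_zero_T_le hφ f).trans (by gcongr; exact le_self_add)) (fun f hf => ?_) f
    obtain ⟨f', hf'⟩ := exists_isDer (r := 2) (by norm_num) (hf 2)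
    have hf1 : ∀ r, sn r f' ≠ ⊤ := fun r => sn_ne_top_of_isDer hf' (hf _)
    obtain ⟨f'', hf''⟩ := exists_isDer (r := 2) (by norm_num) (hf1 2)
    obtain ⟨R', hR'⟩ := exists_isDer hq hRt
    have h1 := sn_add_one (φ.isDer_T hf') 1
    have h2 := sn_le_of_isDer hf' 1
    rw [one_add_one_eq_two] at h1 h2
    calc sn 2 (φ.T f) = sn 1 (φ.T f) + c * sn 1 (φ.T (f' * φ.R)) := h1
      _ ≤ M1 * sn 2 f + c * (M1 * (mulConst 1 * (N * (d * sn 2 f)))) := by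
        gcongr
        · exact (bound1 f f' hf').trans (by gcongr; exact sn_mono one_le_two f)
        · refine (bound1 _ _ (hf''.mul hR')).trans ?_
          rw [mul_comm f']
          gcongr
          refine (sn_mul_le (by norm_num) (sn_ne_top_of_le (by linarith) hRt)).trans ?_
          gcongr
          exact (sn_mono (by linarith) _).trans hR
      _ = M2 * sn 2 f := by rw [hM2]; ring
      _ ≤ (M0 + M2) * sn 2 f := by gcongr; exact le_add_self
  -- For r ≥ 2 one order is peeled off through (f ∘ φ⁻¹)' = (f'R) ∘ φ⁻¹. Here H^{r-1} is an algebra,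
  -- and r - 1 ≤ q ensures that it contains R.
  have high : ∀ n : ℕ, ∀ r : ℝ, 0 < r → r < 2 + n → r ≤ q + 1 →
      ∃ C : ℝ≥0∞, C ≠ ⊤ ∧ ∀ φ : CircleDiffeo, (∀ x, 1 + φ.h' x ≤ M) → sn q φ.R ≤ N →
      ∀ f, sn r f ≠ ⊤ → sn r (φ.T f) ≤ C * sn r f := by
    intro n
    induction n with
    | zero => exact fun r hr hr2 _ => low r hr (by simpa using hr2)
    | succ n ih =>
      intro r hr hrn hrq
      rcases lt_or_ge r 2 with h2 | h2
      · exact low r hr h2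
      push_cast at hrn
      obtain ⟨C, hC, hT⟩ := ih (r - 1) (by linarith) (by linarith) (by linarith)
      have hmt : mulConst (r - 1) ≠ ⊤ := mulConst_ne_top (by linarith)
      refine ⟨C + c * (C * (mulConst (r - 1) * (N * d))), by finiteness, fun φ hφ hR f hf => ?_⟩
      have hRt : sn q φ.R ≠ ⊤ := ne_top_of_le_ne_top hN hR
      have hRt' : sn (r - 1) φ.R ≠ ⊤ := sn_ne_top_of_le (by linarith) hRt
      obtain ⟨f', hf'⟩ := exists_isDer (by linarith) hf
      have h1 := sn_add_one (φ.isDer_T hf') (r - 1)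
      have h2 := sn_le_of_isDer hf' (r - 1)
      rw [sub_add_cancel] at h1 h2
      have hf't : sn (r - 1) f' ≠ ⊤ := ne_top_of_le_ne_top (by finiteness) h2
      calc sn r (φ.T f) = sn (r - 1) (φ.T f) + c * sn (r - 1) (φ.T (f' * φ.R)) := h1
        _ ≤ C * sn r f + c * (C * (mulConst (r - 1) * (N * (d * sn r f)))) := by
          gcongr
          · exact (hT φ hφ hR f (sn_ne_top_of_le (by linarith) hf)).trans
              (by gcongr; exact sn_mono (by linarith) f)
          · refine (hT φ hφ hR _ (sn_mul_ne_top (by linarith) hf't hRt')).trans ?_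
            rw [mul_comm f']
            gcongr
            refine (sn_mul_le (by linarith) hRt').trans ?_
            gcongr
            exact (sn_mono (by linarith) _).trans hR
        _ = _ := by ring
  rcases hr.eq_or_lt with rfl | hr
  · exact ⟨ENNReal.ofReal M, ENNReal.ofReal_ne_top, fun φ hφ _ f _ => φ.sn_zero_T_le hφ f⟩
  · obtain ⟨n, hn⟩ := exists_nat_gt (r - 2)
    exact high n r hr (by linarith) hrq

/-! ### Continuity of the composition -/

theorem sn_const_one_ne_top (r : ℝ) : sn r (1 : C(UnitAddCircle, ℝ)) ≠ ⊤ := by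
  have h : ∀ k : ℤ, k ≠ 0 → fc (1 : C(UnitAddCircle, ℝ)) k = 0 := fun k hk => by
    have h1 : fc (1 : C(UnitAddCircle, ℝ)) k = fourierCoeff (T := 1) (fourier 0) k := by
      unfold fc
      congr 1
      funext x
      simp
    rw [h1, fourierCoeff_fourier]
    simp [hk]
  unfold sn
  rw [tsum_eq_single 0 fun k hk => by rw [h k hk]; simp]
  finiteness

/-- Smooth functions are dense in `H^r`. -/
theorem exists_smooth_sn_sub_le {r : ℝ} {f : C(UnitAddCircle, ℝ)} (hf : sn r f ≠ ⊤) {ε : ℝ≥0∞}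
    (hε : 0 < ε) : ∃ g : C(UnitAddCircle, ℝ), (∀ q, sn q g ≠ ⊤) ∧ sn r (f - g) ≤ ε := by
  obtain ⟨S, hS⟩ := ((ENNReal.tendsto_nhds_zero.mp
    (ENNReal.tendsto_tsum_compl_atTop_zero hf)) ε hε).exists
  obtain ⟨t, ht⟩ : ∃ t : ℝ, ∀ k ∈ S, 1 + (k : ℝ) ^ 2 ≤ t :=
    ⟨∑ k ∈ S, (1 + (k : ℝ) ^ 2), fun k hk =>
      Finset.single_le_sum (f := fun k : ℤ => 1 + (k : ℝ) ^ 2)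
        (fun i _ => (weight_pos i).le) hk⟩
  obtain ⟨g, hg, hgs⟩ := exists_truncation f t
  refine ⟨g, hgs, le_trans ?_ hS⟩
  unfold sn
  refine le_of_le_of_eq ?_ (tsum_subtype (s := {k | k ∉ S})
    (f := fun k : ℤ => ENNReal.ofReal ((1 + (k : ℝ) ^ 2) ^ r) * ‖fc f k‖ₑ ^ 2)).symm
  refine ENNReal.tsum_le_tsum fun k => ?_
  rw [fc_sub, hg]
  by_cases hk : 1 + (k : ℝ) ^ 2 ≤ t
  · simp [if_pos hk]
  · rw [if_neg hk, sub_zero, Set.indicator_of_mem]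
    exact fun h => hk (ht k h)

theorem tendsto_sn_of_le {ι : Type*} {l : Filter ι} {u : ι → ℝ≥0∞} {C : ℝ≥0∞} (hC : C ≠ ⊤)
    {v : ι → ℝ≥0∞} (hv : Tendsto v l (𝓝 0)) (h : ∀ᶠ i in l, u i ≤ C * v i) :
    Tendsto u l (𝓝 0) := by
  refine tendsto_of_tendsto_of_tendsto_of_le_of_le' tendsto_const_nhds ?_
    (.of_forall fun _ => zero_le) h
  simpa using ENNReal.Tendsto.const_mul (a := C) hv (Or.inr hC)

/-- Convergence of diffeomorphisms in the topology of `H^{q+1}`. -/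
structure CircleDiffeo.Converges {ι : Type*} (q : ℝ) (l : Filter ι) (Φ : ι → CircleDiffeo)
    (φ : CircleDiffeo) : Prop where
  fin : sn (q + 1) φ.h ≠ ⊤
  tendsto : Tendsto (fun i => sn (q + 1) ((Φ i).h - φ.h)) l (𝓝 0)

namespace CircleDiffeo

theorem sn_R_ne_top {q : ℝ} (hq : 3 / 2 < q) {φ : CircleDiffeo} (h : sn (q + 1) φ.h ≠ ⊤) :
    sn q φ.R ≠ ⊤ :=
  sn_recip_ne_top hq φ.recip
    (sn_add_ne_top (sn_const_one_ne_top q) (sn_ne_top_of_isDer φ.isDer h))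

variable {ι : Type*} {q : ℝ} {l : Filter ι} {Φ : ι → CircleDiffeo} {φ : CircleDiffeo}

theorem Converges.eventually_fin (H : Converges q l Φ φ) :
    ∀ᶠ i in l, sn (q + 1) (Φ i).h ≠ ⊤ := by
  filter_upwards [(ENNReal.tendsto_nhds_zero.mp H.tendsto) 1 one_pos] with i hi
  have := sn_add_ne_top (ne_top_of_le_ne_top (by simp) hi) H.fin
  rwa [sub_add_cancel] at this

theorem Converges.tendsto_h' (H : Converges q l Φ φ) :
    Tendsto (fun i => sn q ((Φ i).h' - φ.h')) l (𝓝 0) :=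
  tendsto_sn_of_le ENNReal.ofReal_ne_top H.tendsto
    (.of_forall fun i => sn_le_of_isDer ((Φ i).isDer.sub φ.isDer) q)

theorem Converges.tendsto_R (hq : 3 / 2 < q) (H : Converges q l Φ φ) :
    Tendsto (fun i => sn q ((Φ i).R - φ.R)) l (𝓝 0) := by
  refine tendsto_recip (by linarith) φ.recip (.of_forall fun i => (Φ i).recip)
    (sn_R_ne_top hq H.fin) (H.eventually_fin.mono fun i hi => sn_R_ne_top hq hi) ?_
  simpa only [add_sub_add_left_eq_sub] using H.tendsto_h'

theorem _root_.eventually_forall_abs_le {q : ℝ} (hq : 1 / 2 < q) {F : ι → C(UnitAddCircle, ℝ)}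
    (h : Tendsto (fun i => sn q (F i)) l (𝓝 0)) {ε : ℝ} (hε : 0 < ε) :
    ∀ᶠ i in l, ∀ x, |F i x| ≤ ε := by
  have h2 : Tendsto (fun i => wsum q * sn q (F i)) l (𝓝 0) := by
    simpa using ENNReal.Tendsto.const_mul (a := wsum q) h (Or.inr (wsum_ne_top hq))
  filter_upwards [(ENNReal.tendsto_nhds_zero.mp h2) (ENNReal.ofReal (ε ^ 2)) (by positivity)]
    with i hi x
  have h3 := ENNReal.toReal_mono ENNReal.ofReal_ne_top ((enorm_apply_sq_le hq (F i) x).trans hi)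
  rw [ENNReal.toReal_pow, toReal_enorm, Real.norm_eq_abs, ENNReal.toReal_ofReal (sq_nonneg ε)] at h3
  exact (pow_le_pow_iff_left₀ (abs_nonneg _) hε.le two_ne_zero).mp h3

/-- Along a convergent family the composition operators are uniformly bounded. -/
theorem Converges.exists_bound (hq : 3 / 2 < q) (H : Converges q l Φ φ) {r : ℝ} (hr : 0 ≤ r)
    (hrq : r ≤ q + 1) : ∃ C : ℝ≥0∞, C ≠ ⊤ ∧
      ∀ᶠ i in l, ∀ f, sn r f ≠ ⊤ → sn r ((Φ i).T f) ≤ C * sn r f := by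
  have hRt := sn_R_ne_top hq H.fin
  -- The bounds leave room for |Φ_i' - φ'| ≤ 1 uniformly and `sn q (R_i - R)` ≤ 1, both of which
  -- hold eventually.
  obtain ⟨C, hC, h⟩ := exists_sn_T_le hq (1 + ‖φ.h'‖ + 1) (N := 2 * (1 + sn q φ.R))
    (by finiteness) hr hrq
  refine ⟨C, hC, ?_⟩
  filter_upwards [eventually_forall_abs_le (by linarith) H.tendsto_h' one_pos,
    (ENNReal.tendsto_nhds_zero.mp (H.tendsto_R hq)) 1 one_pos] with i h1 h2
  refine h (Φ i) (fun x => ?_) ?_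
  · have h3 := (abs_le.mp (h1 x)).2
    have h4 := (abs_le.mp (φ.h'.norm_coe_le_norm x)).2
    rw [ContinuousMap.sub_apply] at h3
    linarith
  · have := sn_add_le q ((Φ i).R - φ.R) φ.R
    rw [sub_add_cancel] at this
    exact this.trans (by gcongr)

theorem bound_self (hq : 3 / 2 < q) (h : sn (q + 1) φ.h ≠ ⊤) {r : ℝ} (hr : 0 ≤ r)
    (hrq : r ≤ q + 1) : ∃ C : ℝ≥0∞, C ≠ ⊤ ∧ ∀ f, sn r f ≠ ⊤ → sn r (φ.T f) ≤ C * sn r f := by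
  obtain ⟨C, hC, hT⟩ := exists_sn_T_le hq (1 + ‖φ.h'‖) (sn_R_ne_top hq h) hr hrq
  refine ⟨C, hC, hT φ (fun x => ?_) le_rfl⟩
  have h4 := (abs_le.mp (φ.h'.norm_coe_le_norm x)).2
  linarith

/-- With x = ψ⁻¹(y), the two values are φ⁻¹(φ(x)) and φ⁻¹(ψ(x)), and φ⁻¹ is B-Lipschitz because its
derivative is R ∘ φ⁻¹. -/
theorem abs_inv_sub_inv_le {B : ℝ} (ψ : CircleDiffeo) (hB : ∀ x, φ.R x ≤ B) (y : ℝ) :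
    |ψ.inv y - φ.inv y| ≤ B * |(ψ.h - φ.h) (ψ.inv y : UnitAddCircle)| := by
  have h1 := Convex.norm_image_sub_le_of_norm_hasDerivWithin_le (f := φ.inv) (C := B)
    (s := Set.univ) (fun x _ => (φ.hasDerivAt_inv x).hasDerivWithinAt) (fun x _ => by
      rw [Real.norm_eq_abs, abs_of_pos (φ.R_pos _)]
      exact hB _) convex_univ (Set.mem_univ y) (Set.mem_univ (φ.lift (ψ.inv y)))
  rw [φ.inv_lift, Real.norm_eq_abs, Real.norm_eq_abs] at h1
  refine h1.trans_eq ?_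
  have h2 := ψ.lift_inv y
  rw [ContinuousMap.sub_apply]
  unfold lift at h2 ⊢
  rw [show ψ.inv y + φ.h (ψ.inv y : UnitAddCircle) - y =
    -(ψ.h (ψ.inv y : UnitAddCircle) - φ.h (ψ.inv y : UnitAddCircle)) by linarith, abs_neg]

/-- The inverses converge uniformly and f is uniformly continuous on the compact circle, so the
compositions converge uniformly, hence in L². -/
theorem Converges.tendsto_sn_zero (hq : 3 / 2 < q) (H : Converges q l Φ φ)
    (f : C(UnitAddCircle, ℝ)) : Tendsto (fun i => sn 0 ((Φ i).T f - φ.T f)) l (𝓝 0) := by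
  have key : ∀ ε : ℝ, 0 < ε → ∀ᶠ i in l, ∀ x, |((Φ i).T f - φ.T f) x| ≤ ε := by
    intro ε hε
    have hu := CompactSpace.uniformContinuous_of_continuous f.continuous
    obtain ⟨δ, hδ, hf⟩ := Metric.uniformContinuous_iff.mp hu ε hε
    have hB : ∀ x, φ.R x ≤ ‖φ.R‖ := fun x => (abs_le.mp (φ.R.norm_coe_le_norm x)).2
    have hB0 : (0 : ℝ) ≤ ‖φ.R‖ := norm_nonneg _
    filter_upwards [eventually_forall_abs_le (by linarith) H.tendsto
      (show 0 < δ / (‖φ.R‖ + 1) by positivity)] with i hi x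
    induction x using QuotientAddGroup.induction_on with
    | H y =>
      refine le_of_lt (hf (a := ((Φ i).inv y : UnitAddCircle)) (b := (φ.inv y : UnitAddCircle)) ?_)
      rw [dist_eq_norm, ← AddCircle.coe_sub]
      refine (QuotientAddGroup.norm_mk_le_norm).trans_lt ?_
      rw [Real.norm_eq_abs]
      refine (abs_inv_sub_inv_le (Φ i) hB y).trans_lt ?_
      calc ‖φ.R‖ * |((Φ i).h - φ.h) ((Φ i).inv y : UnitAddCircle)|
          ≤ ‖φ.R‖ * (δ / (‖φ.R‖ + 1)) := by gcongr; exact hi _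
        _ < (‖φ.R‖ + 1) * (δ / (‖φ.R‖ + 1)) := by gcongr; linarith
        _ = δ := by field_simp
  rw [ENNReal.tendsto_nhds_zero]
  intro ε hε
  obtain ⟨η, hη, hηε⟩ : ∃ η : ℝ, 0 < η ∧ ENNReal.ofReal (η ^ 2) ≤ ε := by
    rcases eq_or_ne ε ⊤ with rfl | hε'
    · exact ⟨1, one_pos, le_top⟩
    · refine ⟨Real.sqrt ε.toReal, Real.sqrt_pos.mpr (ENNReal.toReal_pos hε.ne' hε'), ?_⟩
      rw [Real.sq_sqrt ENNReal.toReal_nonneg, ENNReal.ofReal_toReal hε']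
  filter_upwards [key η hη] with i hi
  exact (sn_zero_le_of_abs_le hi).trans hηε

/-- The derivative of f ∘ Φ_i⁻¹ is (f'R_i) ∘ Φ_i⁻¹. Replacing R_i by R costs (f'(R_i - R)) ∘ Φ_i⁻¹,
which tends to 0 by uniform boundedness; the rest is `h1`. The product bound `hmul` is left open
because it comes from the supremum norm when r = 0 and from the algebra property when r > 1/2. -/
theorem Converges.tendsto_sn_add_one (hq : 3 / 2 < q) (H : Converges q l Φ φ) {r : ℝ} (hr : 0 ≤ r)
    (hrq : r ≤ q) {f f' : C(UnitAddCircle, ℝ)} (hf : IsDer f f')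
    (hmul : ∃ C : ℝ≥0∞, C ≠ ⊤ ∧
      ∀ᶠ i in l, sn r (f' * ((Φ i).R - φ.R)) ≤ C * sn q ((Φ i).R - φ.R))
    (h0 : Tendsto (fun i => sn r ((Φ i).T f - φ.T f)) l (𝓝 0))
    (h1 : Tendsto (fun i => sn r ((Φ i).T (f' * φ.R) - φ.T (f' * φ.R))) l (𝓝 0)) :
    Tendsto (fun i => sn (r + 1) ((Φ i).T f - φ.T f)) l (𝓝 0) := by
  obtain ⟨C, hC, hb⟩ := H.exists_bound hq hr (by linarith : r ≤ q + 1)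
  obtain ⟨D, hD, hm⟩ := hmul
  have h2 : Tendsto (fun i => sn r ((Φ i).T (f' * ((Φ i).R - φ.R)))) l (𝓝 0) := by
    refine tendsto_sn_of_le (C := C * D) (by finiteness) (H.tendsto_R hq) ?_
    filter_upwards [hb, hm, (ENNReal.tendsto_nhds_zero.mp (H.tendsto_R hq)) 1 one_pos]
      with i hb hm h1
    have hfin : sn r (f' * ((Φ i).R - φ.R)) ≠ ⊤ :=
      ne_top_of_le_ne_top (ENNReal.mul_ne_top hD (ne_top_of_le_ne_top (by simp) h1)) hm
    refine (hb _ hfin).trans ?_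
    rw [mul_assoc]
    gcongr
  have h3 : Tendsto (fun i => sn r ((Φ i).T (f' * (Φ i).R) - φ.T (f' * φ.R))) l (𝓝 0) := by
    refine tendsto_sn_of_le (C := 2) (by simp) (by simpa using h2.add h1) (.of_forall fun i => ?_)
    have : (Φ i).T (f' * (Φ i).R) - φ.T (f' * φ.R) =
        (Φ i).T (f' * ((Φ i).R - φ.R)) + ((Φ i).T (f' * φ.R) - φ.T (f' * φ.R)) := by
      rw [mul_sub, T_sub]
      abel
    rw [this]
    exact sn_add_le _ _ _
  have h4 := h0.add (ENNReal.Tendsto.const_mul (a := ENNReal.ofReal (((2 * Real.pi) ^ 2)⁻¹)) h3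
    (Or.inr ENNReal.ofReal_ne_top))
  rw [mul_zero, add_zero] at h4
  refine h4.congr fun i => ?_
  exact (sn_add_one (((Φ i).isDer_T hf).sub (φ.isDer_T hf)) r).symm

theorem Converges.mul_bound {r : ℝ} (hr : 1 / 2 < r) (hrq : r ≤ q)
    {f' : C(UnitAddCircle, ℝ)} (hft : sn r f' ≠ ⊤) : ∃ C : ℝ≥0∞, C ≠ ⊤ ∧
      ∀ᶠ i in l, sn r (f' * ((Φ i).R - φ.R)) ≤ C * sn q ((Φ i).R - φ.R) := by
  have := mulConst_ne_top hr
  refine ⟨mulConst r * sn r f', by finiteness, .of_forall fun i => ?_⟩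
  refine (sn_mul_le hr hft).trans ?_
  rw [mul_assoc]
  gcongr
  exact sn_mono hrq _

/-- For fixed `f ∈ H^r` the composition with `φ⁻¹` depends continuously on `φ`. -/
theorem Converges.tendsto_sn_T (hq : 3 / 2 < q) (H : Converges q l Φ φ) {r : ℝ} (hr : 0 < r)
    (hrq : r ≤ q + 1) {f : C(UnitAddCircle, ℝ)} (hf : sn r f ≠ ⊤) :
    Tendsto (fun i => sn r ((Φ i).T f - φ.T f)) l (𝓝 0) := by
  have hRt := sn_R_ne_top hq H.fin
  have one : ∀ f f', IsDer f f' →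
      Tendsto (fun i => sn 1 ((Φ i).T f - φ.T f)) l (𝓝 0) := by
    intro f f' hf
    have := H.tendsto_sn_add_one hq le_rfl (by linarith : (0 : ℝ) ≤ q) hf
      ⟨wsum q * sn 0 f', ENNReal.mul_ne_top (wsum_ne_top (by linarith)) (sn_zero_ne_top f'), by
        filter_upwards [(ENNReal.tendsto_nhds_zero.mp (H.tendsto_R hq)) 1 one_pos] with i hi
        rw [mul_comm f']
        refine (sn_zero_mul_le_sn (by linarith) (ne_top_of_le_ne_top (by simp) hi) f').trans_eq ?_
        ring⟩
      (H.tendsto_sn_zero hq f) (H.tendsto_sn_zero hq _)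
    rwa [zero_add] at this
  have low : ∀ r : ℝ, 0 < r → r < 2 → ∀ f, sn r f ≠ ⊤ →
      Tendsto (fun i => sn r ((Φ i).T f - φ.T f)) l (𝓝 0) := by
    intro r hr hr2 f hf
    -- For smooth g two applications of the derivative step give convergence even in H², which
    -- dominates H^r.
    have smooth : ∀ g, (∀ p, sn p g ≠ ⊤) →
        Tendsto (fun i => sn r ((Φ i).T g - φ.T g)) l (𝓝 0) := by
      intro g hg
      obtain ⟨g', hg'⟩ := exists_isDer (r := 2) (by norm_num) (hg 2)
      have hg1 : ∀ r, sn r g' ≠ ⊤ := fun r => sn_ne_top_of_isDer hg' (hg _)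
      obtain ⟨g'', hg''⟩ := exists_isDer (r := 2) (by norm_num) (hg1 2)
      obtain ⟨R', hR'⟩ := exists_isDer hq hRt
      have h2 := H.tendsto_sn_add_one hq zero_le_one (by linarith) hg'
        (Converges.mul_bound (by norm_num) (by linarith) (hg1 1)) (one g g' hg')
        (one _ _ (hg''.mul hR'))
      rw [one_add_one_eq_two] at h2
      exact tendsto_of_tendsto_of_tendsto_of_le_of_le tendsto_const_nhds h2
        (fun _ => zero_le) fun i => sn_mono hr2.le _
    obtain ⟨C, hC, hb⟩ := H.exists_bound hq hr.le (by linarith : r ≤ q + 1)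
    obtain ⟨D, hD, hb'⟩ := bound_self hq H.fin hr.le (by linarith : r ≤ q + 1)
    rw [ENNReal.tendsto_nhds_zero]
    intro ε hε
    -- Three-term estimate: C and D bound the two operators on f - g, and the last δ bounds the
    -- difference on the smooth g. The factors 2 come from squared triangle inequalities.
    obtain ⟨δ, hδ, hδε⟩ : ∃ δ : ℝ≥0∞, 0 < δ ∧ 2 * (2 * ((C + D) * δ) + δ) ≤ ε := by
      have ht : Tendsto (fun δ : ℝ≥0∞ => 2 * (2 * ((C + D) * δ) + δ)) (𝓝[>] 0) (𝓝 0) := by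
        have h0 : Tendsto (fun δ : ℝ≥0∞ => δ) (𝓝[>] 0) (𝓝 0) := nhdsWithin_le_nhds
        have h1 := ENNReal.Tendsto.const_mul (a := C + D) h0 (Or.inr (by finiteness))
        have h2 := ENNReal.Tendsto.const_mul (a := 2) h1 (Or.inr (by simp))
        have h3 := ENNReal.Tendsto.const_mul (a := 2) (h2.add h0) (Or.inr (by simp))
        simpa using h3
      obtain ⟨δ, h1, h2⟩ := (((ENNReal.tendsto_nhds_zero.mp ht) ε hε).and
        self_mem_nhdsWithin).exists
      exact ⟨δ, h2, h1⟩
    obtain ⟨g, hg, hfg⟩ := exists_smooth_sn_sub_le hf hδ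
    have hfgt : sn r (f - g) ≠ ⊤ := sn_sub_ne_top hf (hg r)
    filter_upwards [hb, (ENNReal.tendsto_nhds_zero.mp (smooth g hg)) δ hδ] with i hb hs
    have e : (Φ i).T f - φ.T f =
        ((Φ i).T (f - g) - φ.T (f - g)) + ((Φ i).T g - φ.T g) := by
      rw [T_sub, T_sub]
      abel
    rw [e]
    refine le_trans ?_ hδε
    refine (sn_add_le _ _ _).trans ?_
    gcongr
    refine (sn_sub_le _ _ _).trans ?_
    rw [add_mul]
    gcongr
    · exact (hb _ hfgt).trans (by gcongr)
    · exact (hb' _ hfgt).trans (by gcongr)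
  have high : ∀ n : ℕ, ∀ r : ℝ, 0 < r → r < 2 + n → r ≤ q + 1 → ∀ f, sn r f ≠ ⊤ →
      Tendsto (fun i => sn r ((Φ i).T f - φ.T f)) l (𝓝 0) := by
    intro n
    induction n with
    | zero => exact fun r hr hr2 _ => low r hr (by simpa using hr2)
    | succ n ih =>
      intro r hr hrn hrq f hf
      rcases lt_or_ge r 2 with h2 | h2
      · exact low r hr h2 f hf
      push_cast at hrn
      obtain ⟨f', hf'⟩ := exists_isDer (by linarith) hf
      have hf't : sn (r - 1) f' ≠ ⊤ := sn_ne_top_of_isDer hf' (by rwa [sub_add_cancel])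
      have h3 := H.tendsto_sn_add_one hq (r := r - 1) (by linarith) (by linarith) hf'
        (Converges.mul_bound (by linarith) (by linarith) hf't)
        (ih (r - 1) (by linarith) (by linarith) (by linarith) f
          (sn_ne_top_of_le (by linarith) hf))
        (ih (r - 1) (by linarith) (by linarith) (by linarith) _
          (sn_mul_ne_top (by linarith) hf't (sn_ne_top_of_le (by linarith) hRt)))
      rwa [sub_add_cancel] at h3
  obtain ⟨n, hn⟩ := exists_nat_gt (r - 2)
  exact high n r hr (by linarith) hrq f hf

/-- Joint continuity of `(f, φ) ↦ f ∘ φ⁻¹`. -/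
theorem Converges.tendsto_sn_T_joint (hq : 3 / 2 < q) (H : Converges q l Φ φ) {r : ℝ} (hr : 0 < r)
    (hrq : r ≤ q + 1) {F : ι → C(UnitAddCircle, ℝ)} {f : C(UnitAddCircle, ℝ)} (hf : sn r f ≠ ⊤)
    (hF : Tendsto (fun i => sn r (F i - f)) l (𝓝 0)) :
    Tendsto (fun i => sn r ((Φ i).T (F i) - φ.T f)) l (𝓝 0) := by
  obtain ⟨C, hC, hb⟩ := H.exists_bound hq hr.le hrq
  have h1 : Tendsto (fun i => sn r ((Φ i).T (F i - f))) l (𝓝 0) := by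
    refine tendsto_sn_of_le hC hF ?_
    filter_upwards [hb, (ENNReal.tendsto_nhds_zero.mp hF) 1 one_pos] with i hb h1
    exact hb _ (ne_top_of_le_ne_top (by simp) h1)
  refine tendsto_sn_of_le (C := 2) (by simp)
    (by simpa using h1.add (H.tendsto_sn_T hq hr hrq hf)) (.of_forall fun i => ?_)
  have : (Φ i).T (F i) - φ.T f = (Φ i).T (F i - f) + ((Φ i).T f - φ.T f) := by
    rw [T_sub]
    abel
  rw [this]
  exact sn_add_le _ _ _

end CircleDiffeo

/-! ### Curves of diffeomorphisms -/

/-- A curve in a Banach space is differentiable if its images under a separating family of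
functionals have the expected derivatives and the expected derivative is continuous. -/
theorem hasDerivAt_of_separating {E ι : Type*} [NormedAddCommGroup E] [NormedSpace ℝ E]
    [CompleteSpace E] (L : ι → E →L[ℝ] ℝ) (hsep : ∀ a b, (∀ i, L i a = L i b) → a = b)
    {J : Set ℝ} (hJ : IsOpen J) {w v : ℝ → E} (hv : ContinuousOn v J)
    (hw : ∀ t ∈ J, ∀ i, HasDerivAt (fun τ => L i (w τ)) (L i (v t)) t) {t : ℝ} (ht : t ∈ J) :
    HasDerivAt w (v t) t := by
  obtain ⟨δ, hδ, hB⟩ := Metric.isOpen_iff.mp hJ t ht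
  have hsub : ∀ τ ∈ Metric.ball t δ, Set.uIcc t τ ⊆ J := fun τ hτ =>
    ((convex_ball t δ).ordConnected.uIcc_subset (Metric.mem_ball_self hδ) hτ).trans hB
  have hint : ∀ τ ∈ Metric.ball t δ, IntervalIntegrable v volume t τ := fun τ hτ =>
    (hv.mono (hsub τ hτ)).intervalIntegrable
  -- The fundamental theorem of calculus holds for each functional, hence for the vector-valued
  -- curve because the functionals separate points.
  have heq : ∀ τ ∈ Metric.ball t δ, w τ = w t + ∫ r in t..τ, v r := fun τ hτ => by
    refine hsep _ _ fun i => ?_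
    rw [map_add, ← ContinuousLinearMap.intervalIntegral_comp_comm _ (hint τ hτ),
      intervalIntegral.integral_eq_sub_of_hasDerivAt (f := fun r => L i (w r))
        (fun r hr => hw r (hsub τ hτ hr) i)
        ((L i).continuous.comp_continuousOn (hv.mono (hsub τ hτ))).intervalIntegrable]
    ring
  have hd : HasDerivAt (fun τ => w t + ∫ r in t..τ, v r) (v t) t := by
    refine HasDerivAt.const_add _ (intervalIntegral.integral_hasDerivAt_right
      (IntervalIntegrable.refl) ?_ (hv.continuousAt (hJ.mem_nhds ht)))
    exact hv.stronglyMeasurableAtFilter hJ t ht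
  refine hd.congr_of_eventuallyEq ?_
  filter_upwards [Metric.ball_mem_nhds t hδ] with τ hτ using heq τ hτ

/-- Both times are evaluated at the same moving point y τ, so no spatial derivative enters and y
need only be continuous. The Sobolev embedding makes the remainder uniform in that point. -/
theorem Hs.hasDerivAt_sub_apply {r : ℝ} (hr : 1 / 2 < r) {F : ℝ → Hs r} {F' : Hs r} {t : ℝ}
    (hF : HasDerivAt F F' t) {y : ℝ → UnitAddCircle} (hy : ContinuousAt y t) :
    HasDerivAt (fun τ => (F τ).1 (y τ) - (F t).1 (y τ)) (F'.1 (y t)) t := by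
  rw [hasDerivAt_iff_isLittleO] at hF ⊢
  have h1 : (fun τ => (F τ - F t - (τ - t) • F').1 (y τ)) =o[𝓝 t] fun τ => τ - t := by
    refine Asymptotics.IsBigO.trans_isLittleO ?_ hF
    exact Asymptotics.IsBigO.of_bound _ (.of_forall fun τ => Hs.abs_apply_le hr _ _)
  have h2 : (fun τ => (τ - t) * (F'.1 (y τ) - F'.1 (y t))) =o[𝓝 t] fun τ => τ - t := by
    have h3 : (fun τ => F'.1 (y τ) - F'.1 (y t)) =o[𝓝 t] fun _ => (1 : ℝ) := by
      rw [Asymptotics.isLittleO_one_iff]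
      have h4 : Tendsto (fun τ => F'.1 (y τ)) (𝓝 t) (𝓝 (F'.1 (y t))) :=
        (F'.1.continuous.continuousAt.comp hy)
      simpa using h4.sub_const (F'.1 (y t))
    simpa using (Asymptotics.isBigO_refl (fun τ => τ - t) (𝓝 t)).mul_isLittleO h3
  refine (h1.add h2).congr_left fun τ => ?_
  have h5 : (F τ - F t - (τ - t) • F').1 (y τ) =
      (F τ).1 (y τ) - (F t).1 (y τ) - (τ - t) * F'.1 (y τ) := rfl
  rw [h5, sub_self, smul_eq_mul]
  ring

namespace CircleDiffeo

/-- The inverse solves φ_τ⁻¹(x) = φ_t⁻¹(x - (h_τ - h_t)(φ_τ⁻¹(x))). It is first shown to be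
continuous in τ; then the inner difference is differentiable by `Hs.hasDerivAt_sub_apply`, and the
chain rule applies to the fixed map φ_t⁻¹. -/
theorem hasDerivAt_inv_curve {r : ℝ} (hr : 1 / 2 < r) {H : ℝ → Hs r} {H' : Hs r} {t : ℝ}
    (hH : HasDerivAt H H' t) {Φ : ℝ → CircleDiffeo} (hΦ : ∀ᶠ τ in 𝓝 t, (Φ τ).h = (H τ).1)
    (x : ℝ) :
    HasDerivAt (fun τ => (Φ τ).inv x)
      (-((Φ t).R ((Φ t).inv x : UnitAddCircle) * H'.1 ((Φ t).inv x : UnitAddCircle))) t := by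
  have hB : ∀ x, (Φ t).R x ≤ ‖(Φ t).R‖ := fun x => (abs_le.mp ((Φ t).R.norm_coe_le_norm x)).2
  have hΦt : (Φ t).h = (H t).1 := hΦ.self_of_nhds
  have hc : ContinuousAt (fun τ => (Φ τ).inv x) t := by
    rw [ContinuousAt, tendsto_iff_norm_sub_tendsto_zero]
    have h1 : Tendsto (fun τ => ‖(Φ t).R‖ * (Real.sqrt (wsum r).toReal * ‖H τ - H t‖)) (𝓝 t)
        (𝓝 0) := by
      have := ((tendsto_iff_norm_sub_tendsto_zero.mp hH.continuousAt.tendsto).const_mul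
        (Real.sqrt (wsum r).toReal)).const_mul ‖(Φ t).R‖
      simpa using this
    refine squeeze_zero' (.of_forall fun _ => norm_nonneg _) ?_ h1
    filter_upwards [hΦ] with τ hτ
    refine (abs_inv_sub_inv_le (Φ τ) hB x).trans ?_
    gcongr
    rw [hτ, hΦt]
    exact Hs.abs_apply_le hr (H τ - H t) _
  have hy : ContinuousAt (fun τ => ((Φ τ).inv x : UnitAddCircle)) t :=
    (AddCircle.continuous_mk' 1).continuousAt.comp hc
  have h2 := Hs.hasDerivAt_sub_apply hr hH hy
  have h3 := h2.const_sub x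
  have h4 : HasDerivAt (Φ t).inv ((Φ t).R ((Φ t).inv x : UnitAddCircle))
      (x - ((H t).1 ((Φ t).inv x : UnitAddCircle) - (H t).1 ((Φ t).inv x : UnitAddCircle))) := by
    rw [sub_self, sub_zero]
    exact (Φ t).hasDerivAt_inv x
  have h5 := h4.comp t h3
  rw [mul_neg] at h5
  refine h5.congr_of_eventuallyEq ?_
  filter_upwards [hΦ] with τ hτ
  simp only [Function.comp]
  rw [← hτ, ← hΦt]
  conv_lhs => rw [← (Φ t).inv_lift ((Φ τ).inv x)]
  congr 1
  have h6 := (Φ τ).lift_inv x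
  unfold lift at h6 ⊢
  linarith

/-- Chain rule for F_τ ∘ φ_τ⁻¹: the subtracted product is the convective term, velocity times
spatial derivative. The derivative is pointwise in x and is upgraded to a Sobolev norm later. -/
theorem hasDerivAt_T_curve {r : ℝ} (hr : 1 / 2 < r) {H : ℝ → Hs r} {H' : Hs r} {t : ℝ}
    (hH : HasDerivAt H H' t) {Φ : ℝ → CircleDiffeo} (hΦ : ∀ᶠ τ in 𝓝 t, (Φ τ).h = (H τ).1)
    {p : ℝ} (hp : 1 / 2 < p) {F : ℝ → Hs p} {F' : Hs p} (hF : HasDerivAt F F' t)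
    {f' : C(UnitAddCircle, ℝ)} (hf' : IsDer (F t).1 f') (x : UnitAddCircle) :
    HasDerivAt (fun τ => (Φ τ).T (F τ).1 x)
      (((Φ t).T F'.1 - (Φ t).T H'.1 * (Φ t).T (f' * (Φ t).R)) x) t := by
  induction x using QuotientAddGroup.induction_on with
  | H x =>
    have h1 := hasDerivAt_inv_curve hr hH hΦ x
    have hy : ContinuousAt (fun τ => ((Φ τ).inv x : UnitAddCircle)) t :=
      (AddCircle.continuous_mk' 1).continuousAt.comp h1.continuousAt
    have h2 := Hs.hasDerivAt_sub_apply hp hF hy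
    have h3 := (hf' ((Φ t).inv x)).comp t h1
    have h4 := h2.add h3
    refine (h4.congr_of_eventuallyEq (.of_forall fun τ => ?_)).congr_deriv ?_
    · change (F τ).1 ((Φ τ).inv x : UnitAddCircle) = _
      simp [Function.comp]
    · change _ = F'.1 ((Φ t).inv x : UnitAddCircle) - H'.1 ((Φ t).inv x : UnitAddCircle) *
        (f' ((Φ t).inv x : UnitAddCircle) * (Φ t).R ((Φ t).inv x : UnitAddCircle))
      ring

/-- The identity. -/
def id : CircleDiffeo where
  h := 0
  h' := 0
  R := 1
  isDer _ := hasDerivAt_const _ _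
  h_zero := rfl
  pos _ := by simp
  recip := by simp

end CircleDiffeo

/-! ### Translation between elements of the group and circle diffeomorphisms -/

theorem exists_circleDiffeo {s : ℝ} (hs : 3 / 2 < s) {c : H0 s × Hs (s - 1)} (hc : c ∈ Gs s) :
    ∃ φ : CircleDiffeo, φ.h = c.1.1.1 := by
  obtain ⟨h', hh'⟩ := exists_isDer hs c.1.1.sn_ne_top
  have hd : ∀ x : ℝ, HasDerivAt (diffeo c) (1 + h' (x : UnitAddCircle)) x := fun x =>
    (hasDerivAt_id x).add (hh' x)
  have hpos : ∀ x : UnitAddCircle, 0 < 1 + h' x := fun x => by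
    induction x using QuotientAddGroup.induction_on with
    | H x => rw [← (hd x).deriv]; exact hc x
  obtain ⟨R, hR⟩ := exists_recip (a := 1 + h') fun x => (hpos x).ne'
  exact ⟨⟨_, h', R, hh', c.1.2, hpos, hR⟩, rfl⟩

theorem toIdentity_eq {s : ℝ} {c : H0 s × Hs (s - 1)} {φ : CircleDiffeo} (h : φ.h = c.1.1.1)
    (U : H0 s × Hs (s - 1)) :
    toIdentity c U = (fun x : ℝ => φ.T U.1.1.1 (x : UnitAddCircle),
      fun x : ℝ => φ.T U.2.1 (x : UnitAddCircle)) := by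
  have h1 : diffeo c = φ.lift := by
    unfold diffeo CircleDiffeo.lift
    rw [h]
    rfl
  have h2 : diffeoInv c = φ.inv := by
    unfold diffeoInv CircleDiffeo.inv
    rw [h1]
  unfold toIdentity
  rw [h2]
  rfl

theorem tendsto_sn_mul {ι : Type*} {l : Filter ι} {r : ℝ} (hr : 1 / 2 < r)
    {F G : ι → C(UnitAddCircle, ℝ)} {f g : C(UnitAddCircle, ℝ)} (hf : sn r f ≠ ⊤)
    (hg : sn r g ≠ ⊤) (hF : Tendsto (fun i => sn r (F i - f)) l (𝓝 0))
    (hG : Tendsto (fun i => sn r (G i - g)) l (𝓝 0)) :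
    Tendsto (fun i => sn r (F i * G i - f * g)) l (𝓝 0) := by
  have hm := mulConst_ne_top hr
  have h1 : Tendsto (fun i => sn r (F i - f) + sn r (G i - g)) l (𝓝 0) := by
    simpa using hF.add hG
  refine tendsto_sn_of_le (C := 2 * (mulConst r * (2 * (1 + sn r g)) + mulConst r * sn r f))
    (by finiteness) h1 ?_
  filter_upwards [(ENNReal.tendsto_nhds_zero.mp hF) 1 one_pos,
    (ENNReal.tendsto_nhds_zero.mp hG) 1 one_pos] with i h1 h2
  have e : F i * G i - f * g = (F i - f) * G i + f * (G i - g) := by ring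
  rw [e]
  refine (sn_add_le _ _ _).trans ?_
  rw [mul_assoc 2, add_mul]
  have hGi : sn r (G i) ≤ 2 * (1 + sn r g) := by
    have := sn_add_le r (G i - g) g
    rw [sub_add_cancel] at this
    exact this.trans (by gcongr)
  gcongr 2 * (?_ + ?_)
  · refine (sn_mul_le hr (ne_top_of_le_ne_top (by simp) h1)).trans ?_
    rw [mul_assoc]
    gcongr mulConst r * ?_
    rw [mul_comm]
    gcongr
    exact le_self_add
  · refine (sn_mul_le hr hf).trans ?_
    rw [mul_assoc]
    gcongr
    exact le_add_self

theorem tendsto_sn_sub {ι : Type*} {l : Filter ι} {r : ℝ}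
    {F G : ι → C(UnitAddCircle, ℝ)} {f g : C(UnitAddCircle, ℝ)}
    (hF : Tendsto (fun i => sn r (F i - f)) l (𝓝 0))
    (hG : Tendsto (fun i => sn r (G i - g)) l (𝓝 0)) :
    Tendsto (fun i => sn r ((F i - G i) - (f - g))) l (𝓝 0) := by
  refine tendsto_sn_of_le (C := 2) (by simp) (by simpa using hF.add hG) (.of_forall fun i => ?_)
  rw [sub_sub_sub_comm]
  exact sn_sub_le _ _ _

theorem tendsto_sn_mono {ι : Type*} {l : Filter ι} {r q : ℝ} (h : r ≤ q)
    {F : ι → C(UnitAddCircle, ℝ)} (hF : Tendsto (fun i => sn q (F i)) l (𝓝 0)) :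
    Tendsto (fun i => sn r (F i)) l (𝓝 0) :=
  tendsto_of_tendsto_of_tendsto_of_le_of_le tendsto_const_nhds hF (fun _ => zero_le)
    fun _ => sn_mono h _

theorem pair_tendsto_iff {ι : Type*} {l : Filter ι} {a b : ℝ} {F : ι → H0 a × Hs b}
    {G : H0 a × Hs b} : Tendsto F l (𝓝 G) ↔
      Tendsto (fun i => sn a ((F i).1.1.1 - G.1.1.1)) l (𝓝 0) ∧
      Tendsto (fun i => sn b ((F i).2.1 - G.2.1)) l (𝓝 0) := by
  rw [Prod.tendsto_iff, Topology.IsInducing.subtypeVal.tendsto_nhds_iff, Hs.tendsto_iff,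
    Hs.tendsto_iff]
  rfl

/-- The element of `H_0^a × H^b` given by a pair of functions. -/
def pairOfFun {a b : ℝ} (f g : C(UnitAddCircle, ℝ)) (hf : sn a f ≠ ⊤)
    (hf0 : f ((0 : ℝ) : UnitAddCircle) = 0) (hg : sn b g ≠ ⊤) : H0 a × Hs b :=
  (⟨Hs.ofFun f hf, hf0⟩, Hs.ofFun g hg)

/-! ### Regularity of the Eulerian velocity -/

section EulerianVelocity

variable {s : ℝ} {J : Set ℝ} {c : ℝ → H0 s × Hs (s - 1)} {Φ : ℝ → CircleDiffeo}

theorem exists_circleDiffeo_curve (hs : 3 / 2 < s) (hcG : ∀ t ∈ J, c t ∈ Gs s) :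
    ∃ Φ : ℝ → CircleDiffeo, ∀ t ∈ J, (Φ t).h = (c t).1.1.1 := by
  have h : ∀ t, ∃ φ : CircleDiffeo, t ∈ J → φ.h = (c t).1.1.1 := fun t => by
    by_cases ht : t ∈ J
    · obtain ⟨φ, hφ⟩ := exists_circleDiffeo hs (hcG t ht)
      exact ⟨φ, fun _ => hφ⟩
    -- Default value outside J, where nothing is claimed.
    · exact ⟨CircleDiffeo.id, fun h => absurd h ht⟩
  choose Φ hΦ using h
  exact ⟨Φ, hΦ⟩

theorem circleDiffeo_sn_ne_top {φ : CircleDiffeo} {a : H0 s × Hs (s - 1)} (h : φ.h = a.1.1.1) :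
    sn (s - 1 + 1) φ.h ≠ ⊤ := by
  rw [h, sub_add_cancel]
  exact a.1.1.sn_ne_top

theorem circleDiffeo_converges (hc : ContinuousOn c J) (hΦ : ∀ t ∈ J, (Φ t).h = (c t).1.1.1)
    {t : ℝ} (ht : t ∈ J) : CircleDiffeo.Converges (s - 1) (𝓝[J] t) Φ (Φ t) := by
  refine ⟨circleDiffeo_sn_ne_top (hΦ t ht), ?_⟩
  refine ((pair_tendsto_iff.mp (hc t ht)).1).congr' ?_
  filter_upwards [self_mem_nhdsWithin] with τ hτ
  rw [hΦ τ hτ, hΦ t ht, sub_add_cancel]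

theorem sn_T_ne_top {q : ℝ} (hq : 3 / 2 < q) {φ : CircleDiffeo} (h : sn (q + 1) φ.h ≠ ⊤) {r : ℝ}
    (hr : 0 ≤ r) (hrq : r ≤ q + 1) {f : C(UnitAddCircle, ℝ)} (hf : sn r f ≠ ⊤) :
    sn r (φ.T f) ≠ ⊤ := by
  obtain ⟨C, hC, hT⟩ := CircleDiffeo.bound_self hq h hr hrq
  exact ne_top_of_le_ne_top (by finiteness) (hT f hf)

theorem T_zero_of_zero (φ : CircleDiffeo) {f : C(UnitAddCircle, ℝ)}
    (hf : f ((0 : ℝ) : UnitAddCircle) = 0) : φ.T f ((0 : ℝ) : UnitAddCircle) = 0 := by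
  rw [CircleDiffeo.T_coe, φ.inv_zero, hf]

/-- Transport of a continuous curve of tangent vectors to the identity is continuous. -/
theorem tendsto_transport (hs : 5 / 2 < s) (hc : ContinuousOn c J)
    (hΦ : ∀ t ∈ J, (Φ t).h = (c t).1.1.1) {X : ℝ → H0 s × Hs (s - 1)} (hX : ContinuousOn X J)
    {t : ℝ} (ht : t ∈ J) :
    Tendsto (fun τ => sn s ((Φ τ).T (X τ).1.1.1 - (Φ t).T (X t).1.1.1)) (𝓝[J] t) (𝓝 0) ∧
    Tendsto (fun τ => sn (s - 1) ((Φ τ).T (X τ).2.1 - (Φ t).T (X t).2.1)) (𝓝[J] t) (𝓝 0) := by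
  have H := circleDiffeo_converges hc hΦ ht
  have h := pair_tendsto_iff.mp (hX t ht)
  exact ⟨H.tendsto_sn_T_joint (by linarith) (by linarith) (by linarith) (X t).1.1.sn_ne_top h.1,
    H.tendsto_sn_T_joint (by linarith) (by linarith) (by linarith) (X t).2.sn_ne_top h.2⟩

/-- The Eulerian velocity is a continuous curve in `H_0^s × H^{s-1}`. -/
theorem exists_continuousOn_eulerian (hs : 5 / 2 < s) (hc : ContinuousOn c J)
    (hc' : ContinuousOn (deriv c) J) (hcG : ∀ t ∈ J, c t ∈ Gs s) :
    ∃ v : ℝ → H0 s × Hs (s - 1), (∀ t ∈ J, pairFun (v t) = eulerian c t) ∧ ContinuousOn v J := by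
  obtain ⟨Φ, hΦ⟩ := exists_circleDiffeo_curve (by linarith) hcG
  have h : ∀ t, ∃ v : H0 s × Hs (s - 1), t ∈ J →
      v.1.1.1 = (Φ t).T (deriv c t).1.1.1 ∧ v.2.1 = (Φ t).T (deriv c t).2.1 := fun t => by
    by_cases ht : t ∈ J
    · have hf := circleDiffeo_sn_ne_top (hΦ t ht)
      exact ⟨pairOfFun ((Φ t).T (deriv c t).1.1.1) ((Φ t).T (deriv c t).2.1)
        (sn_T_ne_top (by linarith) hf (by linarith) (by linarith) (deriv c t).1.1.sn_ne_top)
        (T_zero_of_zero _ (deriv c t).1.2)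
        (sn_T_ne_top (by linarith) hf (by linarith) (by linarith) (deriv c t).2.sn_ne_top),
        fun _ => ⟨rfl, rfl⟩⟩
    · exact ⟨0, fun h => absurd h ht⟩
  choose v hv using h
  refine ⟨v, fun t ht => ?_, fun t ht => ?_⟩
  · rw [eulerian, toIdentity_eq (hΦ t ht), ← (hv t ht).1, ← (hv t ht).2]
    rfl
  · have h := tendsto_transport hs hc hΦ hc' ht
    refine pair_tendsto_iff.mpr ⟨h.1.congr' ?_, h.2.congr' ?_⟩
    · filter_upwards [self_mem_nhdsWithin] with τ hτ
      rw [(hv τ hτ).1, (hv t ht).1]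
    · filter_upwards [self_mem_nhdsWithin] with τ hτ
      rw [(hv τ hτ).2, (hv t ht).2]

/-- The Eulerian velocity is a `C¹` curve in `H_0^{s-1} × H^{s-2}`, with time derivative
`(φ_tt ∘ φ⁻¹ - u uₓ, α_tt ∘ φ⁻¹ - u ρₓ)`. -/
theorem exists_contDiffOn_eulerian (hs : 5 / 2 < s) (hJ : IsOpen J) (hc : ContDiffOn ℝ 2 c J)
    (hcG : ∀ t ∈ J, c t ∈ Gs s) :
    ∃ w : ℝ → H0 (s - 1) × Hs (s - 2), (∀ t ∈ J, pairFun (w t) = eulerian c t) ∧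
      ContDiffOn ℝ 1 w J ∧ ∀ t ∈ J, ∃ φ : CircleDiffeo, φ.h = (c t).1.1.1 ∧
        ∃ ux ρx : C(UnitAddCircle, ℝ), IsDer (φ.T (deriv c t).1.1.1) ux ∧
          IsDer (φ.T (deriv c t).2.1) ρx ∧ pairFun (deriv w t) =
            (fun x : ℝ => (φ.T (deriv (deriv c) t).1.1.1 - φ.T (deriv c t).1.1.1 * ux)
              (x : UnitAddCircle),
            fun x : ℝ => (φ.T (deriv (deriv c) t).2.1 - φ.T (deriv c t).1.1.1 * ρx)
              (x : UnitAddCircle)) := by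
  have h2 : ContDiffOn ℝ (1 + 1) c J := by rwa [one_add_one_eq_two]
  have h1 : ContDiffOn ℝ 1 (deriv c) J := ((contDiffOn_succ_iff_deriv_of_isOpen hJ).mp h2).2.2
  have h1' : ContDiffOn ℝ (0 + 1) (deriv c) J := by rwa [zero_add]
  have hc0 : ContinuousOn c J := hc.continuousOn
  have hc1 : ContinuousOn (deriv c) J := h1.continuousOn
  have hc2 : ContinuousOn (deriv (deriv c)) J :=
    (((contDiffOn_succ_iff_deriv_of_isOpen hJ).mp h1').2.2).continuousOn
  have hd1 : ∀ t ∈ J, HasDerivAt c (deriv c t) t := fun t ht =>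
    ((hc.differentiableOn (by simp)).differentiableAt (hJ.mem_nhds ht)).hasDerivAt
  have hd2 : ∀ t ∈ J, HasDerivAt (deriv c) (deriv (deriv c) t) t := fun t ht =>
    ((h1.differentiableOn (by simp)).differentiableAt (hJ.mem_nhds ht)).hasDerivAt
  obtain ⟨Φ, hΦ⟩ := exists_circleDiffeo_curve (by linarith) hcG
  set u : ℝ → C(UnitAddCircle, ℝ) := fun t => (Φ t).T (deriv c t).1.1.1 with hu
  set ρ : ℝ → C(UnitAddCircle, ℝ) := fun t => (Φ t).T (deriv c t).2.1 with hρ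
  choose U1' hU1' using fun t => exists_isDer (by linarith) (deriv c t).1.1.sn_ne_top
  choose U2' hU2' using fun t => exists_isDer (by linarith) (deriv c t).2.sn_ne_top
  set ux : ℝ → C(UnitAddCircle, ℝ) := fun t => (Φ t).T (U1' t * (Φ t).R) with hux
  set ρx : ℝ → C(UnitAddCircle, ℝ) := fun t => (Φ t).T (U2' t * (Φ t).R) with hρx
  have dux : ∀ t, IsDer (u t) (ux t) := fun t => (Φ t).isDer_T (hU1' t)
  have dρx : ∀ t, IsDer (ρ t) (ρx t) := fun t => (Φ t).isDer_T (hU2' t)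
  have hfin : ∀ t ∈ J, sn (s - 1 + 1) (Φ t).h ≠ ⊤ := fun t ht =>
    circleDiffeo_sn_ne_top (hΦ t ht)
  have fu : ∀ t ∈ J, sn s (u t) ≠ ⊤ := fun t ht =>
    sn_T_ne_top (by linarith) (hfin t ht) (by linarith) (by linarith) (deriv c t).1.1.sn_ne_top
  have fρ : ∀ t ∈ J, sn (s - 1) (ρ t) ≠ ⊤ := fun t ht =>
    sn_T_ne_top (by linarith) (hfin t ht) (by linarith) (by linarith) (deriv c t).2.sn_ne_top
  have fux : ∀ t ∈ J, sn (s - 1) (ux t) ≠ ⊤ := fun t ht =>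
    sn_ne_top_of_isDer (dux t) (by rw [sub_add_cancel]; exact fu t ht)
  have fρx : ∀ t ∈ J, sn (s - 2) (ρx t) ≠ ⊤ := fun t ht =>
    sn_ne_top_of_isDer (dρx t) (by rw [show s - 2 + 1 = s - 1 by ring]; exact fρ t ht)
  have fa : ∀ t ∈ J, sn s ((Φ t).T (deriv (deriv c) t).1.1.1) ≠ ⊤ := fun t ht =>
    sn_T_ne_top (by linarith) (hfin t ht) (by linarith) (by linarith)
      (deriv (deriv c) t).1.1.sn_ne_top
  have fb : ∀ t ∈ J, sn (s - 1) ((Φ t).T (deriv (deriv c) t).2.1) ≠ ⊤ := fun t ht =>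
    sn_T_ne_top (by linarith) (hfin t ht) (by linarith) (by linarith)
      (deriv (deriv c) t).2.sn_ne_top
  have hw : ∀ t, ∃ w : H0 (s - 1) × Hs (s - 2), t ∈ J → w.1.1.1 = u t ∧ w.2.1 = ρ t := fun t => by
    by_cases ht : t ∈ J
    · exact ⟨pairOfFun (u t) (ρ t) (sn_ne_top_of_le (by linarith) (fu t ht))
        (T_zero_of_zero _ (deriv c t).1.2) (sn_ne_top_of_le (by linarith) (fρ t ht)),
        fun _ => ⟨rfl, rfl⟩⟩
    · exact ⟨0, fun h => absurd h ht⟩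
  have hw' : ∀ t, ∃ w : H0 (s - 1) × Hs (s - 2), t ∈ J →
      w.1.1.1 = (Φ t).T (deriv (deriv c) t).1.1.1 - u t * ux t ∧
      w.2.1 = (Φ t).T (deriv (deriv c) t).2.1 - u t * ρx t := fun t => by
    by_cases ht : t ∈ J
    · refine ⟨pairOfFun ((Φ t).T (deriv (deriv c) t).1.1.1 - u t * ux t)
        ((Φ t).T (deriv (deriv c) t).2.1 - u t * ρx t)
        (sn_sub_ne_top (sn_ne_top_of_le (by linarith) (fa t ht)) (sn_mul_ne_top (by linarith)
          (sn_ne_top_of_le (by linarith) (fu t ht)) (fux t ht))) ?_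
        (sn_sub_ne_top (sn_ne_top_of_le (by linarith) (fb t ht)) (sn_mul_ne_top (by linarith)
          (sn_ne_top_of_le (by linarith) (fu t ht)) (fρx t ht))),
        fun _ => ⟨rfl, rfl⟩⟩
      rw [ContinuousMap.sub_apply, ContinuousMap.mul_apply,
        T_zero_of_zero _ (deriv (deriv c) t).1.2, hu, T_zero_of_zero _ (deriv c t).1.2]
      ring
    · exact ⟨0, fun h => absurd h ht⟩
  choose w hw using hw
  choose v hv using hw'
  -- One order is lost through u_x and ρ_x, so the products uu_x and uρ_x are controlled in H^{s-1}
  -- and H^{s-2}; both spaces are algebras because s - 2 > 1/2.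
  have hvc : ContinuousOn v J := by
    intro t ht
    have hcu := tendsto_transport hs hc0 hΦ hc1 ht
    have hca := tendsto_transport hs hc0 hΦ hc2 ht
    have hcux : Tendsto (fun τ => sn (s - 1) (ux τ - ux t)) (𝓝[J] t) (𝓝 0) := by
      refine tendsto_sn_of_le (C := ENNReal.ofReal ((2 * Real.pi) ^ 2)) (by simp) hcu.1
        (.of_forall fun τ => ?_)
      have := sn_le_of_isDer ((dux τ).sub (dux t)) (s - 1)
      rwa [sub_add_cancel] at this
    have hcρx : Tendsto (fun τ => sn (s - 2) (ρx τ - ρx t)) (𝓝[J] t) (𝓝 0) := by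
      refine tendsto_sn_of_le (C := ENNReal.ofReal ((2 * Real.pi) ^ 2)) (by simp) hcu.2
        (.of_forall fun τ => ?_)
      have := sn_le_of_isDer ((dρx τ).sub (dρx t)) (s - 2)
      rwa [show s - 2 + 1 = s - 1 by ring] at this
    refine pair_tendsto_iff.mpr
      ⟨(tendsto_sn_sub (tendsto_sn_mono (by linarith) hca.1) (tendsto_sn_mul (by linarith)
        (sn_ne_top_of_le (by linarith) (fu t ht)) (fux t ht)
        (tendsto_sn_mono (by linarith) hcu.1) hcux)).congr' ?_,
       (tendsto_sn_sub (tendsto_sn_mono (by linarith) hca.2) (tendsto_sn_mul (by linarith)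
        (sn_ne_top_of_le (by linarith) (fu t ht)) (fρx t ht)
        (tendsto_sn_mono (by linarith) hcu.1) hcρx)).congr' ?_⟩
    · filter_upwards [self_mem_nhdsWithin] with τ hτ
      rw [(hv τ hτ).1, (hv t ht).1]
    · filter_upwards [self_mem_nhdsWithin] with τ hτ
      rw [(hv τ hτ).2, (hv t ht).2]
  have hr1 : 1 / 2 < s - 1 := by linarith
  have hr2 : 1 / 2 < s - 2 := by linarith
  have hwd : ∀ t ∈ J, HasDerivAt w (v t) t := by
    intro t ht
    have := H0.completeSpace hr1
    have := Hs.completeSpace hr2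
    -- Point evaluations of the two components, continuous by the Sobolev embedding, form the
    -- separating family; `hasDerivAt_T_curve` supplies their time derivatives.
    let L : UnitAddCircle ⊕ UnitAddCircle → (H0 (s - 1) × Hs (s - 2)) →L[ℝ] ℝ :=
      Sum.elim
        (fun x => ((Hs.evalCLM hr1 x).comp (H0 (s - 1)).subtypeL).comp (ContinuousLinearMap.fst ..))
        (fun x => (Hs.evalCLM hr2 x).comp (ContinuousLinearMap.snd ..))
    refine hasDerivAt_of_separating L (fun a b h => ?_) hJ hvc (fun t ht i => ?_) ht
    · exact Prod.ext
        (Subtype.ext (Subtype.ext (ContinuousMap.ext fun x => h (Sum.inl x))))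
        (Subtype.ext (ContinuousMap.ext fun x => h (Sum.inr x)))
    · have hH : HasDerivAt (fun τ => (c τ).1.1) (deriv c t).1.1 t :=
        ((H0 s).subtypeL.comp (ContinuousLinearMap.fst ℝ (H0 s) (Hs (s - 1)))).hasFDerivAt.comp_hasDerivAt
          t (hd1 t ht)
      have hF1 : HasDerivAt (fun τ => (deriv c τ).1.1) (deriv (deriv c) t).1.1 t :=
        ((H0 s).subtypeL.comp (ContinuousLinearMap.fst ℝ (H0 s) (Hs (s - 1)))).hasFDerivAt.comp_hasDerivAt
          t (hd2 t ht)
      have hF2 : HasDerivAt (fun τ => (deriv c τ).2) (deriv (deriv c) t).2 t :=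
        (ContinuousLinearMap.snd ℝ (H0 s) (Hs (s - 1))).hasFDerivAt.comp_hasDerivAt t (hd2 t ht)
      have hev : ∀ᶠ τ in 𝓝 t, (Φ τ).h = ((c τ).1.1).1 := by
        filter_upwards [hJ.mem_nhds ht] with τ hτ using hΦ τ hτ
      rcases i with x | x
      · have h := CircleDiffeo.hasDerivAt_T_curve (by linarith) hH hev (by linarith) hF1 (hU1' t) x
        refine (h.congr_of_eventuallyEq ?_).congr_deriv ?_
        · filter_upwards [hJ.mem_nhds ht] with τ hτ
          change (w τ).1.1.1 x = _
          rw [(hw τ hτ).1]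
        · change _ = (v t).1.1.1 x
          rw [(hv t ht).1]
      · have h := CircleDiffeo.hasDerivAt_T_curve (by linarith) hH hev (by linarith) hF2 (hU2' t) x
        refine (h.congr_of_eventuallyEq ?_).congr_deriv ?_
        · filter_upwards [hJ.mem_nhds ht] with τ hτ
          change (w τ).2.1 x = _
          rw [(hw τ hτ).2]
        · change _ = (v t).2.1 x
          rw [(hv t ht).2]
  refine ⟨w, fun t ht => ?_, ?_, fun t ht => ⟨Φ t, hΦ t ht, ux t, ρx t, dux t, dρx t, ?_⟩⟩
  · rw [eulerian, toIdentity_eq (hΦ t ht)]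
    change _ = ((fun x : ℝ => u t (x : UnitAddCircle)), (fun x : ℝ => ρ t (x : UnitAddCircle)))
    rw [← (hw t ht).1, ← (hw t ht).2]
    rfl
  · have : ContDiffOn ℝ (0 + 1) w J := by
      refine (contDiffOn_succ_iff_deriv_of_isOpen hJ).mpr
        ⟨fun t ht => (hwd t ht).differentiableAt.differentiableWithinAt, by simp, ?_⟩
      rw [contDiffOn_zero]
      exact hvc.congr fun t ht => (hwd t ht).deriv
    rwa [zero_add] at this
  · rw [(hwd t ht).deriv, ← (hv t ht).1, ← (hv t ht).2]
    rfl

end EulerianVelocity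

/-! ### The metric in Lagrangian coordinates -/

theorem intervalIntegrable_of_continuousMap (f : C(UnitAddCircle, ℝ)) (a b : ℝ) :
    IntervalIntegrable (fun x : ℝ => f (x : UnitAddCircle)) volume a b :=
  (continuous_coe_circle f).intervalIntegrable _ _

theorem integral_continuousMap_add (f g : C(UnitAddCircle, ℝ)) (a b : ℝ) :
    ∫ x in a..b, (f + g) (x : UnitAddCircle) =
      (∫ x in a..b, f (x : UnitAddCircle)) + ∫ x in a..b, g (x : UnitAddCircle) :=
  intervalIntegral.integral_add (intervalIntegrable_of_continuousMap _ _ _)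
    (intervalIntegrable_of_continuousMap _ _ _)

theorem integral_continuousMap_sub (f g : C(UnitAddCircle, ℝ)) (a b : ℝ) :
    ∫ x in a..b, (f - g) (x : UnitAddCircle) =
      (∫ x in a..b, f (x : UnitAddCircle)) - ∫ x in a..b, g (x : UnitAddCircle) :=
  intervalIntegral.integral_sub (intervalIntegrable_of_continuousMap _ _ _)
    (intervalIntegrable_of_continuousMap _ _ _)

theorem integral_continuousMap_smul (m : ℝ) (f : C(UnitAddCircle, ℝ)) (a b : ℝ) :
    ∫ x in a..b, (m • f) (x : UnitAddCircle) = m * ∫ x in a..b, f (x : UnitAddCircle) :=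
  intervalIntegral.integral_const_mul _ _

theorem CircleDiffeo.inv_norm_le (φ : CircleDiffeo) (x : UnitAddCircle) :
    (‖φ.R‖ + 1)⁻¹ ≤ 1 + φ.h' x := by
  have h1 := (abs_le.mp (φ.R.norm_coe_le_norm x)).2
  rw [φ.R_eq] at h1
  rw [inv_le_comm₀ (by positivity) (φ.pos x)]
  linarith

/-- Differentiation under the integral sign. Here b is the spatial derivative of the variation of φ;
A/φ_x and Bφ_x are the two shapes occurring in the metric density. -/
theorem hasDerivAt_integral_metric_density (φ : CircleDiffeo) (A B b : C(UnitAddCircle, ℝ)) :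
    HasDerivAt (fun ε : ℝ => ∫ x in (0:ℝ)..1, (A (x : UnitAddCircle) /
        (1 + φ.h' (x : UnitAddCircle) + ε * b (x : UnitAddCircle)) +
        B (x : UnitAddCircle) * (1 + φ.h' (x : UnitAddCircle) + ε * b (x : UnitAddCircle))))
      (∫ x in (0:ℝ)..1, (B * b - A * b * (φ.R * φ.R)) (x : UnitAddCircle)) 0 := by
  -- m is a positive lower bound for φ_x, and δ is chosen so that |εb| ≤ m/2; the denominators then
  -- stay above m/2.
  set m := (‖φ.R‖ + 1)⁻¹ with hm
  have hm0 : 0 < m := by positivity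
  set δ := m / 2 / (‖b‖ + 1) with hδ
  have hδ0 : 0 < δ := by positivity
  have low : ∀ ε ∈ Metric.ball (0 : ℝ) δ, ∀ x, m / 2 ≤ 1 + φ.h' x + ε * b x := by
    intro ε hε x
    have h1 := φ.inv_norm_le x
    have h2 : |ε * b x| ≤ m / 2 := by
      rw [abs_mul]
      calc |ε| * |b x| ≤ δ * (‖b‖ + 1) := by
            gcongr
            · rw [mem_ball_zero_iff] at hε
              exact hε.le
            · exact (b.norm_coe_le_norm x).trans (by linarith)
        _ = m / 2 := by rw [hδ]; field_simp
    have := (abs_le.mp h2).1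
    linarith
  have hcont : ∀ ε ∈ Metric.ball (0 : ℝ) δ, Continuous fun x : ℝ => (A (x : UnitAddCircle) /
        (1 + φ.h' (x : UnitAddCircle) + ε * b (x : UnitAddCircle)) +
        B (x : UnitAddCircle) * (1 + φ.h' (x : UnitAddCircle) + ε * b (x : UnitAddCircle))) := by
    intro ε hε
    have hA := continuous_coe_circle A
    have hB := continuous_coe_circle B
    have hb := continuous_coe_circle b
    have hh := continuous_coe_circle φ.h'
    refine (hA.div (by fun_prop) fun x => ?_).add (by fun_prop)
    have := low ε hε x
    exact ne_of_gt (by linarith)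
  have h0 : (0 : ℝ) ∈ Metric.ball (0 : ℝ) δ := Metric.mem_ball_self hδ0
  have key := (intervalIntegral.hasDerivAt_integral_of_dominated_loc_of_deriv_le
    (μ := volume) (a := 0) (b := 1) (x₀ := (0 : ℝ)) (s := Metric.ball (0 : ℝ) δ)
    (F := fun (ε : ℝ) (x : ℝ) => A (x : UnitAddCircle) /
        (1 + φ.h' (x : UnitAddCircle) + ε * b (x : UnitAddCircle)) +
        B (x : UnitAddCircle) * (1 + φ.h' (x : UnitAddCircle) + ε * b (x : UnitAddCircle)))
    (F' := fun (ε : ℝ) (x : ℝ) => -(A (x : UnitAddCircle) * b (x : UnitAddCircle)) /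
        (1 + φ.h' (x : UnitAddCircle) + ε * b (x : UnitAddCircle)) ^ 2 +
        B (x : UnitAddCircle) * b (x : UnitAddCircle))
    (bound := fun _ => ‖A‖ * ‖b‖ / (m / 2) ^ 2 + ‖B‖ * ‖b‖)
    (Metric.ball_mem_nhds 0 hδ0) ?_ ((hcont 0 h0).intervalIntegrable _ _) ?_ ?_
    intervalIntegrable_const ?_).2
  · refine key.congr_deriv (intervalIntegral.integral_congr fun x _ => ?_)
    simp only [ContinuousMap.sub_apply, ContinuousMap.mul_apply, φ.R_eq, zero_mul, add_zero]
    have := (φ.pos (x : UnitAddCircle)).ne'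
    field_simp
    ring
  · filter_upwards [Metric.ball_mem_nhds 0 hδ0] with ε hε
    exact (hcont ε hε).aestronglyMeasurable
  · have hA := continuous_coe_circle A
    have hB := continuous_coe_circle B
    have hb := continuous_coe_circle b
    have hh := continuous_coe_circle φ.h'
    refine Continuous.aestronglyMeasurable (((hA.mul hb).neg.div (by fun_prop) fun x => ?_).add
      (by fun_prop))
    have := low 0 h0 x
    exact pow_ne_zero 2 (ne_of_gt (by linarith))
  · refine .of_forall fun x _ ε hε => ?_
    have h1 := low ε hε x
    refine (norm_add_le _ _).trans ?_
    rw [norm_div, norm_neg, norm_mul, norm_mul, norm_pow]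
    gcongr
    · exact A.norm_coe_le_norm _
    · exact b.norm_coe_le_norm _
    · rw [Real.norm_eq_abs]
      exact h1.trans (le_abs_self _)
    · exact B.norm_coe_le_norm _
    · exact b.norm_coe_le_norm _
  · refine .of_forall fun x _ ε hε => ?_
    have h1 := low ε hε x
    have h2 : HasDerivAt (fun ε : ℝ => 1 + φ.h' (x : UnitAddCircle) + ε * b (x : UnitAddCircle))
        (b (x : UnitAddCircle)) ε := by
      simpa using ((hasDerivAt_id ε).mul_const (b (x : UnitAddCircle))).const_add
        (1 + φ.h' (x : UnitAddCircle))
    have h3 := ((hasDerivAt_const ε (A (x : UnitAddCircle))).div h2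
      (ne_of_gt (by linarith))).add (h2.const_mul (B (x : UnitAddCircle)))
    refine h3.congr_deriv ?_
    ring

section Metric

variable {s : ℝ} {c : H0 s × Hs (s - 1)} {φ : CircleDiffeo}

/-- Substitution y = φ(x): each spatial derivative carries a factor 1/φ_x and the measure a factor
φ_x. -/
theorem metric_eq (κ : ℝ) (hφ : φ.h = c.1.1.1) {Y Z : H0 s × Hs (s - 1)}
    {Y' Z' : C(UnitAddCircle, ℝ)} (hY : IsDer Y.1.1.1 Y') (hZ : IsDer Z.1.1.1 Z') :
    metric κ c Y Z = 1 / 4 * ∫ x in (0:ℝ)..1, ((Y' * Z') (x : UnitAddCircle) /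
      (1 + φ.h' (x : UnitAddCircle)) +
      (κ • (Y.2.1 * Z.2.1)) (x : UnitAddCircle) * (1 + φ.h' (x : UnitAddCircle))) := by
  rw [metric, metricId, toIdentity_eq hφ, toIdentity_eq hφ]
  congr 1
  have hc : Continuous fun x : ℝ => Y' (x : UnitAddCircle) * φ.R (x : UnitAddCircle) *
      (Z' (x : UnitAddCircle) * φ.R (x : UnitAddCircle)) +
      κ * (Y.2.1 (x : UnitAddCircle) * Z.2.1 (x : UnitAddCircle)) := by
    have h1 := continuous_coe_circle Y'
    have h2 := continuous_coe_circle Z'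
    have h3 := continuous_coe_circle φ.R
    have h4 := continuous_coe_circle Y.2.1
    have h5 := continuous_coe_circle Z.2.1
    fun_prop
  have h := φ.integral_comp_inv hc
  have e1 : ∀ x : ℝ, deriv (fun x : ℝ => φ.T Y.1.1.1 (x : UnitAddCircle)) x =
      φ.T (Y' * φ.R) (x : UnitAddCircle) := fun x => (φ.isDer_T hY x).deriv
  have e2 : ∀ x : ℝ, deriv (fun x : ℝ => φ.T Z.1.1.1 (x : UnitAddCircle)) x =
      φ.T (Z' * φ.R) (x : UnitAddCircle) := fun x => (φ.isDer_T hZ x).deriv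
  simp only [e1, e2]
  simp only [CircleDiffeo.T_coe, ContinuousMap.mul_apply]
  rw [h]
  refine intervalIntegral.integral_congr fun x _ => ?_
  have := (φ.pos (x : UnitAddCircle)).ne'
  simp only [φ.R_eq, ContinuousMap.smul_apply, ContinuousMap.mul_apply, smul_eq_mul]
  field_simp

theorem metricDeriv_eq (κ : ℝ) (hφ : φ.h = c.1.1.1) {X Y Z : H0 s × Hs (s - 1)}
    {X' Y' Z' : C(UnitAddCircle, ℝ)} (hX : IsDer X.1.1.1 X') (hY : IsDer Y.1.1.1 Y')
    (hZ : IsDer Z.1.1.1 Z') :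
    metricDeriv κ c X Y Z = 1 / 4 * ∫ x in (0:ℝ)..1,
      (κ • (Y.2.1 * Z.2.1) * X' - Y' * Z' * X' * (φ.R * φ.R)) (x : UnitAddCircle) := by
  have h := (hasDerivAt_integral_metric_density φ (Y' * Z') (κ • (Y.2.1 * Z.2.1)) X').const_mul
    (1 / 4 : ℝ)
  refine (h.congr_of_eventuallyEq ?_).deriv
  have hδ : 0 < (‖φ.R‖ + 1)⁻¹ / (‖X'‖ + 1) := by positivity
  -- For such ε the perturbed map is still a diffeomorphism, so the Lagrangian formula for the
  -- metric is available near ε = 0.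
  filter_upwards [Metric.ball_mem_nhds (0 : ℝ) hδ] with ε hε
  have hpos : ∀ x, 0 < 1 + (φ.h' + ε • X') x := fun x => by
    have h1 := φ.inv_norm_le x
    have h2 : |ε * X' x| < (‖φ.R‖ + 1)⁻¹ := by
      rw [abs_mul]
      rw [mem_ball_zero_iff, Real.norm_eq_abs] at hε
      calc |ε| * |X' x| ≤ |ε| * (‖X'‖ + 1) := by
            gcongr
            exact (X'.norm_coe_le_norm x).trans (by linarith)
        _ < (‖φ.R‖ + 1)⁻¹ / (‖X'‖ + 1) * (‖X'‖ + 1) := by gcongr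
        _ = _ := by field_simp
    have := (abs_lt.mp h2).1
    simp only [ContinuousMap.add_apply, ContinuousMap.smul_apply, smul_eq_mul]
    linarith
  obtain ⟨R, hR⟩ := exists_recip (a := 1 + (φ.h' + ε • X')) fun x => (hpos x).ne'
  have hd : IsDer (φ.h + ε • X.1.1.1) (φ.h' + ε • X') :=
    φ.isDer.add fun x => (hX x).const_smul ε
  have h0 : (φ.h + ε • X.1.1.1) ((0 : ℝ) : UnitAddCircle) = 0 := by
    have hX0 : X.1.1.1 ((0 : ℝ) : UnitAddCircle) = 0 := X.1.2
    rw [ContinuousMap.add_apply, ContinuousMap.smul_apply, φ.h_zero, hX0, smul_zero, add_zero]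
  let ψ : CircleDiffeo := ⟨φ.h + ε • X.1.1.1, φ.h' + ε • X', R, hd, h0, hpos, hR⟩
  have hψ : ψ.h = (c + ε • X).1.1.1 := by
    change φ.h + ε • X.1.1.1 = _
    rw [hφ]
    rfl
  rw [metric_eq κ hψ hY hZ]
  congr 1
  refine intervalIntegral.integral_congr fun x _ => ?_
  simp only [ψ, ContinuousMap.add_apply, ContinuousMap.smul_apply, smul_eq_mul, add_assoc]

/-- The acceleration `∇_{c_t} c_t`, tested against `Z`, in Lagrangian coordinates. -/
theorem metric_add_christoffelFirst_eq (κ : ℝ) (hφ : φ.h = c.1.1.1) {U V Z : H0 s × Hs (s - 1)}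
    {U' V' Z' : C(UnitAddCircle, ℝ)} (hU : IsDer U.1.1.1 U') (hV : IsDer V.1.1.1 V')
    (hZ : IsDer Z.1.1.1 Z') :
    metric κ c V Z + christoffelFirst κ c U U Z = 1 / 4 * ∫ x in (0:ℝ)..1,
      (Z' * (V' * φ.R - (1 / 2 : ℝ) • ((U' * φ.R) * (U' * φ.R) + κ • (U.2.1 * U.2.1))) +
        κ • (Z.2.1 * (V.2.1 * (1 + φ.h') + U.2.1 * U'))) (x : UnitAddCircle) := by
  have e : ∫ x in (0:ℝ)..1, ((V' * Z') (x : UnitAddCircle) / (1 + φ.h' (x : UnitAddCircle)) +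
      (κ • (V.2.1 * Z.2.1)) (x : UnitAddCircle) * (1 + φ.h' (x : UnitAddCircle))) =
      ∫ x in (0:ℝ)..1, (V' * Z' * φ.R + κ • (V.2.1 * Z.2.1) * (1 + φ.h')) (x : UnitAddCircle) := by
    refine intervalIntegral.integral_congr fun x _ => ?_
    simp only [ContinuousMap.add_apply, ContinuousMap.mul_apply, ContinuousMap.one_apply, φ.R_eq]
    rfl
  -- With both arguments equal to U, the first two terms of Koszul's formula coincide and only the
  -- term differentiated along Z keeps the factor ½.
  rw [christoffelFirst, metric_eq κ hφ hV hZ, metricDeriv_eq κ hφ hU hU hZ,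
    metricDeriv_eq κ hφ hZ hU hU, e]
  have e2 : Z' * (V' * φ.R - (1 / 2 : ℝ) • ((U' * φ.R) * (U' * φ.R) + κ • (U.2.1 * U.2.1))) +
        κ • (Z.2.1 * (V.2.1 * (1 + φ.h') + U.2.1 * U')) =
      (V' * Z' * φ.R + κ • (V.2.1 * Z.2.1) * (1 + φ.h')) +
      ((κ • (U.2.1 * Z.2.1) * U' - U' * Z' * U' * (φ.R * φ.R)) -
        (1 / 2 : ℝ) • (κ • (U.2.1 * U.2.1) * Z' - U' * U' * Z' * (φ.R * φ.R))) := by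
    ext x
    simp only [ContinuousMap.add_apply, ContinuousMap.sub_apply, ContinuousMap.mul_apply,
      ContinuousMap.smul_apply, smul_eq_mul]
    ring
  rw [e2]
  simp only [integral_continuousMap_add, integral_continuousMap_sub, integral_continuousMap_smul]
  ring

end Metric

/-! ### Antiderivatives and the variational lemma -/

theorem integral_eq_zero_of_isDer {f g : C(UnitAddCircle, ℝ)} (h : IsDer f g) :
    ∫ x in (0:ℝ)..1, g (x : UnitAddCircle) = 0 := by
  rw [intervalIntegral.integral_eq_sub_of_hasDerivAt (fun x _ => h x)
    (intervalIntegrable_of_continuousMap g 0 1)]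
  have h3 : ((1 : ℝ) : UnitAddCircle) = ((0 : ℝ) : UnitAddCircle) := AddCircle.coe_period 1
  rw [h3, sub_self]

theorem exists_antiderivative {f : C(UnitAddCircle, ℝ)}
    (hf : ∫ x in (0:ℝ)..1, f (x : UnitAddCircle) = 0) :
    ∃ F : C(UnitAddCircle, ℝ), IsDer F f ∧ F ((0 : ℝ) : UnitAddCircle) = 0 := by
  set P : ℝ → ℝ := fun x => ∫ y in (0:ℝ)..x, f (y : UnitAddCircle) with hP
  have hper : Function.Periodic P 1 := fun x => by
    have h1 : Function.Periodic (fun y : ℝ => f (y : UnitAddCircle)) 1 := fun y => by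
      simp only [AddCircle.coe_add_period]
    have h2 := h1.intervalIntegral_add_eq 0 x
    rw [zero_add, hf] at h2
    rw [hP]
    simp only
    rw [← intervalIntegral.integral_add_adjacent_intervals
      (intervalIntegrable_of_continuousMap f 0 x) (intervalIntegrable_of_continuousMap f x (x + 1)),
      ← h2, add_zero]
  have hd : ∀ x : ℝ, HasDerivAt P (f (x : UnitAddCircle)) x := fun x =>
    (continuous_coe_circle f).integral_hasStrictDerivAt 0 x |>.hasDerivAt
  have hc : Continuous P := continuous_iff_continuousAt.mpr fun x => (hd x).continuousAt
  refine ⟨⟨hper.lift, continuous_coinduced_dom.mpr hc⟩, hd, ?_⟩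
  change P 0 = 0
  simp [hP]

/-- For k ≠ 0 the coefficients satisfy |F̂| ≤ |f̂|, since |2πk| ≥ 1; the mean k = 0 is controlled by
the L² norm of F. This makes the primitive an admissible tangent vector. -/
theorem sn_antiderivative_ne_top {F f : C(UnitAddCircle, ℝ)} (h : IsDer F f) {r : ℝ}
    (hf : sn r f ≠ ⊤) : sn (r + 1) F ≠ ⊤ := by
  refine sn_add_one_ne_top h (ne_top_of_le_ne_top
    (ENNReal.add_ne_top.mpr ⟨sn_zero_ne_top F, hf⟩) ?_) hf
  unfold sn
  rw [← ENNReal.tsum_add]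
  refine ENNReal.tsum_le_tsum fun k => ?_
  rcases eq_or_ne k 0 with rfl | hk
  · simp
  · refine le_add_left ?_
    gcongr
    rw [fc_of_isDer h, enorm_mul]
    refine le_mul_of_one_le_left zero_le ?_
    rw [← ofReal_norm, ← ENNReal.ofReal_one]
    refine ENNReal.ofReal_le_ofReal ?_
    simp only [norm_mul, Complex.norm_I, Complex.norm_real, Complex.norm_intCast,
      Complex.norm_ofNat, mul_one]
    have h1 : (1 : ℝ) ≤ |(k : ℝ)| := by exact_mod_cast Int.one_le_abs hk
    rw [Real.norm_of_nonneg Real.pi_pos.le]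
    nlinarith [Real.pi_gt_three]

theorem eq_zero_of_integral_sq {f : C(UnitAddCircle, ℝ)}
    (h : ∫ x in (0:ℝ)..1, (f * f) (x : UnitAddCircle) = 0) : f = 0 := by
  have h1 : sn 0 f = 0 := by
    rw [sn_zero]
    simp only [sq]
    rw [ENNReal.ofReal_eq_zero]
    exact h.le
  refine eq_of_fc_eq fun k => ?_
  have h2 := ENNReal.tsum_eq_zero.mp h1 k
  simp only [Real.rpow_zero, ENNReal.ofReal_one, one_mul, pow_eq_zero_iff two_ne_zero,
    enorm_eq_zero] at h2
  rw [h2, ← sub_self (0 : C(UnitAddCircle, ℝ)), fc_sub, sub_self]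

/-! ### The geodesic equation -/

section Equivalence

variable {s κ : ℝ} {c : H0 s × Hs (s - 1)} {φ : CircleDiffeo} {U V : H0 s × Hs (s - 1)}
  {U' V' : C(UnitAddCircle, ℝ)}

/-- The Levi-Civita acceleration vanishes iff the geodesic equation holds in Lagrangian
coordinates. -/
theorem forall_metric_eq_zero_iff (hs : 5 / 2 < s) (hκ : κ ≠ 0) (hφ : φ.h = c.1.1.1)
    (hU : IsDer U.1.1.1 U') (hV : IsDer V.1.1.1 V') :
    (∀ Z, metric κ c V Z + christoffelFirst κ c U U Z = 0) ↔
      V.2.1 * (1 + φ.h') + U.2.1 * U' = 0 ∧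
      ∃ m : ℝ, V' * φ.R - (1 / 2 : ℝ) • ((U' * φ.R) * (U' * φ.R) + κ • (U.2.1 * U.2.1)) =
        ContinuousMap.const _ m := by
  set Q := V.2.1 * (1 + φ.h') + U.2.1 * U' with hQ
  set P := V' * φ.R - (1 / 2 : ℝ) • ((U' * φ.R) * (U' * φ.R) + κ • (U.2.1 * U.2.1)) with hP
  have q1 : 1 / 2 < s - 1 := by linarith
  have fh : sn (s - 1) φ.h' ≠ ⊤ := sn_ne_top_of_isDer φ.isDer (by
    rw [hφ, sub_add_cancel]; exact c.1.1.sn_ne_top)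
  have fR : sn (s - 1) φ.R ≠ ⊤ := CircleDiffeo.sn_R_ne_top (by linarith)
    (circleDiffeo_sn_ne_top hφ)
  have fU : sn (s - 1) U' ≠ ⊤ := sn_ne_top_of_isDer hU (by
    rw [sub_add_cancel]; exact U.1.1.sn_ne_top)
  have fV : sn (s - 1) V' ≠ ⊤ := sn_ne_top_of_isDer hV (by
    rw [sub_add_cancel]; exact V.1.1.sn_ne_top)
  have fU2 := U.2.sn_ne_top
  have fV2 := V.2.sn_ne_top
  have fconst : ∀ (m : ℝ) {f : C(UnitAddCircle, ℝ)}, sn (s - 1) f ≠ ⊤ →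
      sn (s - 1) (m • f) ≠ ⊤ := fun m f hf => (m • Hs.ofFun f hf).sn_ne_top
  have fQ : sn (s - 1) Q ≠ ⊤ :=
    sn_add_ne_top (sn_mul_ne_top q1 fV2 (sn_add_ne_top (sn_const_one_ne_top _) fh))
      (sn_mul_ne_top q1 fU2 fU)
  have fP : sn (s - 1) P ≠ ⊤ :=
    sn_sub_ne_top (sn_mul_ne_top q1 fV fR) (fconst _ (sn_add_ne_top
      (sn_mul_ne_top q1 (sn_mul_ne_top q1 fU fR) (sn_mul_ne_top q1 fU fR))
      (fconst _ (sn_mul_ne_top q1 fU2 fU2))))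
  constructor
  · intro h
    constructor
    -- The test vector (0, Q) is admissible since Q ∈ H^{s-1}; it yields κ∫Q² = 0.
    · have h1 := h (0, Hs.ofFun Q fQ)
      rw [metric_add_christoffelFirst_eq κ hφ hU hV (Z' := 0)
        (fun x => hasDerivAt_const x (0 : ℝ))] at h1
      change 1 / 4 * ∫ x in (0:ℝ)..1, (0 * P + κ • (Q * Q)) (x : UnitAddCircle) = 0 at h1
      rw [zero_mul, zero_add, integral_continuousMap_smul] at h1
      refine eq_zero_of_integral_sq ?_
      simpa [hκ] using h1
    -- Du Bois-Reymond argument: the first test component is the periodic primitive F of P minus its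
    -- mean m. Then ∫(P - m)P = ∫(P - m)², because P - m has mean zero.
    · set m := ∫ x in (0:ℝ)..1, P (x : UnitAddCircle) with hm
      refine ⟨m, ?_⟩
      have hint : ∫ x in (0:ℝ)..1, (P - m • (1 : C(UnitAddCircle, ℝ))) (x : UnitAddCircle) = 0 := by
        rw [integral_continuousMap_sub, integral_continuousMap_smul]
        simp [hm]
      obtain ⟨F, hF, hF0⟩ := exists_antiderivative hint
      have fF : sn s F ≠ ⊤ := by
        have := sn_antiderivative_ne_top hF
          (sn_sub_ne_top fP (fconst m (sn_const_one_ne_top (s - 1))))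
        rwa [sub_add_cancel] at this
      have h1 := h (⟨Hs.ofFun F fF, hF0⟩, 0)
      rw [metric_add_christoffelFirst_eq κ hφ hU hV hF] at h1
      change 1 / 4 * ∫ x in (0:ℝ)..1, ((P - m • (1 : C(UnitAddCircle, ℝ))) * P +
        κ • (0 * Q)) (x : UnitAddCircle) = 0 at h1
      have e : (P - m • (1 : C(UnitAddCircle, ℝ))) * P + κ • (0 * Q) =
          (P - m • (1 : C(UnitAddCircle, ℝ))) * (P - m • (1 : C(UnitAddCircle, ℝ))) +
            m • (P - m • (1 : C(UnitAddCircle, ℝ))) := by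
        ext x
        simp only [ContinuousMap.add_apply, ContinuousMap.sub_apply, ContinuousMap.mul_apply,
          ContinuousMap.smul_apply, smul_eq_mul, ContinuousMap.zero_apply, ContinuousMap.one_apply]
        ring
      rw [e, integral_continuousMap_add, integral_continuousMap_smul, hint] at h1
      have h2 := eq_zero_of_integral_sq (f := P - m • (1 : C(UnitAddCircle, ℝ))) (by linarith)
      rw [sub_eq_zero] at h2
      rw [h2]
      ext x
      simp
  · rintro ⟨hQ0, m, hPm⟩ Z
    obtain ⟨Z', hZ⟩ := exists_isDer (by linarith) Z.1.1.sn_ne_top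
    rw [metric_add_christoffelFirst_eq κ hφ hU hV hZ]
    change 1 / 4 * ∫ x in (0:ℝ)..1, (Z' * P + κ • (Z.2.1 * Q)) (x : UnitAddCircle) = 0
    -- Only m Z' remains, and the derivative of a periodic function integrates to zero.
    have e : Z' * P + κ • (Z.2.1 * Q) = m • Z' := by
      rw [hQ0, hPm]
      ext x
      simp [mul_comm]
    rw [e, integral_continuousMap_smul, integral_eq_zero_of_isDer hZ]
    simp

/-- The inner integral of g' is g(y) - g(0); the two contributions x g(0) cancel. -/
theorem Ainv_deriv_eq {g g' : C(UnitAddCircle, ℝ)} (hg : IsDer g g') (x : ℝ) :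
    Ainv (deriv fun y : ℝ => g (y : UnitAddCircle)) x =
      -(∫ y in (0:ℝ)..x, g (y : UnitAddCircle)) + x * ∫ y in (0:ℝ)..1, g (y : UnitAddCircle) := by
  have h1 : (deriv fun y : ℝ => g (y : UnitAddCircle)) = fun y : ℝ => g' (y : UnitAddCircle) :=
    funext fun y => (hg y).deriv
  have h2 : ∀ y : ℝ, ∫ z in (0:ℝ)..y, g' (z : UnitAddCircle) =
      g (y : UnitAddCircle) - g ((0 : ℝ) : UnitAddCircle) := fun y =>
    intervalIntegral.integral_eq_sub_of_hasDerivAt (fun z _ => hg z)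
      (intervalIntegrable_of_continuousMap g' 0 y)
  unfold Ainv
  rw [h1]
  simp only [h2]
  rw [intervalIntegral.integral_sub (intervalIntegrable_of_continuousMap _ _ _)
      intervalIntegrable_const, intervalIntegral.integral_sub
      (intervalIntegrable_of_continuousMap _ _ _) intervalIntegrable_const,
    intervalIntegral.integral_const, intervalIntegral.integral_const]
  simp only [smul_eq_mul]
  ring

theorem T_injective (φ : CircleDiffeo) {f g : C(UnitAddCircle, ℝ)} (h : φ.T f = φ.T g) :
    f = g := by
  refine CircleDiffeo.ext_coe fun x => ?_
  have := congrArg (fun q : C(UnitAddCircle, ℝ) => q (φ.lift x : UnitAddCircle)) h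
  simpa only [CircleDiffeo.T_coe, φ.inv_lift] using this

/-- The first equation of the weak system in terms of the acceleration. -/
theorem acceleration_eq_iff {v v' g g' : C(UnitAddCircle, ℝ)} (hv : IsDer v v')
    (hv0 : v ((0 : ℝ) : UnitAddCircle) = 0) (hg : IsDer g g') :
    (∀ x : ℝ, v (x : UnitAddCircle) =
      -(1 / 2) * Ainv (deriv fun y : ℝ => g (y : UnitAddCircle)) x) ↔
      ∃ m : ℝ, v' - (1 / 2 : ℝ) • g = ContinuousMap.const _ m := by
  set M := ∫ y in (0:ℝ)..1, g (y : UnitAddCircle) with hM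
  have hd : ∀ x : ℝ, HasDerivAt (fun x : ℝ => -(1 / 2) *
      (-(∫ y in (0:ℝ)..x, g (y : UnitAddCircle)) + x * M))
      (-(1 / 2) * (-g (x : UnitAddCircle) + 1 * M)) x := fun x =>
    (((((continuous_coe_circle g).integral_hasStrictDerivAt 0 x).hasDerivAt).neg).add
      ((hasDerivAt_id x).mul_const M)).const_mul _
  simp only [Ainv_deriv_eq hg, ← hM]
  constructor
  · intro h
    refine ⟨-(1 / 2) * M, CircleDiffeo.ext_coe fun x => ?_⟩
    have h1 := (hv x).unique ((hd x).congr_of_eventuallyEq (.of_forall h))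
    rw [ContinuousMap.sub_apply, ContinuousMap.smul_apply, h1, ContinuousMap.const_apply,
      smul_eq_mul]
    ring
  · rintro ⟨m, hm⟩
    have hm1 : v' = (1 / 2 : ℝ) • g + m • (1 : C(UnitAddCircle, ℝ)) := by
      rw [sub_eq_iff_eq_add] at hm
      rw [hm]
      ext x
      simp [add_comm]
    -- The constant is forced: v' has mean zero, being the derivative of a periodic function.
    have hmM : m = -(1 / 2) * M := by
      have h1 := integral_eq_zero_of_isDer hv
      rw [hm1, integral_continuousMap_add, integral_continuousMap_smul,
        integral_continuousMap_smul, ← hM] at h1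
      simp at h1
      linarith
    have hconst : ∀ x y : ℝ, v (x : UnitAddCircle) - -(1 / 2) *
        (-(∫ y in (0:ℝ)..x, g (y : UnitAddCircle)) + x * M) =
        v (y : UnitAddCircle) - -(1 / 2) *
        (-(∫ z in (0:ℝ)..y, g (z : UnitAddCircle)) + y * M) := by
      refine is_const_of_deriv_eq_zero
        (fun x => ((hv x).sub (hd x)).differentiableAt) fun x => ?_
      refine ((hv x).sub (hd x)).deriv.trans ?_
      rw [hm1, hmM]
      simp only [ContinuousMap.add_apply, ContinuousMap.smul_apply, smul_eq_mul,
        ContinuousMap.one_apply]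
      ring
    intro x
    have h1 := hconst x 0
    rw [hv0, intervalIntegral.integral_same] at h1
    linarith

/-- The weak Hunter–Saxton system, expressed through the acceleration, is the geodesic equation in
Lagrangian coordinates. -/
theorem weakHunterSaxton_iff (hs : 5 / 2 < s) (hφ : φ.h = c.1.1.1)
    (hU : IsDer U.1.1.1 U') (hV : IsDer V.1.1.1 V') {ux ρx : C(UnitAddCircle, ℝ)}
    (hux : IsDer (φ.T U.1.1.1) ux) (hρx : IsDer (φ.T U.2.1) ρx) :
    WeakHunterSaxton κ (toIdentity c U)
        (fun x : ℝ => (φ.T V.1.1.1 - φ.T U.1.1.1 * ux) (x : UnitAddCircle),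
          fun x : ℝ => (φ.T V.2.1 - φ.T U.1.1.1 * ρx) (x : UnitAddCircle)) ↔
      V.2.1 * (1 + φ.h') + U.2.1 * U' = 0 ∧
      ∃ m : ℝ, V' * φ.R - (1 / 2 : ℝ) • ((U' * φ.R) * (U' * φ.R) + κ • (U.2.1 * U.2.1)) =
        ContinuousMap.const _ m := by
  have hux' : ux = φ.T (U' * φ.R) := hux.unique (φ.isDer_T hU)
  have du : ∀ x : ℝ, deriv (fun x : ℝ => φ.T U.1.1.1 (x : UnitAddCircle)) x =
      ux (x : UnitAddCircle) := fun x => (hux x).deriv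
  have dρ : ∀ x : ℝ, deriv (fun x : ℝ => φ.T U.2.1 (x : UnitAddCircle)) x =
      ρx (x : UnitAddCircle) := fun x => (hρx x).deriv
  set G := (U' * φ.R) * (U' * φ.R) + κ • (U.2.1 * U.2.1) with hG
  have hTG : ∀ y : ℝ, ux (y : UnitAddCircle) ^ 2 + κ * φ.T U.2.1 (y : UnitAddCircle) ^ 2 =
      φ.T G (y : UnitAddCircle) := fun y => by
    rw [hux', hG]
    simp only [CircleDiffeo.T_coe, ContinuousMap.add_apply, ContinuousMap.mul_apply,
      ContinuousMap.smul_apply, smul_eq_mul]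
    ring
  have dG : ∃ G', IsDer G G' := by
    refine exists_isDer (r := s - 1) (by linarith) ?_
    have q1 : 1 / 2 < s - 1 := by linarith
    have fU : sn (s - 1) U' ≠ ⊤ := sn_ne_top_of_isDer hU (by
      rw [sub_add_cancel]; exact U.1.1.sn_ne_top)
    have fR : sn (s - 1) φ.R ≠ ⊤ := CircleDiffeo.sn_R_ne_top (by linarith)
      (circleDiffeo_sn_ne_top hφ)
    have fUR := sn_mul_ne_top q1 fU fR
    have fU2 := sn_mul_ne_top q1 U.2.sn_ne_top U.2.sn_ne_top
    exact sn_add_ne_top (sn_mul_ne_top q1 fUR fUR) (κ • Hs.ofFun _ fU2).sn_ne_top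
  obtain ⟨G', hG'⟩ := dG
  have h1 := acceleration_eq_iff (φ.isDer_T hV) (T_zero_of_zero φ V.1.2) (φ.isDer_T hG')
  have hfirst : (∃ m : ℝ, φ.T (V' * φ.R) - (1 / 2 : ℝ) • φ.T G = ContinuousMap.const _ m) ↔
      -- Composition with φ⁻¹ is injective and fixes constants, so constancy may be tested in either
      -- coordinate.
      ∃ m : ℝ, V' * φ.R - (1 / 2 : ℝ) • G = ContinuousMap.const _ m := by
    have e1 : φ.T (V' * φ.R - (1 / 2 : ℝ) • G) = φ.T (V' * φ.R) - (1 / 2 : ℝ) • φ.T G :=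
      CircleDiffeo.ext_coe fun _ => rfl
    have e2 : ∀ m : ℝ, φ.T (ContinuousMap.const _ m) = ContinuousMap.const _ m := fun m =>
      CircleDiffeo.ext_coe fun _ => rfl
    refine exists_congr fun m => ⟨fun h => T_injective φ ?_, fun h => ?_⟩
    · rw [e1, e2, h]
    · rw [← e1, h, e2]
  have hsecond : (∀ x : ℝ, φ.T V.2.1 (x : UnitAddCircle) =
      -(φ.T U.2.1 (x : UnitAddCircle) * ux (x : UnitAddCircle))) ↔
      V.2.1 * (1 + φ.h') + U.2.1 * U' = 0 := by
    rw [hux']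
    constructor
    · intro h
      refine CircleDiffeo.ext_coe fun x => ?_
      have h2 := h (φ.lift x)
      simp only [CircleDiffeo.T_coe, φ.inv_lift, ContinuousMap.mul_apply] at h2
      have h3 := φ.recip_apply (x : UnitAddCircle)
      simp only [ContinuousMap.add_apply, ContinuousMap.mul_apply, ContinuousMap.one_apply,
        ContinuousMap.zero_apply]
      rw [h2]
      linear_combination (-(U.2.1 (x : UnitAddCircle) * U' (x : UnitAddCircle))) * h3
    · intro h x
      have h2 := congrArg (fun q : C(UnitAddCircle, ℝ) => q (φ.inv x : UnitAddCircle)) h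
      have h3 := φ.recip_apply (φ.inv x : UnitAddCircle)
      simp only [ContinuousMap.add_apply, ContinuousMap.mul_apply, ContinuousMap.one_apply,
        ContinuousMap.zero_apply] at h2
      simp only [CircleDiffeo.T_coe, ContinuousMap.mul_apply]
      linear_combination φ.R (φ.inv x : UnitAddCircle) * h2 -
        V.2.1 (φ.inv x : UnitAddCircle) * h3
  rw [← hfirst, ← h1, ← hsecond, toIdentity_eq hφ]
  unfold WeakHunterSaxton
  -- The convective terms cancel against those in (u_t, ρ_t), leaving φ_tt ∘ φ⁻¹ and α_tt ∘ φ⁻¹.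
  simp only [du, dρ, hTG, ContinuousMap.sub_apply (φ.T _), ContinuousMap.mul_apply (φ.T _),
    sub_add_cancel]
  rw [forall_and, and_comm]

/-- The geodesic equation for the Christoffel operator is the weak Hunter–Saxton system. -/
theorem eq_christoffel_iff (hφ : φ.h = c.1.1.1) {ux ρx : C(UnitAddCircle, ℝ)}
    (hux : IsDer (φ.T U.1.1.1) ux) (hρx : IsDer (φ.T U.2.1) ρx) :
    pairFun V = christoffel κ c U U ↔
      WeakHunterSaxton κ (toIdentity c U)
        (fun x : ℝ => (φ.T V.1.1.1 - φ.T U.1.1.1 * ux) (x : UnitAddCircle),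
          fun x : ℝ => (φ.T V.2.1 - φ.T U.1.1.1 * ρx) (x : UnitAddCircle)) := by
  have h1 : diffeo c = φ.lift := by
    unfold diffeo CircleDiffeo.lift
    rw [hφ]
    rfl
  have du : ∀ x : ℝ, deriv (fun x : ℝ => φ.T U.1.1.1 (x : UnitAddCircle)) x =
      ux (x : UnitAddCircle) := fun x => (hux x).deriv
  have dρ : ∀ x : ℝ, deriv (fun x : ℝ => φ.T U.2.1 (x : UnitAddCircle)) x =
      ρx (x : UnitAddCircle) := fun x => (hρx x).deriv
  have hsq : (fun y : ℝ => ux (y : UnitAddCircle) * ux (y : UnitAddCircle) +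
      κ * (φ.T U.2.1 (y : UnitAddCircle) * φ.T U.2.1 (y : UnitAddCircle))) =
      fun y : ℝ => ux (y : UnitAddCircle) ^ 2 + κ * φ.T U.2.1 (y : UnitAddCircle) ^ 2 := by
    funext y
    ring
  rw [christoffel, toIdentity_eq hφ, h1]
  unfold WeakHunterSaxton christoffelId
  simp only [du, dρ, hsq, ContinuousMap.sub_apply (φ.T _), ContinuousMap.mul_apply (φ.T _),
    sub_add_cancel]
  constructor
  -- The two forms differ by composition with φ: evaluation at φ⁻¹(x) gives one direction, at φ(x)
  -- the other.
  · intro h x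
    have e1 := congrFun (congrArg Prod.fst h) (φ.inv x)
    have e2 := congrFun (congrArg Prod.snd h) (φ.inv x)
    simp only [Function.comp, φ.lift_inv] at e1 e2
    refine ⟨e1, Eq.trans e2 (by ring)⟩
  · intro h
    refine Prod.ext (funext fun x => ?_) (funext fun x => ?_)
    · have e := (h (φ.lift x)).1
      rw [CircleDiffeo.T_coe, φ.inv_lift] at e
      exact e
    · have e := (h (φ.lift x)).2
      rw [CircleDiffeo.T_coe, φ.inv_lift] at e
      refine Eq.trans e ?_
      simp only [Function.comp]
      ring

end Equivalence

/-! ### The main theorem -/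

theorem proposition3p1
    (κ : ℝ) (hκ : κ = 1 ∨ κ = -1) (s : ℝ) (hs : 5 / 2 < s)
    (J : Set ℝ) (hJopen : IsOpen J) (hJint : J.OrdConnected)
    (c : ℝ → H0 s × Hs (s - 1)) (hc : ContDiffOn ℝ 2 c J) (hcG : ∀ t ∈ J, c t ∈ Gs s) :
    -- `(u, ρ) ∈ C(J; H_0^s × H^{s-1})`
    (∃ v : ℝ → H0 s × Hs (s - 1),
      (∀ t ∈ J, pairFun (v t) = eulerian c t) ∧ ContinuousOn v J) ∧
    -- `(u, ρ) ∈ C¹(J; H_0^{s-1} × H^{s-2})`; `deriv w t` is then `(u_t, ρ_t)`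
    (∃ w : ℝ → H0 (s - 1) × Hs (s - 2),
      (∀ t ∈ J, pairFun (w t) = eulerian c t) ∧ ContDiffOn ℝ 1 w J ∧
      (IsMetricGeodesic κ c J ↔
        ∀ t ∈ J, WeakHunterSaxton κ (eulerian c t) (pairFun (deriv w t))) ∧
      (IsChristoffelGeodesic κ c J ↔
        ∀ t ∈ J, WeakHunterSaxton κ (eulerian c t) (pairFun (deriv w t)))) := by
  have hκ0 : κ ≠ 0 := by
    rcases hκ with rfl | rfl <;> norm_num
  have h2 : ContDiffOn ℝ (1 + 1) c J := by rwa [one_add_one_eq_two]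
  have h1 : ContDiffOn ℝ 1 (deriv c) J := ((contDiffOn_succ_iff_deriv_of_isOpen hJopen).mp h2).2.2
  refine ⟨exists_continuousOn_eulerian hs hc.continuousOn h1.continuousOn hcG, ?_⟩
  obtain ⟨w, hw, hwc, hwd⟩ := exists_contDiffOn_eulerian hs hJopen hc hcG
  -- With the formula for the time derivative of w, both equivalences hold separately at each
  -- instant.
  refine ⟨w, hw, hwc, forall₂_congr fun t ht => ?_, forall₂_congr fun t ht => ?_⟩
  · obtain ⟨φ, hφ, ux, ρx, hux, hρx, hd⟩ := hwd t ht
    obtain ⟨U', hU'⟩ := exists_isDer (by linarith) (deriv c t).1.1.sn_ne_top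
    obtain ⟨V', hV'⟩ := exists_isDer (by linarith) (deriv (deriv c) t).1.1.sn_ne_top
    rw [hd, eulerian, weakHunterSaxton_iff hs hφ hU' hV' hux hρx]
    exact forall_metric_eq_zero_iff hs hκ0 hφ hU' hV'
  · obtain ⟨φ, hφ, ux, ρx, hux, hρx, hd⟩ := hwd t ht
    rw [hd, eulerian]
    exact eq_christoffel_iff hφ hux hρx
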